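/- **Setting.** Let $E$ be a directed graph with vertex set $E^0$, set of directed edges $E^1_+$, and origin and terminus maps $o,t:E^1_+\to E^0$ (loops, multiple edges and arbitrary cardinalities are allowed). Each $e\in E^1_+$ has a formal reversal $\bar e$ with $o(\bar e)=t(e)$, $t(\bar e)=o(e)$. A path is a sequence of composable edges $e$ or $\bar e$ without backtracking; it is directed if only edges of $E^1_+$ occur. Put $\Sigma(E)=\{u\in E^0: 0<\#o^{-1}(u)<\infty\}$, $o^{-1}(u)$ being taken in $E^1_+$. Let $G$ be the discrete groupoid of all finite paths $p$ (those of length $0$ being the vertices), with range $o(p)$, source $t(p)$, and multiplication given by concatenation followed by cancellation of pairs $e\bar e$ and $\bar e e$. For $u\in E^0$ let $T_u$ be the directed tree whose vertices are the paths with origin $u$ and whose directed edges are the pairs $(p,q)$ with $p^{-1}q\in E^1_+$. For a directed tree $T$ with vertex set $T^0$ and $v\in T^0$ let $V(v)\subseteq T^0$ be the set of termini of finite directed paths from $v$. For a finite set $F$ of directed edges with origin $v$ let $V(v;F)=\{v\}\cup\bigcup_{e}V(t(e))$, the union being over the directed edges $e\notin F$ with origin $v$. Let $\mathcal A(T)$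 be the ring of finite disjoint unions of such sets $V(v;F)$ (with $\emptyset$), and let $\widehat{A}(T)$ be the space of $\mathcal A(T)$-ultrafilters, with the sets $[B]=\{\mathcal U: B\in\mathcal U\}$, $B\in\mathcal A(T)$, as a base of the topology. (This is the spectrum of the commutative C*-algebra $A(T)=\overline{\mathrm{span}}\{\chi_B:B\in\mathcal A(T)\}\subseteq\ell^\infty(T^0)$.) A vertex $v$ is identified with its fixed ultrafilter $\{B: v\in B\}$, and an infinite directed path $p_0,p_1,\dots$ (listed by its vertices) defines the point $\{B: V(p_j)\subseteq B\text{ for some }j\}$. The groupoid $G$ acts on the disjoint union $\bigsqcup_u\widehat A(T_u)$ by left multiplication of paths: an $\alpha\in G$ with source $s$ and range $r$ maps $\widehat A(T_s)$ onto $\widehat A(T_r)$. For $S\subseteq\Sigma(E)$ let $X(E,S)$ be the set of the points of $\bigsqcup_u\widehat A(T_u)$ that are given by a finite directed path $p$ of $E$ with $t(p)\notin S$ (a vertex of $T_{o(p)}$) or by an infinite directed path of $E$ (an infinite directed path in $T_u$ starting at the vertex $u$, where $u$ is its origin). Let $\mathcal{TG}(E,S)$ be the groupoid of all pairs $(\alpha,x)$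 with $\alpha\in G$, $x\in X(E,S)\cap\widehat A(T_{s(\alpha)})$ and $\alpha x\in X(E,S)$, with $(\alpha,\beta x)(\beta,x)=(\alpha\beta,x)$, $(\alpha,x)^{-1}=(\alpha^{-1},\alpha x)$ and the relative product topology ($G$ being discrete). The *Toeplitz graph algebra* $\mathcal{TO}(E,S)$ is the groupoid C*-algebra $C^*(\mathcal{TG}(E,S))$, that is, the completion of the convolution $*$-algebra $C_c(\mathcal{TG}(E,S))$ in the supremum of the seminorms $f\mapsto\|\pi(f)\|$ over its ($I$-norm bounded) $*$-representations $\pi$ on Hilbert spaces. One writes $\mathcal{TO}(E)=\mathcal{TO}(E,\emptyset)$, and $\mathcal O(E)=\mathcal{TO}(E,\Sigma(E))$ is the graph algebra of $E$. **Theorem 2.20.** Let $S\subseteq\Sigma(E)$. For $e\in E^1_+$ and $u\in E^0$ the characteristic functions $\chi_{\{e\}\times[V(t(e))]}$ and $\chi_{\{u\}\times[V(u)]}$ belong to $C_c(\mathcal{TG}(E,S))$ (here $V(t(e))$ and $V(u)$ are formed in $T_{t(e)}$ and $T_u$ at the paths of length zero, and $[\cdot]$ is restricted to $X(E,S)$).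 For every complex Hilbert space $H$ the assignment $$\pi\longmapsto\Bigl(S_e=\pi\bigl(\chi_{\{e\}\times[V(t(e))]}\bigr),\ P_u=\pi\bigl(\chi_{\{u\}\times[V(u)]}\bigr)\Bigr)_{e\in E^1_+,\,u\in E^0}$$ is a bijection from the set of nondegenerate $*$-representations of $\mathcal{TO}(E,S)$ on $H$ onto the set of families $\{S_e\}_{e\in E^1_+}$, $\{P_u\}_{u\in E^0}$ of bounded operators on $H$ such that 1. the $S_e$ are partial isometries and the $P_u$ are projections; 2. $P_uP_v=0$ for $u\ne v$; 3. $\sum_{u}P_u=1$ in the strong operator topology; 4. $S_e^*S_e=P_{t(e)}$ for all $e$; 5. $P_u\ge\sum_{o(f)=u}S_fS_f^*$ for all $u\in E^0$ (the sum existing in the strong operator topology), with equality for all $u\in S$. -/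

import Mathlib

open scoped ENNReal CompactlySupported

noncomputable section

/-- A directed graph, given by its directed edges `E` (the set `E¹₊`) with their origins and
termini.  Loops and parallel edges are allowed, and there is no restriction on cardinality.
The full edge set `E¹` (with the reversed edges) is `E × Bool`: `(e, true)` is `e` itself and
`(e, false)` is its reversal. -/
structure DirectedGraph (V : Type*) (E : Type*) where
  /-- origin of a directed edge -/
  o : E → V
  /-- terminus of a directed edge -/
  t : E → V

namespace DirectedGraph

section Basic

variable {V E : Type*} (Γ : DirectedGraph V E)

/-- `Δ₁(v)`: the directed edges with origin `v`. -/
def outEdges (v : V) : Set E := {e | Γ.o e = v}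

/-- `Σ`: the vertices that emit finitely many, and at least one, directed edges. -/
def regular : Set V := {u | (Γ.outEdges u).Nonempty ∧ (Γ.outEdges u).Finite}

/-- There is a directed edge from `a` to `b`. -/
def Step (a b : V) : Prop := ∃ e, Γ.o e = a ∧ Γ.t e = b

/-- `V(v)`: the termini of the finite directed paths (possibly of length zero) with origin `v`. -/
def reach (v : V) : Set V := {w | Relation.ReflTransGen Γ.Step v w}

/-- `V(v; F) = {v} ∪ ⋃ {V(t(e)) : e ∈ Δ₁(v) ∖ F}`. -/
def cyl (v : V) (F : Set E) : Set V := {v} ∪ ⋃ e ∈ Γ.outEdges v \ F, Γ.reach (Γ.t e)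

/-- The family of all `V(v; F)`, with `F ⊆ Δ₁(v)` finite, together with the empty set. -/
def basicSets : Set (Set V) :=
  {B | ∃ v F, F ⊆ Γ.outEdges v ∧ F.Finite ∧ B = Γ.cyl v F} ∪ {∅}

/-- The finite disjoint unions of basic sets (for a directed tree this is a ring of sets). -/
def ring : Set (Set V) :=
  {B | ∃ C : Set (Set V), C ⊆ Γ.basicSets ∧ C.Finite ∧ C.PairwiseDisjoint id ∧ B = ⋃₀ C}

end Basic

/-- A proper nonempty filter in the family of sets `R`. -/
structure IsRingFilter {X : Type*} (R : Set (Set X)) (U : Set (Set X)) : Prop where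
  subset : U ⊆ R
  nonempty : U.Nonempty
  empty_notMem : ∅ ∉ U
  inter_mem : ∀ B ∈ U, ∀ C ∈ U, B ∩ C ∈ U
  mem_of_superset : ∀ B ∈ U, ∀ C ∈ R, B ⊆ C → C ∈ U

section Spectrum

variable {V E : Type*} (T : DirectedGraph V E)

/-- For a directed tree `T`, the spectrum of the commutative C*-algebra `A(T) ⊆ ℓ^∞(T⁰)`, the
closed span of the characteristic functions of the sets in `T.ring`: its points are
the ultrafilters (maximal filters) in the ring of sets `T.ring`. -/
def Spectrum : Type _ := {U : Set (Set V) // Maximal (IsRingFilter T.ring) U}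

variable {T} in
/-- `[B]`: the ultrafilters containing `B`. -/
def Spectrum.supp (B : Set V) : Set T.Spectrum := {U | B ∈ U.1}

/-- The Gelfand (= Stone) topology: the sets `[B]`, for `B` in the ring, are a base. -/
instance : TopologicalSpace T.Spectrum :=
  TopologicalSpace.generateFrom (Spectrum.supp '' T.ring)

/-- The fixed ultrafilter of the vertex `v`. -/
def fixedFilter (v : V) : Set (Set V) := {B ∈ T.ring | v ∈ B}

/-- Infinite directed paths. -/
def IsInfinitePath (ω : ℕ → E) : Prop := ∀ n, T.t (ω n) = T.o (ω (n + 1))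

/-- The filter of an infinite directed path `ω`: the sets of the ring that contain `V(o(ω_j))`
for some `j`. -/
def pathFilter (ω : ℕ → E) : Set (Set V) := {B ∈ T.ring | ∃ j, T.reach (T.o (ω j)) ⊆ B}

/-- The space `∂(T, S)`: the points of the spectrum that are not the fixed
ultrafilter of a vertex in `S`. -/
def boundary (S : Set V) : Set T.Spectrum := {U | ∀ v ∈ S, U.1 ≠ T.fixedFilter v}

end Spectrum

/-- Isomorphisms of directed graphs. -/
structure Iso {V₁ E₁ V₂ E₂ : Type*} (T₁ : DirectedGraph V₁ E₁) (T₂ : DirectedGraph V₂ E₂) where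
  vert : V₁ ≃ V₂
  edge : E₁ ≃ E₂
  o_edge : ∀ e, T₂.o (edge e) = vert (T₁.o e)
  t_edge : ∀ e, T₂.t (edge e) = vert (T₁.t e)

namespace Iso

variable {V₁ E₁ V₂ E₂ : Type*} {T₁ : DirectedGraph V₁ E₁} {T₂ : DirectedGraph V₂ E₂}

def symm (φ : Iso T₁ T₂) : Iso T₂ T₁ where
  vert := φ.vert.symm
  edge := φ.edge.symm
  o_edge e := by
    rw [Equiv.eq_symm_apply, ← φ.o_edge, Equiv.apply_symm_apply]
  t_edge e := by
    rw [Equiv.eq_symm_apply, ← φ.t_edge, Equiv.apply_symm_apply]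

theorem reach_sub (φ : Iso T₁ T₂) (v : V₁) : φ.vert '' T₁.reach v ⊆ T₂.reach (φ.vert v) := by
  rintro _ ⟨w, hw, rfl⟩
  have hw' : Relation.ReflTransGen T₁.Step v w := hw
  have key : ∀ a b, T₁.Step a b → T₂.Step (φ.vert a) (φ.vert b) := by
    rintro a b ⟨e, rfl, rfl⟩
    exact ⟨φ.edge e, φ.o_edge e, φ.t_edge e⟩
  change Relation.ReflTransGen T₂.Step (φ.vert v) (φ.vert w)
  induction hw' with
  | refl => exact Relation.ReflTransGen.refl
  | tail h1 h2 ih => exact (ih h1).tail (key _ _ h2)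

theorem image_symm_image (φ : Iso T₁ T₂) (B : Set V₁) : φ.symm.vert '' (φ.vert '' B) = B :=
  φ.vert.symm_image_image B

theorem image_image_symm (φ : Iso T₁ T₂) (B : Set V₂) : φ.vert '' (φ.symm.vert '' B) = B :=
  φ.vert.image_symm_image B

theorem image_reach (φ : Iso T₁ T₂) (v : V₁) : φ.vert '' T₁.reach v = T₂.reach (φ.vert v) := by
  refine (φ.reach_sub v).antisymm ?_
  have h := Set.image_mono (f := φ.vert) (φ.symm.reach_sub (φ.vert v))
  rw [image_image_symm] at h
  simpa [symm] using h

theorem image_outEdges (φ : Iso T₁ T₂) (v : V₁) :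
    φ.edge '' T₁.outEdges v = T₂.outEdges (φ.vert v) := by
  ext e
  constructor
  · rintro ⟨e, rfl, rfl⟩
    exact φ.o_edge e
  · intro he
    refine ⟨φ.edge.symm e, ?_, by simp⟩
    apply φ.vert.injective
    rw [← φ.o_edge, Equiv.apply_symm_apply]
    exact he

theorem image_cyl (φ : Iso T₁ T₂) (v : V₁) (F : Set E₁) :
    φ.vert '' T₁.cyl v F = T₂.cyl (φ.vert v) (φ.edge '' F) := by
  unfold cyl
  rw [Set.image_union, Set.image_singleton, ← φ.image_outEdges,
    ← Set.image_sdiff φ.edge.injective, Set.biUnion_image, Set.image_iUnion₂]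
  simp only [φ.image_reach, φ.t_edge]

theorem image_basic (φ : Iso T₁ T₂) {B : Set V₁} (hB : B ∈ T₁.basicSets) :
    φ.vert '' B ∈ T₂.basicSets := by
  rcases hB with ⟨v, F, hF, hfin, rfl⟩ | hB
  · refine Or.inl ⟨φ.vert v, φ.edge '' F, ?_, hfin.image _, φ.image_cyl v F⟩
    rw [← φ.image_outEdges]
    exact Set.image_mono hF
  · rw [Set.mem_singleton_iff] at hB
    subst hB
    exact Or.inr (by simp)

theorem image_ring (φ : Iso T₁ T₂) {B : Set V₁} (hB : B ∈ T₁.ring) :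
    φ.vert '' B ∈ T₂.ring := by
  obtain ⟨C, hC, hfin, hdisj, rfl⟩ := hB
  refine ⟨(φ.vert '' ·) '' C, ?_, hfin.image _, ?_, by rw [Set.image_sUnion]⟩
  · rintro _ ⟨B, hB, rfl⟩
    exact φ.image_basic (hC hB)
  · rintro _ ⟨B, hB, rfl⟩ _ ⟨B', hB', rfl⟩ hne
    have : B ≠ B' := fun h => hne (by rw [h])
    exact (Set.disjoint_image_iff φ.vert.injective).2 (hdisj hB hB' this)

theorem image_filter (φ : Iso T₁ T₂) {U : Set (Set V₁)} (hU : IsRingFilter T₁.ring U) :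
    IsRingFilter T₂.ring ((φ.vert '' ·) '' U) where
  subset := by
    rintro _ ⟨B, hB, rfl⟩
    exact φ.image_ring (hU.subset hB)
  nonempty := hU.nonempty.image _
  empty_notMem := by
    rintro ⟨B, hB, h⟩
    rw [Set.image_eq_empty.1 h] at hB
    exact hU.empty_notMem hB
  inter_mem := by
    rintro _ ⟨B, hB, rfl⟩ _ ⟨C, hC, rfl⟩
    exact ⟨B ∩ C, hU.inter_mem B hB C hC, Set.image_inter φ.vert.injective⟩
  mem_of_superset := by
    rintro _ ⟨B, hB, rfl⟩ C hC hBC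
    refine ⟨φ.symm.vert '' C, ?_, φ.image_image_symm C⟩
    refine hU.mem_of_superset B hB _ (φ.symm.image_ring hC) ?_
    have h := Set.image_mono (f := φ.symm.vert) hBC
    rwa [show φ.symm.vert '' ((fun x => φ.vert '' x) B) = B from φ.image_symm_image B] at h

theorem image_image_filter (φ : Iso T₁ T₂) (U : Set (Set V₁)) :
    (φ.symm.vert '' ·) '' ((φ.vert '' ·) '' U) = U := by
  simp only [Set.image_image, symm, Equiv.symm_apply_apply, Set.image_id']

/-- The map on spectra induced by an isomorphism of directed graphs, `U ↦ {φ(B) : B ∈ U}`. -/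
def onSpectrum (φ : Iso T₁ T₂) (U : T₁.Spectrum) : T₂.Spectrum :=
  ⟨(φ.vert '' ·) '' U.1, φ.image_filter U.2.prop, by
    intro W hW hUW
    have h1 := Set.image_mono (f := (φ.symm.vert '' ·)) hUW
    rw [φ.image_image_filter] at h1
    have h2 := U.2.2 (φ.symm.image_filter hW) h1
    have h3 := Set.image_mono (f := (φ.vert '' ·)) h2
    have h4 := φ.symm.image_image_filter W
    rw [show φ.symm.symm = φ from rfl] at h4
    rwa [h4] at h3⟩

end Iso

section Groupoid

universe u v

variable {V : Type u} {E : Type v} (Γ : DirectedGraph V E)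

/-- Origin of an edge in `E¹ = E × Bool`. -/
def origin (a : E × Bool) : V := if a.2 then Γ.o a.1 else Γ.t a.1

/-- Terminus of an edge in `E¹ = E × Bool`. -/
def terminus (a : E × Bool) : V := if a.2 then Γ.t a.1 else Γ.o a.1

/-- `Γ.IsWalk u L w`: the list of edges `L` is a walk from `u` to `w`, that is, successive edges
are composable (backtracking is not excluded here). -/
def IsWalk : V → List (E × Bool) → V → Prop
  | u, [], w => u = w
  | u, a :: L, w => Γ.origin a = u ∧ IsWalk (Γ.terminus a) L w

open Classical in
/-- The elements of the groupoid `G(E)` with range `u` and source `w`: the finite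
(undirected) paths without backtracking from `u` to `w`.  An element of the free group on `E` is
the same thing as a reduced word in the edges `E × Bool`, and the group multiplication is
concatenation followed by removal of the pairs `(e, ē)`. -/
@[ext] structure GPath (u w : V) where
  word : FreeGroup E
  isWalk : Γ.IsWalk u word.toWord w

variable {Γ}

theorem IsWalk.append {u w x : V} {L M : List (E × Bool)} (hL : Γ.IsWalk u L w)
    (hM : Γ.IsWalk w M x) : Γ.IsWalk u (L ++ M) x := by
  induction L generalizing u with
  | nil => cases hL; exact hM
  | cons a L ih => exact ⟨hL.1, ih hL.2⟩

theorem IsWalk.of_append {u x : V} {L M : List (E × Bool)} (h : Γ.IsWalk u (L ++ M) x) :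
    ∃ w, Γ.IsWalk u L w ∧ Γ.IsWalk w M x := by
  induction L generalizing u with
  | nil => exact ⟨u, rfl, h⟩
  | cons a L ih =>
    obtain ⟨w, h1, h2⟩ := ih h.2
    exact ⟨w, ⟨h.1, h1⟩, h2⟩

theorem origin_not (e : E) (b : Bool) : Γ.origin (e, !b) = Γ.terminus (e, b) := by
  cases b <;> simp [origin, terminus]

theorem terminus_not (e : E) (b : Bool) : Γ.terminus (e, !b) = Γ.origin (e, b) := by
  cases b <;> simp [origin, terminus]

theorem IsWalk.red {u w : V} {L M : List (E × Bool)} (hLM : FreeGroup.Red L M)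
    (hL : Γ.IsWalk u L w) : Γ.IsWalk u M w := by
  induction hLM with
  | refl => exact hL
  | tail _ hs ih =>
    cases hs with
    | not =>
      obtain ⟨x, h1, h2, h3, h4⟩ := ih.of_append
      rw [terminus_not, h2] at h4
      exact h1.append h4

theorem IsWalk.invRev {u w : V} {L : List (E × Bool)} (hL : Γ.IsWalk u L w) :
    Γ.IsWalk w (FreeGroup.invRev L) u := by
  induction L generalizing u with
  | nil => exact hL.symm
  | cons a L ih =>
    have h : Γ.IsWalk (Γ.terminus a) [(a.1, !a.2)] u :=
      ⟨origin_not a.1 a.2, (terminus_not a.1 a.2).trans hL.1⟩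
    have := (ih hL.2).append h
    simpa [FreeGroup.invRev] using this

namespace GPath

/-- The path of length zero at `u`. -/
def nil (u : V) : Γ.GPath u u := ⟨1, by simp [IsWalk]⟩

/-- A directed edge, as a path of length one. -/
def edge (e : E) : Γ.GPath (Γ.o e) (Γ.t e) :=
  ⟨FreeGroup.of e, by simp [IsWalk, origin, terminus]⟩

/-- Multiplication in the groupoid: concatenation followed by cancellation. -/
def mul {u w x : V} (p : Γ.GPath u w) (q : Γ.GPath w x) : Γ.GPath u x :=
  ⟨p.word * q.word, by
    classical
    convert (p.isWalk.append q.isWalk).red FreeGroup.reduce.red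
    rw [FreeGroup.toWord_mul]⟩

/-- Inversion in the groupoid: reversal of paths. -/
def inv {u w : V} (p : Γ.GPath u w) : Γ.GPath w u :=
  ⟨p.word⁻¹, by
    classical
    convert p.isWalk.invRev
    rw [FreeGroup.toWord_inv]⟩

open Classical in
/-- A path is directed if all its edges are directed edges (not reversed ones). -/
def IsDirected {u w : V} (p : Γ.GPath u w) : Prop := ∀ a ∈ p.word.toWord, a.2 = true

end GPath

variable (Γ)

/-- The vertices of the tree `λ⁻¹(u)`: the paths with origin `u`, and any terminus `w`. -/
abbrev CoverVert (u : V) : Type _ := Σ w : V, Γ.GPath u w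

/-- The directed edges of the tree `λ⁻¹(u)`: the pairs `(p, q)` of paths with origin `u` such that
`p⁻¹q` is (the path of length one given by) a directed edge. -/
abbrev CoverEdge (u : V) : Type _ :=
  {pq : Γ.CoverVert u × Γ.CoverVert u //
    ∃ e : E, (pq.1.2.inv.mul pq.2.2).word = FreeGroup.of e}

/-- The directed tree `λ⁻¹(u)`, the component over `u` of the bundle of trees `Ẽ`. -/
def cover (u : V) : DirectedGraph (Γ.CoverVert u) (Γ.CoverEdge u) where
  o pq := pq.1.1
  t pq := pq.1.2

/-- The path of length zero at `u`, as a vertex of the tree over `u`. -/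
def base (u : V) : Γ.CoverVert u := ⟨u, GPath.nil u⟩

variable {Γ}

/-- Left multiplication by `α` as a bijection between the sets of vertices of the trees over the
source and the range of `α`. -/
def transVert {r s : V} (α : Γ.GPath r s) : Γ.CoverVert s ≃ Γ.CoverVert r where
  toFun p := ⟨p.1, α.mul p.2⟩
  invFun p := ⟨p.1, α.inv.mul p.2⟩
  left_inv p := by
    obtain ⟨w, p⟩ := p
    simp [GPath.mul, GPath.inv]
  right_inv p := by
    obtain ⟨w, p⟩ := p
    simp [GPath.mul, GPath.inv]

/-- Left multiplication by `α` as an isomorphism of directed trees. -/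
def trans {r s : V} (α : Γ.GPath r s) : Iso (Γ.cover s) (Γ.cover r) where
  vert := transVert α
  edge := (Equiv.prodCongr (transVert α) (transVert α)).subtypeEquiv (by
    rintro ⟨⟨a, p⟩, ⟨b, q⟩⟩
    have h : (((α.mul p).inv).mul (α.mul q)).word = (p.inv.mul q).word := by
      simp [GPath.mul, GPath.inv, mul_assoc]
    change (∃ e, (p.inv.mul q).word = FreeGroup.of e) ↔
      ∃ e, (((α.mul p).inv).mul (α.mul q)).word = FreeGroup.of e
    rw [h])
  o_edge _ := rfl
  t_edge _ := rfl

/-- The action of the groupoid `G(E)` on the spectrum of the bundle of trees. -/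
def act {r s : V} (α : Γ.GPath r s) (x : (Γ.cover s).Spectrum) : (Γ.cover r).Spectrum :=
  (trans α).onSpectrum x

theorem trans_mul {u r s : V} (α : Γ.GPath u r) (β : Γ.GPath r s) (p : Γ.CoverVert s) :
    (trans (α.mul β)).vert p = (trans α).vert ((trans β).vert p) := by
  simp [trans, transVert, GPath.mul, mul_assoc]

theorem act_mul {u r s : V} (α : Γ.GPath u r) (β : Γ.GPath r s) (x : (Γ.cover s).Spectrum) :
    act (α.mul β) x = act α (act β x) := by
  apply Subtype.ext
  simp only [act, Iso.onSpectrum, Set.image_image, trans_mul]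

theorem act_inv {r s : V} (α : Γ.GPath r s) (x : (Γ.cover s).Spectrum) :
    act α.inv (act α x) = x := by
  apply Subtype.ext
  have h : ∀ p, (trans α.inv).vert ((trans α).vert p) = p := by
    intro p
    simp [trans, transVert, GPath.mul, GPath.inv]
  simp only [act, Iso.onSpectrum, Set.image_image, h, Set.image_id']

theorem mul_inv_mul {u r s : V} (α : Γ.GPath u s) (β : Γ.GPath r s) :
    (α.mul β.inv).mul β = α := by
  ext
  simp [GPath.mul, GPath.inv]

variable (Γ)

/-- The spectrum of the bundle of trees `Ẽ`: the disjoint (topological) union over the vertices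
`u` of the spectra of the trees `λ⁻¹(u)`.  The first component of a point `x` is `λ(x)`. -/
abbrev BundleSpectrum : Type _ := Σ u : V, (Γ.cover u).Spectrum

/-- The space `∂(Ẽ, S̃)`, where `S̃` consists of the paths that end in `S`. -/
def bundleBoundary (S : Set V) : Set Γ.BundleSpectrum :=
  {x | x.2 ∈ (Γ.cover x.1).boundary {p | p.1 ∈ S}}

/-- The points of the spectrum that are represented by directed paths of `E`: the fixed
ultrafilters of finite directed paths `p`, and the ultrafilters given by infinite directed
paths `f₁f₂⋯` with origin `u = λ(x)`, that is, by the infinite directed paths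
`(p₀, p₁)(p₁, p₂)⋯` in the tree over `u` with `p₀ = u` and `p_{i-1}⁻¹ p_i = f_i`. -/
def directedPoints : Set Γ.BundleSpectrum :=
  {x | (∃ p : Γ.CoverVert x.1, p.2.IsDirected ∧ x.2.1 = (Γ.cover x.1).fixedFilter p) ∨
    ∃ ω : ℕ → Γ.CoverEdge x.1, (Γ.cover x.1).o (ω 0) = Γ.base x.1 ∧
      (Γ.cover x.1).IsInfinitePath ω ∧ x.2.1 = (Γ.cover x.1).pathFilter ω}

/-- The transversal `X(E, S)`: the points of `∂(Ẽ, S̃)` represented by directed paths. -/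
def transversal (S : Set V) : Set Γ.BundleSpectrum := Γ.bundleBoundary S ∩ Γ.directedPoints

/-- The Toeplitz graph groupoid of `(E, S)`: the restriction to `X(E, S)` of the transformation
groupoid `G(E) * ∂(Ẽ, S̃)`.  Its elements are the pairs `(α, x)` with `x` and `αx` in
`X(E, S)`, where `λ(x)` is the source of `α`. -/
@[ext] structure ToeplitzGroupoid (S : Set V) where
  /-- range of `α` -/
  r : V
  /-- source of `α` -/
  s : V
  α : Γ.GPath r s
  x : (Γ.cover s).Spectrum
  source_mem : (⟨s, x⟩ : Γ.BundleSpectrum) ∈ Γ.transversal S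
  range_mem : (⟨r, act α x⟩ : Γ.BundleSpectrum) ∈ Γ.transversal S

namespace ToeplitzGroupoid

variable {Γ} {S : Set V}

/-- The source `x` of `(α, x)`. -/
def source (γ : Γ.ToeplitzGroupoid S) : Γ.transversal S := ⟨⟨γ.s, γ.x⟩, γ.source_mem⟩

/-- The range `αx` of `(α, x)`. -/
def range (γ : Γ.ToeplitzGroupoid S) : Γ.transversal S := ⟨⟨γ.r, act γ.α γ.x⟩, γ.range_mem⟩

/-- The component `α` of `(α, x)`, as an element of the set of all paths. -/
def path (γ : Γ.ToeplitzGroupoid S) : Σ r s : V, Γ.GPath r s := ⟨γ.r, γ.s, γ.α⟩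

/-- The relative product topology of `G(E) × X(E, S)`, with `G(E)` discrete. -/
instance : TopologicalSpace (Γ.ToeplitzGroupoid S) :=
  TopologicalSpace.induced path ⊥ ⊓ TopologicalSpace.induced source inferInstance

/-- `(α, x)⁻¹ = (α⁻¹, αx)`. -/
def inv (γ : Γ.ToeplitzGroupoid S) : Γ.ToeplitzGroupoid S where
  r := γ.s
  s := γ.r
  α := γ.α.inv
  x := act γ.α γ.x
  source_mem := γ.range_mem
  range_mem := by rw [act_inv]; exact γ.source_mem

/-- The elements `η = (β, x)` of the groupoid with the same source `x` as `γ = (α, x)`. -/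
structure SameSource (γ : Γ.ToeplitzGroupoid S) where
  r : V
  β : Γ.GPath r γ.s
  range_mem : (⟨r, act β γ.x⟩ : Γ.BundleSpectrum) ∈ Γ.transversal S

namespace SameSource

variable {γ : Γ.ToeplitzGroupoid S}

/-- The element `η = (β, x)`. -/
def right (η : SameSource γ) : Γ.ToeplitzGroupoid S :=
  ⟨η.r, γ.s, η.β, γ.x, γ.source_mem, η.range_mem⟩

/-- The element `γη⁻¹ = (αβ⁻¹, βx)`, so that `γ = (γη⁻¹)η`. -/
def left (η : SameSource γ) : Γ.ToeplitzGroupoid S :=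
  ⟨γ.r, η.r, γ.α.mul η.β.inv, act η.β γ.x, η.range_mem, by
    rw [← act_mul, mul_inv_mul]; exact γ.range_mem⟩

end SameSource

/-- The convolution product, `(f * g)(γ) = ∑ f(γη⁻¹) g(η)`, the sum being over the elements `η`
with the same source as `γ` (for `f`, `g` of compact support only finitely many terms are
nonzero). -/
def conv (f g : Γ.ToeplitzGroupoid S → ℂ) (γ : Γ.ToeplitzGroupoid S) : ℂ :=
  ∑ᶠ η : SameSource γ, f η.left * g η.right

/-- The involution `f*(γ) = conj (f(γ⁻¹))`. -/
def invol (f : Γ.ToeplitzGroupoid S → ℂ) (γ : Γ.ToeplitzGroupoid S) : ℂ := star (f γ.inv)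

/-- The `I`-norm: the larger of the suprema over `x` of `∑ |f(γ)|`, over the `γ` with source `x`
respectively with range `x`. -/
def inorm (f : Γ.ToeplitzGroupoid S → ℂ) : ℝ :=
  max (⨆ x : Γ.transversal S, ∑ᶠ γ : {γ : Γ.ToeplitzGroupoid S // γ.source = x}, ‖f γ.1‖)
    (⨆ x : Γ.transversal S, ∑ᶠ γ : {γ : Γ.ToeplitzGroupoid S // γ.range = x}, ‖f γ.1‖)

end ToeplitzGroupoid

/-- A bounded `*`-representation on a Hilbert space of the convolution algebra of continuous
functions of compact support on the Toeplitz graph groupoid.  (The pointwise product of such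
functions plays no role here.) -/
structure CcRep (S : Set V) where
  H : Type (max u v)
  [group : NormedAddCommGroup H]
  [inner : InnerProductSpace ℂ H]
  [complete : CompleteSpace H]
  toLin : C_c(Γ.ToeplitzGroupoid S, ℂ) →ₗ[ℂ] (H →L[ℂ] H)
  map_conv : ∀ f g h : C_c(Γ.ToeplitzGroupoid S, ℂ),
    (h : Γ.ToeplitzGroupoid S → ℂ) = ToeplitzGroupoid.conv f g → toLin h = toLin f * toLin g
  map_invol : ∀ f h : C_c(Γ.ToeplitzGroupoid S, ℂ),
    (h : Γ.ToeplitzGroupoid S → ℂ) = ToeplitzGroupoid.invol f → toLin h = star (toLin f)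
  bounded : ∀ f, ‖toLin f‖ ≤ ToeplitzGroupoid.inorm f

attribute [instance] CcRep.group CcRep.inner CcRep.complete

/-- The universal representation: the direct sum of all bounded representations, with values
in the `ℓ^∞`-product of the algebras of bounded operators. -/
def universalRep (S : Set V) (f : C_c(Γ.ToeplitzGroupoid S, ℂ)) :
    lp (fun π : Γ.CcRep S => π.H →L[ℂ] π.H) ∞ :=
  ⟨fun π => π.toLin f, memℓp_infty ⟨ToeplitzGroupoid.inorm f, by
    rintro _ ⟨π, rfl⟩
    exact π.bounded f⟩⟩

/-- The Toeplitz graph algebra `TO(E, S)`, the C*-algebra of the Toeplitz graph groupoid: the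
completion of the convolution algebra in the norm `‖f‖ = sup ‖π(f)‖` over all bounded
representations `π`, realized as the norm closure of the image of the universal representation. -/
def toeplitzAlgebra (S : Set V) :
    NonUnitalStarSubalgebra ℂ (lp (fun π : Γ.CcRep S => π.H →L[ℂ] π.H) ∞) :=
  (NonUnitalStarAlgebra.adjoin ℂ (Set.range (Γ.universalRep S))).topologicalClosure

/-- The canonical map of the convolution algebra into `TO(E, S)`. -/
def toToeplitzAlgebra {S : Set V} (f : C_c(Γ.ToeplitzGroupoid S, ℂ)) : Γ.toeplitzAlgebra S :=
  ⟨Γ.universalRep S f, NonUnitalStarSubalgebra.le_topologicalClosure _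
    (NonUnitalStarAlgebra.subset_adjoin ℂ _ ⟨f, rfl⟩)⟩

/-- The compact open set `{e} × [V(t(e))]` in the groupoid. -/
def edgeSet (S : Set V) (e : E) : Set (Γ.ToeplitzGroupoid S) :=
  {γ | γ.path = ⟨Γ.o e, Γ.t e, GPath.edge e⟩ ∧
    γ.x ∈ Spectrum.supp ((Γ.cover γ.s).reach (Γ.base γ.s))}

/-- The compact open set `[V(u)]` in the unit space of the groupoid. -/
def vertexSet (S : Set V) (u : V) : Set (Γ.ToeplitzGroupoid S) :=
  {γ | γ.path = ⟨u, u, GPath.nil u⟩ ∧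
    γ.x ∈ Spectrum.supp ((Γ.cover γ.s).reach (Γ.base γ.s))}

end Groupoid

/-- A `*`-representation `π` on a Hilbert space is nondegenerate if the vectors `π(a)ξ` span a
dense subspace. -/
def Nondegenerate {A H : Type*} [NonUnitalNonAssocSemiring A] [Module ℂ A] [Star A]
    [NormedAddCommGroup H] [InnerProductSpace ℂ H] [CompleteSpace H]
    (π : A →⋆ₙₐ[ℂ] (H →L[ℂ] H)) : Prop :=
  (Submodule.span ℂ {η : H | ∃ a ξ, π a ξ = η}).topologicalClosure = ⊤

/-- The relations between partial isometries `s e` and projections `p u`.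
All infinite sums are in the strong operator topology. -/
structure IsToeplitzFamily {V E : Type*} (Γ : DirectedGraph V E) (S : Set V) {H : Type*}
    [NormedAddCommGroup H] [InnerProductSpace ℂ H] [CompleteSpace H]
    (s : E → H →L[ℂ] H) (p : V → H →L[ℂ] H) : Prop where
  partialIsometry : ∀ e, s e * star (s e) * s e = s e
  projection : ∀ u, IsStarProjection (p u)
  orthogonal : ∀ u w, u ≠ w → p u * p w = 0
  sum_eq_one : ∀ ξ : H, HasSum (fun u => p u ξ) ξ
  initial : ∀ e, star (s e) * s e = p (Γ.t e)
  /-- The strong sum `q` of the `s f (s f)*`, over the edges `f` with origin `u`, exists and is at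
  most `p u`, with equality if `u ∈ S`. -/
  final : ∀ u, ∃ q : H →L[ℂ] H,
    (∀ ξ : H, HasSum (fun f : {f // Γ.o f = u} => (s f * star (s f)) ξ) (q ξ)) ∧
      q ≤ p u ∧ (u ∈ S → q = p u)

end DirectedGraph

end

/-!
# Representations of Toeplitz graph algebras

A point of `X(E, S)` is a finite or infinite directed path not ending in `S`, and it is determined by
the set of its finite initial segments (`IsPathSet`, `pathSet`).  The conditions on such a set involve
finitely many coordinates each, as the vertices in `S` emit finitely many edges.  Hence these sets,
together with the empty one, form a compact totally disconnected space `PathSpace`, which is the one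
point compactification of `X(E, S)`.  The free group on the edges acts partially on it by adding and
removing first edges (`gact`, with the empty set `0` as the value where the action is undefined), and the
elements of the groupoid are the pairs `(g, x)` such that `gx` is defined.  A function `f` of compact
support on the groupoid becomes a finitely supported family of continuous functions `f(g, ·)` on
the path space (`hatC`), and the convolution and the involution are those of a partial crossed product
(`hat_conv`, `hat_invol`).

*Toeplitz families give representations.*  The range projections `S_μ S_μ^*` of directed words satisfy
the relations of the sets `V(μ)` and generate a commutative C*-algebra.  A character of this algebra
defines the path set of the words `μ` with `S_μ S_μ^* ↦ 1`, so that Gelfand duality yields a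
representation `Φ` of the continuous functions on the path space (`IsToeplitzFamily.exists_diagonal`).
For a reduced word `g` let `S_g` be the product of the operators `S_e` and `S_e^*` of its letters.
Then `Φ` is covariant, and `S_g S_k Φ(f) = S_{gk} Φ(f)` if `f` is supported where the composition of
`g` and `k` is defined, since the cancelled letters contribute projections absorbed by `Φ(f)`.  So
`f ↦ ∑ S_g Φ(f(g, ·))` is a `*`-representation (`integrated_conv`, `integrated_invol`).  It is bounded by the
`I`-norm (`norm_integrated_le`), hence by the universal norm, and extends to the Toeplitz graph algebra
(`IsCcRep.exists_extension`).  The universal norm is a supremum over Hilbert spaces in the universe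
of the graph only; `IsCcRep.norm_le` extends the bound to other universes by passing to cyclic
subspaces, which are small.

*Representations give Toeplitz families.*  The generators satisfy the algebraic relations already
in the convolution algebra.  The strong sums exist because sums of orthogonal projections converge
strongly (`exists_hasSum_of_orthogonal`), and nondegeneracy shows that the sum of the `P_u`, which is
a unit for the image of the representation, is the identity (`isToeplitzFamily_of_nondegenerate`).

*Injectivity.*  The generators generate the algebra (`toeplitzAlgebra_induction`): conjugation by the
partial isometries of edges yields all indicator functions of the sets `V(μ)` on the unit space, these
generate the diagonal by the theorem of Stone and Weierstrass, and a function supported on a word `g` is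
the product of the generator of the first letter of `g`, or of its adjoint, and of a function supported
on the rest of the word.
-/

noncomputable section

namespace DirectedGraph

/-! ### Directed words in the free group -/

section Words

variable {E : Type*}

/-- The element of the free group given by a directed word. -/
def pos (μ : List E) : FreeGroup E := FreeGroup.mk (μ.map fun e => (e, true))

@[simp] theorem pos_nil : pos ([] : List E) = 1 := rfl

theorem pos_append (μ ν : List E) : pos (μ ++ ν) = pos μ * pos ν := by
  simp [pos]

theorem pos_cons (e : E) (μ : List E) : pos (e :: μ) = FreeGroup.of e * pos μ := by
  rw [← List.singleton_append, pos_append]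
  rfl

theorem pos_singleton (e : E) : pos [e] = FreeGroup.of e := rfl

/-- The word of the inverse of a directed word. -/
def negWord (μ : List E) : List (E × Bool) := (μ.map fun e => (e, false)).reverse

theorem negWord_cons (e : E) (μ : List E) : negWord (e :: μ) = negWord μ ++ [(e, false)] := by
  simp [negWord]

theorem invRev_pos (μ : List E) :
    FreeGroup.invRev (μ.map fun e => (e, true)) = negWord μ := by
  simp [FreeGroup.invRev, negWord, Function.comp_def]

theorem mk_negWord (μ : List E) : FreeGroup.mk (negWord μ) = (pos μ)⁻¹ := by
  rw [pos, FreeGroup.inv_mk, invRev_pos]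

theorem isReduced_map_true (μ : List E) : FreeGroup.IsReduced (μ.map fun e => (e, true)) := by
  induction μ with
  | nil => simp [FreeGroup.IsReduced]
  | cons e μ ih =>
    cases μ with
    | nil => simp [FreeGroup.IsReduced]
    | cons f μ =>
      simp only [List.map_cons, FreeGroup.IsReduced, List.isChain_cons_cons] at ih ⊢
      exact ⟨fun _ => trivial, ih⟩

open Classical in
theorem toWord_pos (μ : List E) : (pos μ).toWord = μ.map fun e => (e, true) := by
  rw [pos, FreeGroup.toWord_mk]
  exact (isReduced_map_true μ).reduce_eq

theorem pos_injective : Function.Injective (pos : List E → FreeGroup E) := by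
  classical
  intro μ ν h
  have := congrArg FreeGroup.toWord h
  rw [toWord_pos, toWord_pos] at this
  exact List.map_injective_iff.2 (fun a b hab => (Prod.mk.inj hab).1) this

/-- Two directed words have no common last letter.  This is expressed by saying that the word
`a b⁻¹` is reduced: the only cancellation could take place between the last letters. -/
def NoCommonSuffix (a b : List E) : Prop :=
  FreeGroup.IsReduced (a.map (fun e => (e, true)) ++ negWord b)

theorem isReduced_negWord (μ : List E) : FreeGroup.IsReduced (negWord μ) := by
  classical
  rw [FreeGroup.isReduced_iff_reduce_eq, ← invRev_pos, FreeGroup.reduce_invRev,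
    (isReduced_map_true μ).reduce_eq]

/-- Cancelling the longest common suffix. -/
theorem exists_noCommonSuffix (a b : List E) :
    ∃ a' b' κ, a = a' ++ κ ∧ b = b' ++ κ ∧ NoCommonSuffix a' b' := by
  induction a using List.reverseRecOn generalizing b with
  | nil => exact ⟨[], b, [], rfl, by simp, by simpa [NoCommonSuffix] using isReduced_negWord b⟩
  | append_singleton a x ih =>
    cases b using List.reverseRecOn with
    | nil => exact ⟨a ++ [x], [], [], by simp, rfl, by
        simpa [NoCommonSuffix, negWord] using isReduced_map_true (a ++ [x])⟩
    | append_singleton b y =>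
      by_cases hxy : x = y
      · subst hxy
        obtain ⟨a', b', κ, rfl, rfl, h⟩ := ih b
        exact ⟨a', b', κ ++ [x], by simp, by simp, h⟩
      · refine ⟨a ++ [x], b ++ [y], [], by simp, by simp, ?_⟩
        have h1 := isReduced_map_true (a ++ [x])
        have h2 := isReduced_negWord (b ++ [y])
        simp only [NoCommonSuffix, FreeGroup.IsReduced] at h1 h2 ⊢
        rw [List.isChain_append]
        refine ⟨h1, h2, ?_⟩
        simp [negWord]
        exact fun h => absurd h hxy

open Classical in
theorem NoCommonSuffix.toWord {a b : List E} (h : NoCommonSuffix a b) :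
    (pos a * (pos b)⁻¹).toWord = a.map (fun e => (e, true)) ++ negWord b := by
  rw [← mk_negWord, pos, FreeGroup.mul_mk, FreeGroup.toWord_mk]
  exact h.reduce_eq

/-- Since the reduced word of `a' b'⁻¹` shows `a'` and `b'`, every other representation
`a b⁻¹` of the same element arises by appending a common suffix. -/
theorem NoCommonSuffix.exists_eq_append {a b a' b' : List E} (h : NoCommonSuffix a' b')
    (heq : pos a * (pos b)⁻¹ = pos a' * (pos b')⁻¹) : ∃ κ, a = a' ++ κ ∧ b = b' ++ κ := by
  classical
  obtain ⟨c, d, κ, rfl, rfl, h'⟩ := exists_noCommonSuffix a b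
  have h1 : pos c * (pos d)⁻¹ = pos a' * (pos b')⁻¹ := by
    rw [← heq, pos_append, pos_append]
    group
  have h2 := congrArg FreeGroup.toWord h1
  rw [h.toWord, h'.toWord] at h2
  have key : ∀ x y : List E,
      ((x.map (fun e => (e, true)) ++ negWord y).filter (fun z => z.2)).map Prod.fst = x ∧
      (((x.map (fun e => (e, true)) ++ negWord y).filter (fun z => !z.2)).map Prod.fst).reverse
        = y := by
    intro x y
    constructor
    · simp [negWord, List.filter_map, Function.comp_def]
    · simp [negWord, List.filter_map, Function.comp_def]
  have e1 := (key c d).1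
  have e2 := (key c d).2
  rw [h2, (key a' b').1] at e1
  rw [h2, (key a' b').2] at e2
  subst e1 e2
  exact ⟨κ, rfl, rfl⟩

end Words

/-! ### The trees of paths in terms of words -/

section Tree

variable {V E : Type*} {Γ : DirectedGraph V E}

/-- The directed word `μ` is a walk from `u` to `w`. -/
def DWalk (Γ : DirectedGraph V E) (u : V) (μ : List E) (w : V) : Prop :=
  Γ.IsWalk u (μ.map fun e => (e, true)) w

@[simp] theorem dWalk_nil {u w : V} : Γ.DWalk u [] w ↔ u = w := Iff.rfl

@[simp] theorem dWalk_cons {u w : V} {e : E} {μ : List E} :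
    Γ.DWalk u (e :: μ) w ↔ Γ.o e = u ∧ Γ.DWalk (Γ.t e) μ w := by
  simp [DWalk, IsWalk, origin, terminus]

theorem dWalk_append {u w : V} {μ ν : List E} :
    Γ.DWalk u (μ ++ ν) w ↔ ∃ v, Γ.DWalk u μ v ∧ Γ.DWalk v ν w := by
  simp only [DWalk, List.map_append]
  exact ⟨fun h => h.of_append, fun ⟨v, h1, h2⟩ => h1.append h2⟩

theorem IsWalk.right_unique {u w w' : V} {L : List (E × Bool)} (h : Γ.IsWalk u L w)
    (h' : Γ.IsWalk u L w') : w = w' := by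
  induction L generalizing u with
  | nil => exact h.symm.trans h'
  | cons a L ih => exact ih h.2 h'.2

theorem IsWalk.left_unique {u u' w : V} {L : List (E × Bool)} (h : Γ.IsWalk u L w)
    (h' : Γ.IsWalk u' L w) : u = u' := by
  cases L with
  | nil => exact h.trans h'.symm
  | cons a L => exact h.1.symm.trans h'.1

/-- A directed walk, as an element of the groupoid of paths. -/
def DWalk.path {u w : V} {μ : List E} (h : Γ.DWalk u μ w) : Γ.GPath u w :=
  ⟨pos μ, by
    classical
    rw [toWord_pos]
    exact h⟩

theorem GPath.dWalk {u w : V} (p : Γ.GPath u w) {μ : List E} (h : p.word = pos μ) :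
    Γ.DWalk u μ w := by
  classical
  have := p.isWalk
  rw [h] at this
  rw [DWalk, ← toWord_pos]
  exact this

variable {s : V}

theorem coverVert_ext {p q : Γ.CoverVert s} (h : p.2.word = q.2.word) : p = q := by
  obtain ⟨v, p⟩ := p
  obtain ⟨w, q⟩ := q
  have hw := q.isWalk
  rw [← (show p.word = q.word from h)] at hw
  obtain rfl := p.isWalk.right_unique hw
  obtain rfl : p = q := GPath.ext h
  rfl

theorem dWalk_of_word_eq {p q : Γ.CoverVert s} {μ : List E} (h : q.2.word = p.2.word * pos μ) :
    Γ.DWalk p.1 μ q.1 := by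
  refine (p.2.inv.mul q.2).dWalk ?_
  simp [GPath.mul, GPath.inv, h]

/-- The end of the directed walk `μ` starting at the vertex `p` of the tree. -/
def DWalk.vert (p : Γ.CoverVert s) {w : V} {μ : List E} (h : Γ.DWalk p.1 μ w) : Γ.CoverVert s :=
  ⟨w, p.2.mul h.path⟩

theorem DWalk.word_vert (p : Γ.CoverVert s) {w : V} {μ : List E} (h : Γ.DWalk p.1 μ w) :
    (DWalk.vert p h).2.word = p.2.word * pos μ := rfl

theorem exists_vert_of_append {p q : Γ.CoverVert s} {μ ν : List E}
    (h : q.2.word = p.2.word * pos (μ ++ ν)) :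
    ∃ r : Γ.CoverVert s, r.2.word = p.2.word * pos μ ∧ Γ.DWalk p.1 μ r.1 := by
  obtain ⟨v, hv, -⟩ := dWalk_append.1 (dWalk_of_word_eq h)
  exact ⟨DWalk.vert p hv, DWalk.word_vert p hv, hv⟩

/-- The label in `E` of a directed edge of the tree. -/
def coverLabel (ε : Γ.CoverEdge s) : E := ε.2.choose

theorem coverLabel_spec (ε : Γ.CoverEdge s) :
    ε.1.2.2.word = ε.1.1.2.word * FreeGroup.of (coverLabel ε) := by
  have h := ε.2.choose_spec
  change ε.1.1.2.word⁻¹ * ε.1.2.2.word = _ at h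
  rw [coverLabel, ← h, mul_inv_cancel_left]

theorem exists_coverEdge {p q : Γ.CoverVert s} {e : E}
    (h : q.2.word = p.2.word * FreeGroup.of e) :
    ∃ ε : Γ.CoverEdge s, (Γ.cover s).o ε = p ∧ (Γ.cover s).t ε = q ∧ coverLabel ε = e := by
  refine ⟨⟨(p, q), e, by simp [GPath.mul, GPath.inv, h]⟩, rfl, rfl, ?_⟩
  have h1 := coverLabel_spec (⟨(p, q), e, by simp [GPath.mul, GPath.inv, h]⟩ : Γ.CoverEdge s)
  exact FreeGroup.of_injective (mul_left_cancel (h1.symm.trans h))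

theorem step_cover_iff {p q : Γ.CoverVert s} :
    (Γ.cover s).Step p q ↔ ∃ e, q.2.word = p.2.word * FreeGroup.of e := by
  constructor
  · rintro ⟨ε, rfl, rfl⟩
    exact ⟨_, coverLabel_spec ε⟩
  · rintro ⟨e, h⟩
    obtain ⟨ε, h1, h2, -⟩ := exists_coverEdge h
    exact ⟨ε, h1, h2⟩

theorem mem_reach_iff {p q : Γ.CoverVert s} :
    q ∈ (Γ.cover s).reach p ↔ ∃ μ, q.2.word = p.2.word * pos μ := by
  constructor
  · intro h
    change Relation.ReflTransGen _ _ _ at h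
    induction h with
    | refl => exact ⟨[], by simp⟩
    | tail _ h2 ih =>
      obtain ⟨μ, hμ⟩ := ih
      obtain ⟨e, he⟩ := step_cover_iff.1 h2
      exact ⟨μ ++ [e], by rw [he, hμ, pos_append, mul_assoc]; rfl⟩
  · rintro ⟨μ, hμ⟩
    induction μ generalizing p with
    | nil =>
      rw [coverVert_ext (p := q) (q := p) (by simpa using hμ)]
      exact Relation.ReflTransGen.refl
    | cons e μ ih =>
      obtain ⟨r, hr, -⟩ := exists_vert_of_append (μ := [e]) (ν := μ) hμ
      refine Relation.ReflTransGen.head (step_cover_iff.2 ⟨e, hr⟩) (ih ?_)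
      rw [hμ, hr, pos_cons, pos_singleton, mul_assoc]

/-- The set `V(g; F)` of the tree over `s`, for a word `g` and a set `F` of edges of `E`: the paths
`g c` with `c` a directed word whose first letter, if there is one, does not belong to `F`. -/
def cylWord (Γ : DirectedGraph V E) (s : V) (g : FreeGroup E) (F : Set E) :
    Set (Γ.CoverVert s) :=
  {q | ∃ c : List E, q.2.word = g * pos c ∧ ∀ e, c.head? = some e → e ∉ F}

/-- The set `V(g)` of the tree over `s`, for a word `g`. -/
def cone (Γ : DirectedGraph V E) (s : V) (g : FreeGroup E) : Set (Γ.CoverVert s) :=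
  Γ.cylWord s g ∅

theorem mem_cone {g : FreeGroup E} {q : Γ.CoverVert s} :
    q ∈ Γ.cone s g ↔ ∃ c : List E, q.2.word = g * pos c := by
  simp [cone, cylWord]

theorem reach_eq_cone (p : Γ.CoverVert s) : (Γ.cover s).reach p = Γ.cone s p.2.word := by
  ext q
  rw [mem_reach_iff, mem_cone]

/-- Edges of the tree with a given origin correspond to their labels, so that the sets `V(p; F)` of the
tree are the sets `cylWord`. -/
theorem cyl_eq_cylWord (p : Γ.CoverVert s) (F : Set (Γ.CoverEdge s)) (F' : Set E)
    (hF : ∀ ε ∈ (Γ.cover s).outEdges p, ε ∈ F ↔ coverLabel ε ∈ F') :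
    (Γ.cover s).cyl p F = Γ.cylWord s p.2.word F' := by
  ext q
  simp only [cyl, Set.mem_union, Set.mem_singleton_iff, Set.mem_iUnion, Set.mem_sdiff]
  constructor
  · rintro (rfl | ⟨ε, ⟨hε, hεF⟩, hq⟩)
    · exact ⟨[], by simp, by simp⟩
    · obtain ⟨μ, hμ⟩ := mem_reach_iff.1 hq
      have hl := coverLabel_spec ε
      obtain rfl : ε.1.1 = p := hε
      refine ⟨coverLabel ε :: μ, ?_, ?_⟩
      · rw [hμ, pos_cons, ← mul_assoc, ← hl]
        rfl
      · intro e he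
        obtain rfl : coverLabel ε = e := by simpa using he
        exact fun h => hεF ((hF ε rfl).2 h)
  · rintro ⟨c, hc, hcF⟩
    cases c with
    | nil => exact Or.inl (coverVert_ext (by simpa using hc))
    | cons e c =>
      right
      obtain ⟨r, hr, -⟩ := exists_vert_of_append (μ := [e]) (ν := c) hc
      obtain ⟨ε, h1, h2, rfl⟩ := exists_coverEdge hr
      refine ⟨ε, ⟨h1, fun h => hcF _ rfl ((hF ε h1).1 h)⟩, ?_⟩
      rw [h2, mem_reach_iff]
      exact ⟨c, by rw [hc, hr, pos_cons, pos_singleton, mul_assoc]⟩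

theorem mem_basicSets_cover {B : Set (Γ.CoverVert s)} :
    B ∈ (Γ.cover s).basicSets ↔
      B = ∅ ∨ ∃ (p : Γ.CoverVert s) (F : Set E), F.Finite ∧ B = Γ.cylWord s p.2.word F := by
  have hinj : ∀ p : Γ.CoverVert s, Set.InjOn coverLabel ((Γ.cover s).outEdges p) := by
    intro p ε hε ε' hε' h
    have h1 := coverLabel_spec ε
    have h2 := coverLabel_spec ε'
    have h3 : ε.1.1 = ε'.1.1 := Eq.trans hε (Eq.symm hε')
    rw [← h, ← h3, ← h1] at h2
    exact Subtype.ext (Prod.ext h3 (coverVert_ext h2.symm))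
  constructor
  · rintro (⟨p, F, hF, hfin, rfl⟩ | hB)
    · refine Or.inr ⟨p, coverLabel '' F, hfin.image _, cyl_eq_cylWord p F _ fun ε hε => ?_⟩
      exact ((hinj p).mem_image_iff hF hε).symm
    · exact Or.inl hB
  · rintro (rfl | ⟨p, F, hF, rfl⟩)
    · exact Or.inr rfl
    · refine Or.inl ⟨p, (Γ.cover s).outEdges p ∩ coverLabel ⁻¹' F, Set.inter_subset_left, ?_, ?_⟩
      · refine Set.Finite.of_finite_image (hF.subset ?_) ((hinj p).mono Set.inter_subset_left)
        rintro _ ⟨ε, hε, rfl⟩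
        exact hε.2
      · exact (cyl_eq_cylWord p ((Γ.cover s).outEdges p ∩ coverLabel ⁻¹' F) F
          fun ε hε => by simp [hε]).symm

theorem cylWord_mono {g : FreeGroup E} {F F' : Set E} (h : F ⊆ F') :
    Γ.cylWord s g F' ⊆ Γ.cylWord s g F := by
  rintro q ⟨c, hc, hF⟩
  exact ⟨c, hc, fun e he he' => hF e he (h he')⟩

theorem cylWord_subset_cone {g : FreeGroup E} {F : Set E} : Γ.cylWord s g F ⊆ Γ.cone s g :=
  cylWord_mono (Set.empty_subset _)

theorem cone_anti (g : FreeGroup E) (κ : List E) : Γ.cone s (g * pos κ) ⊆ Γ.cone s g := by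
  intro q hq
  obtain ⟨c, hc⟩ := mem_cone.1 hq
  exact mem_cone.2 ⟨κ ++ c, by rw [hc, pos_append, mul_assoc]⟩

/-- Two sets `V(g; F)` and `V(h; F')` that have a common point meet in the set `V(r; F'')` for the
first common descendant `r = ga = hb` of `g` and `h`.  The forbidden edges `F` at `g` restrict the
intersection only if `r = g`, since otherwise the first letter of `a` is already fixed and
allowed. -/
theorem exists_cylWord_inter {g h : FreeGroup E} {F F' : Set E} {z : Γ.CoverVert s}
    (hz : z ∈ Γ.cylWord s g F) (hz' : z ∈ Γ.cylWord s h F') :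
    ∃ a b : List E, NoCommonSuffix a b ∧ g * pos a = h * pos b ∧
      z ∈ Γ.cone s (g * pos a) ∧
      Γ.cylWord s g F ∩ Γ.cylWord s h F' =
        Γ.cylWord s (g * pos a) ({e ∈ F | a = []} ∪ {e ∈ F' | b = []}) := by
  obtain ⟨c, hc, hcF⟩ := hz
  obtain ⟨d, hd, hdF⟩ := hz'
  obtain ⟨a, b, κ, rfl, rfl, hab⟩ := exists_noCommonSuffix c d
  have hr : g * pos a = h * pos b := by
    have := hc.symm.trans hd
    rw [pos_append, pos_append, ← mul_assoc, ← mul_assoc] at this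
    exact mul_right_cancel this
  refine ⟨a, b, hab, hr, mem_cone.2 ⟨κ, by rw [hc, pos_append, mul_assoc]⟩, ?_⟩
  ext q
  constructor
  · rintro ⟨⟨c, hc', hcF'⟩, ⟨d, hd', hdF'⟩⟩
    have : pos c * (pos d)⁻¹ = pos a * (pos b)⁻¹ := by
      have h1 : pos c = g⁻¹ * q.2.word := by rw [hc']; group
      have h2 : pos d = h⁻¹ * q.2.word := by rw [hd']; group
      have h3 : g⁻¹ * h = pos a * (pos b)⁻¹ := by
        rw [eq_mul_inv_iff_mul_eq, mul_assoc, ← hr]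
        group
      rw [h1, h2, ← h3]
      group
    obtain ⟨l, rfl, rfl⟩ := hab.exists_eq_append this
    refine ⟨l, by rw [hc', pos_append, mul_assoc], ?_⟩
    rintro e he (⟨h1, rfl⟩ | ⟨h1, rfl⟩)
    · exact hcF' e (by simpa using he) h1
    · exact hdF' e (by simpa using he) h1
  · rintro ⟨l, hl, hlF⟩
    refine ⟨⟨a ++ l, by rw [hl, pos_append, mul_assoc], ?_⟩,
      ⟨b ++ l, by rw [hl, hr, pos_append, mul_assoc], ?_⟩⟩
    · intro e he heF
      cases a with
      | nil => exact hlF e (by simpa using he) (Or.inl ⟨heF, rfl⟩)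
      | cons f a => exact hcF e (by simpa using he) heF
    · intro e he heF
      cases b with
      | nil => exact hlF e (by simpa using he) (Or.inr ⟨heF, rfl⟩)
      | cons f b => exact hdF e (by simpa using he) heF

theorem inter_mem_basicSets {B C : Set (Γ.CoverVert s)} (hB : B ∈ (Γ.cover s).basicSets)
    (hC : C ∈ (Γ.cover s).basicSets) : B ∩ C ∈ (Γ.cover s).basicSets := by
  rw [mem_basicSets_cover] at *
  obtain rfl | ⟨p, F, hF, rfl⟩ := hB
  · simp
  obtain rfl | ⟨p', F', hF', rfl⟩ := hC
  · simp
  obtain h | ⟨z, hz, hz'⟩ := Set.eq_empty_or_nonempty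
    (Γ.cylWord s p.2.word F ∩ Γ.cylWord s p'.2.word F')
  · exact Or.inl h
  · obtain ⟨a, b, -, -, hza, heq⟩ := exists_cylWord_inter hz hz'
    obtain ⟨c, hc⟩ := mem_cone.1 hza
    rw [mul_assoc, ← pos_append] at hc
    obtain ⟨r, hr, -⟩ := exists_vert_of_append hc
    refine Or.inr ⟨r, _, ?_, hr ▸ heq⟩
    exact (hF.subset (Set.sep_subset _ _)).union (hF'.subset (Set.sep_subset _ _))

theorem basicSets_subset_ring {V E : Type*} (T : DirectedGraph V E) : T.basicSets ⊆ T.ring := by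
  intro B hB
  exact ⟨{B}, by simpa using hB, Set.finite_singleton B, Set.pairwiseDisjoint_singleton _ _,
    by simp⟩

theorem inter_mem_ring {B C : Set (Γ.CoverVert s)} (hB : B ∈ (Γ.cover s).ring)
    (hC : C ∈ (Γ.cover s).ring) : B ∩ C ∈ (Γ.cover s).ring := by
  obtain ⟨𝓑, h1, h2, h3, rfl⟩ := hB
  obtain ⟨𝓒, k1, k2, k3, rfl⟩ := hC
  refine ⟨Set.image2 (· ∩ ·) 𝓑 𝓒, ?_, h2.image2 _ k2, ?_, ?_⟩
  · rintro _ ⟨B, hB, C, hC, rfl⟩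
    exact inter_mem_basicSets (h1 hB) (k1 hC)
  · rintro _ ⟨B, hB, C, hC, rfl⟩ _ ⟨B', hB', C', hC', rfl⟩ hne
    by_cases hBB : B = B'
    · have hCC : C ≠ C' := fun h => hne (by rw [hBB, h])
      exact (k3 hC hC' hCC).mono Set.inter_subset_right Set.inter_subset_right
    · exact (h3 hB hB' hBB).mono Set.inter_subset_left Set.inter_subset_left
  · rw [Set.sUnion_inter_sUnion, Set.sUnion_image2]
    ext q
    simp only [Set.mem_iUnion, Set.mem_inter_iff, exists_prop, Set.mem_prod, Prod.exists]
    grind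

theorem cylWord_mem_ring (p : Γ.CoverVert s) {F : Set E} (hF : F.Finite) :
    Γ.cylWord s p.2.word F ∈ (Γ.cover s).ring :=
  basicSets_subset_ring _ (mem_basicSets_cover.2 (Or.inr ⟨p, F, hF, rfl⟩))

theorem cone_mem_ring (p : Γ.CoverVert s) : Γ.cone s p.2.word ∈ (Γ.cover s).ring :=
  cylWord_mem_ring p Set.finite_empty

end Tree

/-! ### Ultrafilters in the ring of a tree of paths -/

section Ultrafilter

variable {V E : Type*} {Γ : DirectedGraph V E} {s : V}

theorem IsRingFilter.nonempty_of_mem {X : Type*} {R U : Set (Set X)} (hU : IsRingFilter R U)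
    {B : Set X} (hB : B ∈ U) : B.Nonempty := by
  rw [Set.nonempty_iff_ne_empty]
  rintro rfl
  exact hU.empty_notMem hB

theorem Spectrum.eq_of_subset (x : (Γ.cover s).Spectrum) {W : Set (Set (Γ.CoverVert s))}
    (hW : IsRingFilter (Γ.cover s).ring W) (h : x.1 ⊆ W) : x.1 = W :=
  h.antisymm (x.2.2 hW h)

/-- A set of the ring that does not belong to an ultrafilter is disjoint from one that does. -/
theorem Spectrum.exists_disjoint (x : (Γ.cover s).Spectrum) {B : Set (Γ.CoverVert s)}
    (hB : B ∈ (Γ.cover s).ring) (hBx : B ∉ x.1) : ∃ C ∈ x.1, B ∩ C = ∅ := by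
  by_contra! hne
  obtain ⟨C₀, hC₀⟩ := x.2.prop.nonempty
  have hW : IsRingFilter (Γ.cover s).ring {D ∈ (Γ.cover s).ring | ∃ C ∈ x.1, B ∩ C ⊆ D} := by
    refine ⟨Set.sep_subset _ _, ⟨B, hB, C₀, hC₀, Set.inter_subset_left⟩, ?_, ?_, ?_⟩
    · rintro ⟨-, C, hC, h⟩
      exact (hne C hC).ne_empty (Set.subset_empty_iff.1 h)
    · rintro D ⟨hD, C, hC, h⟩ D' ⟨hD', C', hC', h'⟩
      refine ⟨inter_mem_ring hD hD', C ∩ C', x.2.prop.inter_mem C hC C' hC', ?_⟩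
      exact fun q hq => ⟨h ⟨hq.1, hq.2.1⟩, h' ⟨hq.1, hq.2.2⟩⟩
    · rintro D ⟨-, C, hC, h⟩ D' hD' hDD'
      exact ⟨hD', C, hC, h.trans hDD'⟩
  have heq := x.eq_of_subset hW fun C hC =>
    ⟨x.2.prop.subset hC, C, hC, Set.inter_subset_right⟩
  exact hBx (heq ▸ ⟨hB, C₀, hC₀, Set.inter_subset_left⟩)

theorem cone_eq_empty_or_exists_vert (p : Γ.CoverVert s) (μ : List E) :
    Γ.cone s (p.2.word * pos μ) = ∅ ∨
      ∃ r : Γ.CoverVert s, r.2.word = p.2.word * pos μ ∧ Γ.DWalk p.1 μ r.1 := by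
  obtain h | ⟨z, hz⟩ := (Γ.cone s (p.2.word * pos μ)).eq_empty_or_nonempty
  · exact Or.inl h
  · obtain ⟨c, hc⟩ := mem_cone.1 hz
    rw [mul_assoc, ← pos_append] at hc
    exact Or.inr (exists_vert_of_append hc)

theorem Spectrum.exists_disjoint_cone (x : (Γ.cover s).Spectrum) (p : Γ.CoverVert s) (μ : List E)
    (h : Γ.cone s (p.2.word * pos μ) ∉ x.1) :
    ∃ C ∈ x.1, Γ.cone s (p.2.word * pos μ) ∩ C = ∅ := by
  obtain h0 | ⟨r, hr, -⟩ := cone_eq_empty_or_exists_vert p μ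
  · obtain ⟨C, hC⟩ := x.2.prop.nonempty
    exact ⟨C, hC, by rw [h0, Set.empty_inter]⟩
  · rw [← hr] at h ⊢
    exact x.exists_disjoint (cone_mem_ring r) h

theorem cylWord_union_cone (g : FreeGroup E) (e : E) (F : Set E) :
    Γ.cylWord s g F ⊆ Γ.cylWord s g (insert e F) ∪ Γ.cone s (g * pos [e]) := by
  rintro q ⟨c, hc, hF⟩
  cases c with
  | nil => exact Or.inl ⟨[], hc, by simp⟩
  | cons f c =>
    by_cases hfe : f = e
    · subst hfe
      refine Or.inr (mem_cone.2 ⟨c, ?_⟩)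
      rw [hc, mul_assoc, ← pos_append]
      rfl
    · refine Or.inl ⟨f :: c, hc, ?_⟩
      intro e' he'
      obtain rfl : f = e' := by simpa using he'
      simp only [Set.mem_insert_iff, not_or]
      exact ⟨hfe, hF _ (by simp)⟩

/-- An ultrafilter that contains `V(p)`, but none of the finitely many sets `V(pe)`, `e ∈ F`, contains
`V(p; F)`. -/
theorem Spectrum.cylWord_mem (x : (Γ.cover s).Spectrum) (p : Γ.CoverVert s)
    (hp : Γ.cone s p.2.word ∈ x.1) {F : Set E} (hF : F.Finite)
    (h : ∀ e ∈ F, Γ.cone s (p.2.word * pos [e]) ∉ x.1) : Γ.cylWord s p.2.word F ∈ x.1 := by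
  induction F, hF using Set.Finite.induction_on with
  | empty => exact hp
  | @insert e F he hF ih =>
    have h1 := ih fun e he => h e (Or.inr he)
    obtain ⟨C, hC, hd⟩ := x.exists_disjoint_cone p [e] (h e (Or.inl rfl))
    refine x.2.prop.mem_of_superset _ (x.2.prop.inter_mem _ h1 C hC) _
      (cylWord_mem_ring p (hF.insert e)) ?_
    rintro q ⟨hq, hqC⟩
    refine (cylWord_union_cone _ e F hq).resolve_right fun hq' => ?_
    have : q ∈ (∅ : Set (Γ.CoverVert s)) := hd ▸ ⟨hq', hqC⟩
    exact this

theorem cylWord_inter_cone (g : FreeGroup E) {e : E} {F : Set E} (he : e ∈ F) :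
    Γ.cylWord s g F ∩ Γ.cone s (g * pos [e]) = ∅ := by
  rw [Set.eq_empty_iff_forall_notMem]
  rintro q ⟨⟨c, hc, hF⟩, hq⟩
  obtain ⟨d, hd⟩ := mem_cone.1 hq
  rw [hc, mul_assoc, ← pos_append] at hd
  obtain rfl := pos_injective (mul_left_cancel hd)
  exact hF e (by simp) he

theorem isRingFilter_fixedFilter (p : Γ.CoverVert s) :
    IsRingFilter (Γ.cover s).ring ((Γ.cover s).fixedFilter p) where
  subset := Set.sep_subset _ _
  nonempty := ⟨_, cone_mem_ring p, mem_cone.2 ⟨[], by simp⟩⟩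
  empty_notMem h := h.2
  inter_mem B hB C hC := ⟨inter_mem_ring hB.1 hC.1, hB.2, hC.2⟩
  mem_of_superset B hB C hC hBC := ⟨hC, hBC hB.2⟩

theorem reach_mem_ring (p : Γ.CoverVert s) : (Γ.cover s).reach p ∈ (Γ.cover s).ring := by
  rw [reach_eq_cone]
  exact cone_mem_ring p

theorem isRingFilter_pathFilter {ω : ℕ → Γ.CoverEdge s} (hω : (Γ.cover s).IsInfinitePath ω) :
    IsRingFilter (Γ.cover s).ring ((Γ.cover s).pathFilter ω) := by
  have hanti : Antitone fun j => (Γ.cover s).reach ((Γ.cover s).o (ω j)) := by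
    refine antitone_nat_of_succ_le fun j q hq => ?_
    rw [← hω j] at hq
    exact Relation.ReflTransGen.head ⟨ω j, rfl, rfl⟩ hq
  refine ⟨Set.sep_subset _ _, ⟨_, reach_mem_ring _, 0, subset_rfl⟩, ?_, ?_, ?_⟩
  · rintro ⟨-, j, h⟩
    exact h (show (Γ.cover s).o (ω j) ∈ _ from Relation.ReflTransGen.refl)
  · rintro B ⟨hB, i, hi⟩ C ⟨hC, j, hj⟩
    exact ⟨inter_mem_ring hB hC, max i j, Set.subset_inter
      ((hanti (le_max_left i j)).trans hi) ((hanti (le_max_right i j)).trans hj)⟩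
  · rintro B ⟨hB, i, hi⟩ C hC hBC
    exact ⟨hC, i, hi.trans hBC⟩

end Ultrafilter

/-! ### Path sets -/

section PathSet

variable {V E : Type*} {Γ : DirectedGraph V E} {S : Set V} {s : V}

/-- The indicator functions of the sets of finite initial segments of a finite or infinite directed
path of the graph that does not end in `S`.  An initial segment is recorded as the pair of
its origin and its list of edges.  The zero function also has this property; it serves
as the point at infinity. -/
structure IsPathSet (Γ : DirectedGraph V E) (S : Set V) (a : V × List E → Bool) : Prop where
  origin_unique : ∀ u μ v ν, a (u, μ) → a (v, ν) → u = v
  of_append : ∀ u μ ν, a (u, μ ++ ν) → a (u, μ)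
  comparable : ∀ u μ ν, a (u, μ) → a (u, ν) → μ <+: ν ∨ ν <+: μ
  walk : ∀ u μ, a (u, μ) → ∃ w, Γ.DWalk u μ w
  exit : ∀ u μ w, a (u, μ) → Γ.DWalk u μ w → w ∈ S → ∃ e, a (u, μ ++ [e])

theorem IsPathSet.nil_mem {a : V × List E → Bool} (ha : Γ.IsPathSet S a) {u : V} {μ : List E}
    (h : a (u, μ)) : a (u, []) := ha.of_append u [] μ h

/-- The filter in the ring of the tree over `s` given by a path set: it is generated by the
sets `V(μ; F)`, with `μ` in the path set and no `μe`, `e ∈ F`, in the path set. -/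
def pointFilter (Γ : DirectedGraph V E) (a : V × List E → Bool) (s : V) :
    Set (Set (Γ.CoverVert s)) :=
  {B ∈ (Γ.cover s).ring | ∃ μ F, a (s, μ) ∧ F.Finite ∧ (∀ e ∈ F, ¬ a (s, μ ++ [e])) ∧
    Γ.cylWord s (pos μ) F ⊆ B}

theorem exists_vert_pos {μ : List E} {w : V} (h : Γ.DWalk s μ w) :
    ∃ r : Γ.CoverVert s, r.2.word = pos μ ∧ r.1 = w :=
  ⟨DWalk.vert (Γ.base s) h, one_mul _, rfl⟩

variable {a : V × List E → Bool}

theorem IsPathSet.exists_vert (ha : Γ.IsPathSet S a) {μ : List E} (h : a (s, μ)) :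
    ∃ r : Γ.CoverVert s, r.2.word = pos μ := by
  obtain ⟨w, hw⟩ := ha.walk s μ h
  obtain ⟨r, hr, -⟩ := exists_vert_pos hw
  exact ⟨r, hr⟩

theorem IsPathSet.cylWord_mem_pointFilter (ha : Γ.IsPathSet S a) {μ : List E} {F : Set E}
    (h : a (s, μ)) (hF : F.Finite) (hFa : ∀ e ∈ F, ¬ a (s, μ ++ [e])) :
    Γ.cylWord s (pos μ) F ∈ Γ.pointFilter a s := by
  obtain ⟨r, hr⟩ := ha.exists_vert h
  exact ⟨hr ▸ cylWord_mem_ring r hF, μ, F, h, hF, hFa, subset_rfl⟩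

theorem IsPathSet.cone_mem_pointFilter (ha : Γ.IsPathSet S a) {μ : List E}
    (h : a (s, μ)) : Γ.cone s (pos μ) ∈ Γ.pointFilter a s :=
  ha.cylWord_mem_pointFilter h Set.finite_empty (by simp)

theorem cylWord_append_subset {g : FreeGroup E} {e : E} {F : Set E} {c : List E} (he : e ∉ F) :
    Γ.cone s (g * pos (e :: c)) ⊆ Γ.cylWord s g F := by
  intro q hq
  obtain ⟨d, hd⟩ := mem_cone.1 hq
  refine ⟨e :: c ++ d, by rw [hd, pos_append (e :: c), mul_assoc], ?_⟩
  intro e' he'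
  obtain rfl : e = e' := by simpa using he'
  exact he

theorem IsPathSet.exists_cylWord_subset_inter (ha : Γ.IsPathSet S a) {μ ν : List E}
    {F F' : Set E} (h : a (s, ν)) (hF : F.Finite) (hFa : ∀ e ∈ F, ¬ a (s, μ ++ [e]))
    (hF' : F'.Finite) (hFa' : ∀ e ∈ F', ¬ a (s, ν ++ [e])) (hμν : μ <+: ν) :
    ∃ F'' : Set E, F''.Finite ∧ (∀ e ∈ F'', ¬ a (s, ν ++ [e])) ∧
      Γ.cylWord s (pos ν) F'' ⊆ Γ.cylWord s (pos μ) F ∩ Γ.cylWord s (pos ν) F' := by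
  obtain ⟨c, rfl⟩ := hμν
  cases c with
  | nil =>
    rw [List.append_nil] at *
    refine ⟨F ∪ F', hF.union hF', ?_, Set.subset_inter (cylWord_mono Set.subset_union_left)
      (cylWord_mono Set.subset_union_right)⟩
    rintro e (he | he)
    exacts [hFa e he, hFa' e he]
  | cons e c =>
    refine ⟨F', hF', hFa', Set.subset_inter ?_ subset_rfl⟩
    rw [pos_append]
    refine cylWord_subset_cone.trans (cylWord_append_subset fun he => ?_)
    refine hFa e he (ha.of_append s _ c ?_)
    simpa using h

theorem IsPathSet.isRingFilter_pointFilter (ha : Γ.IsPathSet S a) (h : a (s, [])) :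
    IsRingFilter (Γ.cover s).ring (Γ.pointFilter a s) := by
  refine ⟨Set.sep_subset _ _, ⟨_, ha.cone_mem_pointFilter h⟩, ?_, ?_, ?_⟩
  · rintro ⟨-, μ, F, h1, -, -, h4⟩
    obtain ⟨r, hr⟩ := ha.exists_vert h1
    exact h4 (show r ∈ _ from ⟨[], by simp [hr], by simp⟩)
  · rintro B ⟨hB, μ, F, h1, h2, h3, h4⟩ C ⟨hC, ν, F', k1, k2, k3, k4⟩
    refine ⟨inter_mem_ring hB hC, ?_⟩
    rcases ha.comparable s μ ν h1 k1 with hμν | hμν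
    · obtain ⟨F'', l1, l2, l3⟩ := ha.exists_cylWord_subset_inter k1 h2 h3 k2 k3 hμν
      exact ⟨ν, F'', k1, l1, l2, l3.trans (Set.inter_subset_inter h4 k4)⟩
    · obtain ⟨F'', l1, l2, l3⟩ := ha.exists_cylWord_subset_inter h1 k2 k3 h2 h3 hμν
      refine ⟨μ, F'', h1, l1, l2, l3.trans ?_⟩
      rw [Set.inter_comm]
      exact Set.inter_subset_inter h4 k4
  · rintro B ⟨hB, μ, F, h1, h2, h3, h4⟩ C hC hBC
    exact ⟨hC, μ, F, h1, h2, h3, h4.trans hBC⟩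

/-- The place where the word `κ` leaves a path set. -/
theorem exists_last_prefix (h : a (s, [])) {κ : List E}
    (hκ : ¬ a (s, κ)) : ∃ μ e ν, κ = μ ++ e :: ν ∧ a (s, μ) ∧ ¬ a (s, μ ++ [e]) := by
  induction κ using List.reverseRecOn with
  | nil => exact absurd h hκ
  | append_singleton κ e ih =>
    by_cases h1 : a (s, κ)
    · exact ⟨κ, e, [], rfl, h1, hκ⟩
    · obtain ⟨μ, f, ν, rfl, h2, h3⟩ := ih h1
      exact ⟨μ, f, ν ++ [e], by simp, h2, h3⟩

theorem base_word (u : V) : (Γ.base u).2.word = 1 := rfl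

/-- The filter of a path set decides every basic set of the ring. -/
theorem IsPathSet.pointFilter_dichotomy (ha : Γ.IsPathSet S a) (h : a (s, []))
    {B : Set (Γ.CoverVert s)} (hB : B ∈ (Γ.cover s).basicSets) :
    B ∈ Γ.pointFilter a s ∨ ∃ C ∈ Γ.pointFilter a s, C ∩ B = ∅ := by
  have hBr := basicSets_subset_ring _ hB
  obtain rfl | ⟨p, F, hF, rfl⟩ := mem_basicSets_cover.1 hB
  · exact Or.inr ⟨_, ha.cone_mem_pointFilter h, Set.inter_empty _⟩
  obtain h0 | ⟨z, hz, hz'⟩ := (Γ.cone s (pos []) ∩ Γ.cylWord s p.2.word F).eq_empty_or_nonempty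
  · exact Or.inr ⟨_, ha.cone_mem_pointFilter h, h0⟩
  -- Within `V(s)` the basic set is `V(b; F')` for a directed word `b`.
  obtain ⟨b, c, -, -, -, heq⟩ := exists_cylWord_inter hz hz'
  rw [pos_nil, one_mul] at heq
  set F' := {e ∈ (∅ : Set E) | b = []} ∪ {e ∈ F | c = []} with hF'
  have hF'fin : F'.Finite := (Set.finite_empty.subset (Set.sep_subset _ _)).union
    (hF.subset (Set.sep_subset _ _))
  have key : ∀ C : Set (Γ.CoverVert s), C ⊆ Γ.cone s 1 → C ∩ Γ.cylWord s (pos b) F' = ∅ →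
      C ∩ Γ.cylWord s p.2.word F = ∅ := by
    intro C hC h1
    rw [← heq] at h1
    rw [← h1]
    ext q
    exact ⟨fun hq => ⟨hq.1, hC hq.1, hq.2⟩, fun hq => ⟨hq.1, hq.2.2⟩⟩
  have hcone : ∀ μ : List E, Γ.cone s (pos μ) ⊆ Γ.cone s 1 := fun μ => by
    simpa using cone_anti (Γ := Γ) (s := s) 1 μ
  by_cases hb : a (s, b)
  · by_cases he : ∃ e ∈ F', a (s, b ++ [e])
    · -- the path passes through `b` and leaves it by an edge of `F'`
      obtain ⟨e, he, hbe⟩ := he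
      refine Or.inr ⟨_, ha.cone_mem_pointFilter hbe, key _ (hcone _) ?_⟩
      rw [pos_append, Set.inter_comm, cylWord_inter_cone _ he]
    · push Not at he
      exact Or.inl ⟨hBr, b, F', hb, hF'fin, fun e h => by simpa using he e h,
        heq ▸ Set.inter_subset_right⟩
  · -- the path passes through `μ`, but does not continue with the letter `e` of `b`
    obtain ⟨μ, e, ν, rfl, hμ, hμe⟩ := exists_last_prefix h hb
    refine Or.inr ⟨Γ.cylWord s (pos μ) {e}, ha.cylWord_mem_pointFilter hμ
      (Set.finite_singleton e) (by simpa using hμe),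
      key _ (cylWord_subset_cone.trans (hcone _)) ?_⟩
    refine Set.subset_empty_iff.1 ?_
    rw [← cylWord_inter_cone (Γ := Γ) (s := s) (pos μ) (Set.mem_singleton e)]
    refine Set.inter_subset_inter subset_rfl (cylWord_subset_cone.trans ?_)
    rw [← pos_append, show μ ++ e :: ν = (μ ++ [e]) ++ ν by simp, pos_append (μ ++ [e])]
    exact cone_anti _ _

/-- Since a set of the ring is a finite union of basic sets, the filter of a path set either contains
it or contains a set disjoint from it. -/
theorem IsPathSet.maximal_pointFilter (ha : Γ.IsPathSet S a) (h : a (s, [])) :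
    Maximal (IsRingFilter (Γ.cover s).ring) (Γ.pointFilter a s) := by
  refine ⟨ha.isRingFilter_pointFilter h, fun W hW hle B hBW => ?_⟩
  have hB := hW.subset hBW
  obtain ⟨𝓒, hC, hfin, -, rfl⟩ := id hB
  by_contra hn
  have hd : ∀ D ∈ 𝓒, ∃ C ∈ Γ.pointFilter a s, C ∩ D = ∅ := by
    intro D hD
    refine (ha.pointFilter_dichotomy h (hC hD)).resolve_left fun h1 => hn ?_
    exact (ha.isRingFilter_pointFilter h).mem_of_superset D h1 _ hB (Set.subset_sUnion_of_mem hD)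
  have hall : ∃ C ∈ Γ.pointFilter a s, C ∩ ⋃₀ 𝓒 = ∅ := by
    clear hBW hB hn hC
    induction 𝓒, hfin using Set.Finite.induction_on with
    | empty => exact ⟨_, ha.cone_mem_pointFilter h, by simp⟩
    | @insert D 𝓒 hD hfin ih =>
      obtain ⟨C, h1, h2⟩ := ih fun D hD => hd D (Or.inr hD)
      obtain ⟨C', h1', h2'⟩ := hd D (Or.inl rfl)
      refine ⟨C ∩ C', (ha.isRingFilter_pointFilter h).inter_mem C h1 C' h1', ?_⟩
      rw [Set.sUnion_insert, Set.inter_union_distrib_left]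
      rw [Set.eq_empty_iff_forall_notMem] at *
      rintro q (hq | hq)
      · exact h2' q ⟨hq.1.2, hq.2⟩
      · exact h2 q ⟨hq.1.1, hq.2⟩
  obtain ⟨C, h1, h2⟩ := hall
  exact hW.empty_notMem (h2 ▸ hW.inter_mem C (hle h1) _ hBW)

/-- The point of the spectrum of the tree over `s` given by a path set. -/
def IsPathSet.point (ha : Γ.IsPathSet S a) (h : a (s, [])) : (Γ.cover s).Spectrum :=
  ⟨Γ.pointFilter a s, ha.maximal_pointFilter h⟩

theorem IsPathSet.cone_mem_pointFilter_iff (ha : Γ.IsPathSet S a) {μ : List E} :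
    Γ.cone s (pos μ) ∈ Γ.pointFilter a s ↔ a (s, μ) := by
  refine ⟨?_, ha.cone_mem_pointFilter⟩
  rintro ⟨-, ν, F, h1, h2, h3, h4⟩
  obtain ⟨r, hr⟩ := ha.exists_vert h1
  obtain ⟨c, hc⟩ := mem_cone.1 (h4 (show r ∈ _ from ⟨[], by simp [hr], by simp⟩))
  rw [hr, ← pos_append] at hc
  rw [pos_injective hc] at h1
  exact ha.of_append _ _ _ h1

open Classical in
/-- The path set of a point of the spectrum of the tree over `s`: the directed words `μ` with
`V(μ)` in the ultrafilter. -/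
def code (ξ : Γ.BundleSpectrum) : V × List E → Bool :=
  fun κ => decide (κ.1 = ξ.1 ∧ Γ.cone ξ.1 (pos κ.2) ∈ ξ.2.1)

theorem code_iff {x : (Γ.cover s).Spectrum} {u : V} {μ : List E} :
    code (⟨s, x⟩ : Γ.BundleSpectrum) (u, μ) ↔ u = s ∧ Γ.cone s (pos μ) ∈ x.1 := by
  simp [code]

theorem Spectrum.exists_vert_of_cone_mem (x : (Γ.cover s).Spectrum) {μ : List E}
    (h : Γ.cone s (pos μ) ∈ x.1) :
    ∃ r : Γ.CoverVert s, r.2.word = pos μ ∧ Γ.DWalk s μ r.1 := by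
  have h1 := cone_eq_empty_or_exists_vert (Γ.base s) μ
  rw [base_word, one_mul] at h1
  exact h1.resolve_left (x.2.prop.nonempty_of_mem h).ne_empty

theorem Spectrum.cone_mem_of_append (x : (Γ.cover s).Spectrum) {μ ν : List E}
    (h : Γ.cone s (pos (μ ++ ν)) ∈ x.1) : Γ.cone s (pos μ) ∈ x.1 := by
  obtain ⟨r, hr, hw⟩ := x.exists_vert_of_cone_mem h
  obtain ⟨v, hv, -⟩ := dWalk_append.1 hw
  obtain ⟨r', hr', -⟩ := exists_vert_pos hv
  refine x.2.prop.mem_of_superset _ h _ (hr' ▸ cone_mem_ring r') ?_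
  rw [pos_append]
  exact cone_anti _ _

/-- Two disjoint sets `V(μ)` and `V(ν)` cannot belong to the same ultrafilter. -/
theorem Spectrum.comparable (x : (Γ.cover s).Spectrum) {μ ν : List E}
    (h : Γ.cone s (pos μ) ∈ x.1) (h' : Γ.cone s (pos ν) ∈ x.1) : μ <+: ν ∨ ν <+: μ := by
  obtain ⟨z, hz, hz'⟩ := x.2.prop.nonempty_of_mem (x.2.prop.inter_mem _ h _ h')
  obtain ⟨c, hc⟩ := mem_cone.1 hz
  obtain ⟨d, hd⟩ := mem_cone.1 hz'
  rw [hc, ← pos_append, ← pos_append] at hd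
  have := pos_injective hd
  exact List.prefix_or_prefix_of_prefix ⟨c, rfl⟩ ⟨d, this.symm⟩

/-- The words of an ultrafilter form a path set, provided that they can be continued at the vertices
in `S`. -/
theorem isPathSet_code {x : (Γ.cover s).Spectrum}
    (hexit : ∀ μ w, Γ.cone s (pos μ) ∈ x.1 → Γ.DWalk s μ w → w ∈ S →
      ∃ e, Γ.cone s (pos (μ ++ [e])) ∈ x.1) :
    Γ.IsPathSet S (code (⟨s, x⟩ : Γ.BundleSpectrum)) where
  origin_unique u μ v ν h h' := (code_iff.1 h).1.trans (code_iff.1 h').1.symm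
  of_append u μ ν h :=
    code_iff.2 ⟨(code_iff.1 h).1, x.cone_mem_of_append (code_iff.1 h).2⟩
  comparable u μ ν h h' := x.comparable (code_iff.1 h).2 (code_iff.1 h').2
  walk u μ h := by
    obtain ⟨rfl, h⟩ := code_iff.1 h
    obtain ⟨r, -, hr⟩ := x.exists_vert_of_cone_mem h
    exact ⟨_, hr⟩
  exit u μ w h h1 h2 := by
    obtain ⟨rfl, h⟩ := code_iff.1 h
    obtain ⟨e, he⟩ := hexit μ w h h1 h2
    exact ⟨e, code_iff.2 ⟨rfl, he⟩⟩

theorem isPathSet_code_empty (x : (Γ.cover s).Spectrum) :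
    Γ.IsPathSet ∅ (code (⟨s, x⟩ : Γ.BundleSpectrum)) :=
  isPathSet_code fun _ _ _ _ h => h.elim

/-- An ultrafilter that contains `V(s)` is determined by the directed words `μ` such that it
contains `V(μ)`. -/
theorem Spectrum.eq_pointFilter (x : (Γ.cover s).Spectrum) (h : Γ.cone s 1 ∈ x.1) :
    x.1 = Γ.pointFilter (code (⟨s, x⟩ : Γ.BundleSpectrum)) s := by
  have ha := isPathSet_code_empty x
  have hle : Γ.pointFilter (code (⟨s, x⟩ : Γ.BundleSpectrum)) s ⊆ x.1 := by
    rintro B ⟨hB, μ, F, h1, h2, h3, h4⟩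
    refine x.2.prop.mem_of_superset _ ?_ B hB h4
    obtain ⟨r, hr⟩ := ha.exists_vert h1
    rw [← hr]
    refine x.cylWord_mem r (hr ▸ (code_iff.1 h1).2) h2 fun e he hmem => ?_
    rw [hr, ← pos_append] at hmem
    exact h3 e he (code_iff.2 ⟨rfl, hmem⟩)
  refine (hle.antisymm ?_).symm
  exact (ha.maximal_pointFilter (code_iff.2 ⟨rfl, h⟩)).2 x.2.prop hle

theorem IsPathSet.code_point (ha : Γ.IsPathSet S a) (h : a (s, [])) :
    code (⟨s, ha.point h⟩ : Γ.BundleSpectrum) = a := by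
  funext ⟨u, μ⟩
  rw [Bool.eq_iff_iff, code_iff]
  constructor
  · rintro ⟨rfl, h1⟩
    exact ha.cone_mem_pointFilter_iff.1 h1
  · intro h1
    obtain rfl := ha.origin_unique _ _ _ _ h1 h
    exact ⟨rfl, ha.cone_mem_pointFilter_iff.2 h1⟩

/-- If `μ` is the longest word in the path set of an ultrafilter containing `V(s)`, then this is
the fixed ultrafilter of the vertex `μ`. -/
theorem Spectrum.eq_fixedFilter (x : (Γ.cover s).Spectrum) (h : Γ.cone s 1 ∈ x.1)
    {p : Γ.CoverVert s} {μ : List E} (hp : p.2.word = pos μ) (hμ : Γ.cone s (pos μ) ∈ x.1)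
    (hlast : ∀ e, Γ.cone s (pos (μ ++ [e])) ∉ x.1) : x.1 = (Γ.cover s).fixedFilter p := by
  refine x.eq_of_subset (isRingFilter_fixedFilter p) ?_
  rw [x.eq_pointFilter h]
  rintro B ⟨hB, ν, F, h1, h2, h3, h4⟩
  refine ⟨hB, h4 ?_⟩
  rw [code_iff] at h1
  obtain ⟨c, rfl⟩ | ⟨c, rfl⟩ := x.comparable h1.2 hμ
  · refine ⟨c, by rw [hp, pos_append], fun e he heF => h3 e heF (code_iff.2 ⟨rfl, ?_⟩)⟩
    cases c with
    | nil => simp at he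
    | cons f c =>
      obtain rfl : f = e := by simpa using he
      exact x.cone_mem_of_append (μ := ν ++ [f]) (ν := c) (by simpa using hμ)
  · cases c with
    | nil => exact ⟨[], by simp [hp], by simp⟩
    | cons f c =>
      exact absurd (x.cone_mem_of_append (μ := μ ++ [f]) (ν := c) (by simpa using h1.2)) (hlast f)

/-- If the path set of an ultrafilter containing `V(s)` has no longest word, then the ultrafilter
is given by an infinite directed path starting at `s`. -/
theorem Spectrum.exists_eq_pathFilter (x : (Γ.cover s).Spectrum) (h : Γ.cone s 1 ∈ x.1)
    (hnext : ∀ μ, Γ.cone s (pos μ) ∈ x.1 → ∃ e, Γ.cone s (pos (μ ++ [e])) ∈ x.1) :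
    ∃ ω : ℕ → Γ.CoverEdge s, (Γ.cover s).o (ω 0) = Γ.base s ∧
      (Γ.cover s).IsInfinitePath ω ∧ x.1 = (Γ.cover s).pathFilter ω := by
  have : Nonempty E := ⟨(hnext [] h).choose⟩
  choose! f hf using hnext
  let m : ℕ → List E := fun n => Nat.rec [] (fun _ μ => μ ++ [f μ]) n
  have hm0 : m 0 = [] := rfl
  have hm1 : ∀ n, m (n + 1) = m n ++ [f (m n)] := fun n => rfl
  have hmem : ∀ n, Γ.cone s (pos (m n)) ∈ x.1 := by
    intro n
    induction n with
    | zero => simpa [hm0] using h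
    | succ n ih => exact hm1 n ▸ hf _ ih
  have hlen : ∀ n, (m n).length = n := by
    intro n
    induction n with
    | zero => rfl
    | succ n ih => simp [hm1, ih]
  choose v hv _ using fun n => x.exists_vert_of_cone_mem (hmem n)
  choose ω hω1 hω2 _ using fun n => exists_coverEdge (p := v n) (q := v (n + 1)) (e := f (m n))
    (by rw [hv, hv, hm1, pos_append, pos_singleton])
  have hω : (Γ.cover s).IsInfinitePath ω := fun n => by rw [hω1, hω2]
  refine ⟨ω, ?_, hω, ?_⟩
  · rw [hω1]
    exact coverVert_ext (by rw [hv, hm0]; rfl)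
  · refine x.eq_of_subset (isRingFilter_pathFilter hω) ?_
    rw [x.eq_pointFilter h]
    rintro B ⟨hB, ν, F, h1, h2, h3, h4⟩
    refine ⟨hB, ν.length + 1, subset_trans ?_ h4⟩
    rw [hω1, reach_eq_cone, hv]
    rw [code_iff] at h1
    obtain ⟨c, hc⟩ | ⟨c, hc⟩ := x.comparable h1.2 (hmem (ν.length + 1))
    · cases c with
      | nil =>
        have := congrArg List.length hc
        simp [hlen] at this
      | cons e c =>
        rw [← hc, pos_append]
        refine cylWord_append_subset fun he => h3 e he (code_iff.2 ⟨rfl, ?_⟩)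
        refine x.cone_mem_of_append (μ := ν ++ [e]) (ν := c) ?_
        have := hmem (ν.length + 1)
        rw [← hc] at this
        simpa using this
    · have := congrArg List.length hc
      simp [hlen] at this
      omega

theorem GPath.IsDirected.exists_eq_pos {u w : V} {p : Γ.GPath u w} (hp : p.IsDirected) :
    ∃ μ, p.word = pos μ := by
  classical
  refine ⟨p.word.toWord.map Prod.fst, ?_⟩
  have : (p.word.toWord.map Prod.fst).map (fun e => (e, true)) = p.word.toWord := by
    rw [List.map_map, List.map_congr_left (g := id), List.map_id]
    rintro ⟨e, b⟩ h
    have := hp (e, b) (by convert h)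
    simp at this
    simp [this]
  rw [pos, this, FreeGroup.mk_toWord]

theorem isDirected_of_word_eq {u w : V} {p : Γ.GPath u w} {μ : List E} (h : p.word = pos μ) :
    p.IsDirected := by
  classical
  intro a ha
  rw [h] at ha
  have ha' : a ∈ (pos μ).toWord := by convert ha
  rw [toWord_pos] at ha'
  obtain ⟨e, -, rfl⟩ := List.mem_map.1 ha'
  rfl

/-- The points of the spectrum that are given by directed paths of the graph are the
ultrafilters that contain `V(s)`. -/
theorem mem_directedPoints_iff {x : (Γ.cover s).Spectrum} :
    (⟨s, x⟩ : Γ.BundleSpectrum) ∈ Γ.directedPoints ↔ Γ.cone s 1 ∈ x.1 := by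
  have hbase : Γ.cone s 1 ∈ (Γ.cover s).ring := cone_mem_ring (Γ.base s)
  constructor
  · rintro (⟨p, hp, hx⟩ | ⟨ω, h0, hω, hx⟩)
    · obtain ⟨μ, hμ⟩ := hp.exists_eq_pos
      change x.1 = _ at hx
      rw [hx]
      exact ⟨hbase, mem_cone.2 ⟨μ, by simpa using hμ⟩⟩
    · change x.1 = _ at hx
      rw [hx]
      refine ⟨hbase, 0, ?_⟩
      rw [h0, reach_eq_cone, base_word]
  · intro h
    by_cases hnext : ∀ μ, Γ.cone s (pos μ) ∈ x.1 → ∃ e, Γ.cone s (pos (μ ++ [e])) ∈ x.1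
    · exact Or.inr (x.exists_eq_pathFilter h hnext)
    · push Not at hnext
      obtain ⟨μ, hμ, hlast⟩ := hnext
      obtain ⟨p, hp, -⟩ := x.exists_vert_of_cone_mem hμ
      exact Or.inl ⟨p, isDirected_of_word_eq hp, x.eq_fixedFilter h hp hμ hlast⟩

theorem mem_transversal_iff {x : (Γ.cover s).Spectrum} :
    (⟨s, x⟩ : Γ.BundleSpectrum) ∈ Γ.transversal S ↔ Γ.cone s 1 ∈ x.1 ∧
      ∀ p : Γ.CoverVert s, p.1 ∈ S → x.1 ≠ (Γ.cover s).fixedFilter p := by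
  rw [transversal, Set.mem_inter_iff, mem_directedPoints_iff, and_comm]
  rfl

theorem mem_transversal_iff_exit {x : (Γ.cover s).Spectrum} :
    (⟨s, x⟩ : Γ.BundleSpectrum) ∈ Γ.transversal S ↔ Γ.cone s 1 ∈ x.1 ∧
      ∀ μ w, Γ.cone s (pos μ) ∈ x.1 → Γ.DWalk s μ w → w ∈ S →
        ∃ e, Γ.cone s (pos (μ ++ [e])) ∈ x.1 := by
  rw [mem_transversal_iff]
  refine and_congr_right fun h => ⟨fun hx μ w h1 h2 h3 => ?_, fun hx p hp heq => ?_⟩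
  · by_contra! hlast
    obtain ⟨p, hp, rfl⟩ := exists_vert_pos h2
    exact hx p h3 (x.eq_fixedFilter h hp h1 hlast)
  · rw [heq] at h
    obtain ⟨μ, hμ⟩ := mem_cone.1 h.2
    rw [one_mul] at hμ
    have hw : Γ.DWalk s μ p.1 := p.2.dWalk hμ
    have hmem : Γ.cone s (pos μ) ∈ x.1 := by
      rw [heq]
      exact (isRingFilter_fixedFilter p).mem_of_superset _ ⟨cone_mem_ring p,
        mem_cone.2 ⟨[], by simp⟩⟩ _ (hμ ▸ cone_mem_ring p) (by rw [hμ])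
    obtain ⟨e, he⟩ := hx μ _ hmem hw hp
    rw [heq] at he
    obtain ⟨c, hc⟩ := mem_cone.1 he.2
    rw [hμ, ← pos_append] at hc
    have := congrArg List.length (pos_injective hc)
    simp at this

end PathSet

/-! ### The compact space of directed paths -/

section PathSpace

variable {V E : Type*} {Γ : DirectedGraph V E} {S : Set V}

variable (Γ S) in
/-- The space of all path sets, a model of the one point compactification of `X(E, S)`. -/
def PathSpace : Type _ := {a : V × List E → Bool // Γ.IsPathSet S a}

instance : TopologicalSpace (Γ.PathSpace S) := instTopologicalSpaceSubtype

instance : T2Space (Γ.PathSpace S) := inferInstanceAs (T2Space (Subtype _))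

/-- The path space is compact, since each of its defining conditions involves only finitely many
coordinates.  For the last condition this uses that vertices in `S` emit finitely many edges. -/
theorem compactSpace_pathSpace (hS : S ⊆ Γ.regular) : CompactSpace (Γ.PathSpace S) := by
  refine (isCompact_iff_compactSpace (s := {a : V × List E → Bool | Γ.IsPathSet S a})).1 ?_
  refine IsClosed.isCompact ?_
  have heq : {a : V × List E → Bool | Γ.IsPathSet S a} =
      {a | ∀ u μ v ν, a (u, μ) → a (v, ν) → u = v} ∩
      {a | ∀ u μ ν, a (u, μ ++ ν) → a (u, μ)} ∩
      {a | ∀ u μ ν, a (u, μ) → a (u, ν) → μ <+: ν ∨ ν <+: μ} ∩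
      {a | ∀ u μ, a (u, μ) → ∃ w, Γ.DWalk u μ w} ∩
      {a | ∀ u μ w, Γ.DWalk u μ w → w ∈ S → a (u, μ) → ∃ e ∈ Γ.outEdges w, a (u, μ ++ [e])} := by
    ext a
    constructor
    · intro ha
      refine ⟨⟨⟨⟨ha.1, ha.2⟩, ha.3⟩, ha.4⟩, fun u μ w h1 h2 h3 => ?_⟩
      obtain ⟨e, he⟩ := ha.exit u μ w h3 h1 h2
      obtain ⟨w', hw'⟩ := ha.walk _ _ he
      obtain ⟨v, hv, hv'⟩ := dWalk_append.1 hw'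
      obtain rfl := IsWalk.right_unique h1 hv
      exact ⟨e, (dWalk_cons.1 hv').1, he⟩
    · rintro ⟨⟨⟨⟨h1, h2⟩, h3⟩, h4⟩, h5⟩
      refine ⟨h1, h2, h3, h4, fun u μ w k1 k2 k3 => ?_⟩
      obtain ⟨e, -, he⟩ := h5 u μ w k2 k3 k1
      exact ⟨e, he⟩
  have h1 : ∀ κ, IsClosed {a : V × List E → Bool | a κ} := fun κ =>
    (isClosed_discrete ({true} : Set Bool)).preimage
      (continuous_apply (A := fun _ : V × List E => Bool) κ)
  have h0 : ∀ κ, IsOpen {a : V × List E → Bool | a κ} := fun κ =>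
    (isOpen_discrete ({true} : Set Bool)).preimage
      (continuous_apply (A := fun _ : V × List E => Bool) κ)
  rw [heq]
  refine IsClosed.inter (IsClosed.inter (IsClosed.inter (IsClosed.inter ?_ ?_) ?_) ?_) ?_ <;>
    simp only [Set.ofPred_forall]
  · exact isClosed_iInter fun u => isClosed_iInter fun μ => isClosed_iInter fun v =>
      isClosed_iInter fun ν => isClosed_imp (h0 _) (isClosed_imp (h0 _) isClosed_const)
  · exact isClosed_iInter fun u => isClosed_iInter fun μ => isClosed_iInter fun ν =>
      isClosed_imp (h0 _) (h1 _)
  · exact isClosed_iInter fun u => isClosed_iInter fun μ => isClosed_iInter fun ν =>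
      isClosed_imp (h0 _) (isClosed_imp (h0 _) isClosed_const)
  · exact isClosed_iInter fun u => isClosed_iInter fun μ => isClosed_imp (h0 _) isClosed_const
  · refine isClosed_iInter fun u => isClosed_iInter fun μ => isClosed_iInter fun w =>
      isClosed_iInter fun _ => isClosed_iInter fun hw => isClosed_imp (h0 _) ?_
    have : {a : V × List E → Bool | ∃ e ∈ Γ.outEdges w, a (u, μ ++ [e])} =
        ⋃ e ∈ Γ.outEdges w, {a | a (u, μ ++ [e])} := by
      ext a
      simp
    rw [this]
    exact (hS hw).2.isClosed_biUnion fun e _ => h1 _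

namespace PathSpace

theorem isClopen_coord (κ : V × List E) : IsClopen {a : Γ.PathSpace S | a.1 κ} :=
  (isClopen_discrete {true}).preimage ((continuous_apply κ).comp continuous_subtype_val)

theorem origin_unique (a : Γ.PathSpace S) {u v : V} {μ ν : List E} (h : a.1 (u, μ))
    (h' : a.1 (v, ν)) : u = v := a.2.origin_unique u μ v ν h h'

theorem continuous_of_coord {X : Type*} [TopologicalSpace X] {f : X → Γ.PathSpace S}
    (h : ∀ κ, IsClopen {x | (f x).1 κ}) : Continuous f := by
  refine Continuous.subtype_mk (f := fun x => (f x).1) (continuous_pi fun κ => ?_) _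
  refine continuous_def.2 fun s _ => ?_
  have h1 : ∀ b : Bool, IsOpen {x | (f x).1 κ = b} := by
    rintro (_ | _)
    · simpa [Set.compl_ofPred] using (h κ).compl.isOpen
    · exact (h κ).isOpen
  have : (fun x => (f x).1 κ) ⁻¹' s = ⋃ b ∈ s, {x | (f x).1 κ = b} := by
    ext x
    simp
  rw [this]
  exact isOpen_biUnion fun b _ => h1 b

/-- The zero path set, which is the point at infinity. -/
instance : Zero (Γ.PathSpace S) :=
  ⟨⟨fun _ => false, by constructor <;> simp⟩⟩

theorem not_zero_apply (κ : V × List E) : ¬ (0 : Γ.PathSpace S).1 κ := Bool.false_ne_true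

theorem ne_zero_of_apply {a : Γ.PathSpace S} {κ : V × List E} (h : a.1 κ) : a ≠ 0 := by
  rintro rfl
  exact not_zero_apply κ h

theorem exists_of_ne_zero {a : Γ.PathSpace S} (h : a ≠ 0) : ∃ s, a.1 (s, []) := by
  by_contra! hn
  refine h (Subtype.ext (funext fun κ => ?_))
  by_contra hκ
  exact hn κ.1 (a.2.nil_mem (u := κ.1) (μ := κ.2) (by simpa [Zero.zero, OfNat.ofNat] using hκ))

end PathSpace

open Classical in
/-- The partial action on path sets of a letter: of an edge `e`, which is attached to the paths that
start at `t(e)`, or of a reversed edge, which removes `e` from the paths that start with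
`e`.  All other path sets are mapped to zero. -/
def shiftFun (Γ : DirectedGraph V E) : E × Bool → (V × List E → Bool) → V × List E → Bool
  | (e, true), a, (u, []) => decide (u = Γ.o e) && a (Γ.t e, [])
  | (e, true), a, (u, f :: μ) => decide (u = Γ.o e ∧ f = e) && a (Γ.t e, μ)
  | (e, false), a, (u, μ) => decide (u = Γ.t e) && a (Γ.o e, e :: μ)

theorem shiftFun_true_nil {e : E} {a : V × List E → Bool} {u : V} :
    Γ.shiftFun (e, true) a (u, []) ↔ u = Γ.o e ∧ a (Γ.t e, []) := by
  simp [shiftFun]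

theorem shiftFun_true_cons {e : E} {a : V × List E → Bool} {u : V} {f : E} {μ : List E} :
    Γ.shiftFun (e, true) a (u, f :: μ) ↔ u = Γ.o e ∧ f = e ∧ a (Γ.t e, μ) := by
  simp [shiftFun, and_assoc]

theorem shiftFun_false {e : E} {a : V × List E → Bool} {u : V} {μ : List E} :
    Γ.shiftFun (e, false) a (u, μ) ↔ u = Γ.t e ∧ a (Γ.o e, e :: μ) := by
  simp [shiftFun]

theorem IsPathSet.shiftFun_true {a : V × List E → Bool} (ha : Γ.IsPathSet S a) (e : E) :
    Γ.IsPathSet S (Γ.shiftFun (e, true) a) where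
  origin_unique u μ v ν h h' := by
    have : ∀ u μ, Γ.shiftFun (e, true) a (u, μ) → u = Γ.o e := by
      rintro u (_ | ⟨f, μ⟩) h
      exacts [(shiftFun_true_nil.1 h).1, (shiftFun_true_cons.1 h).1]
    rw [this _ _ h, this _ _ h']
  of_append u μ ν h := by
    rcases μ with _ | ⟨f, μ⟩ <;> rcases ν with _ | ⟨g, ν⟩ <;>
      simp only [List.nil_append, List.append_nil, List.cons_append, shiftFun_true_nil,
        shiftFun_true_cons] at h ⊢
    · exact h
    · exact ⟨h.1, ha.nil_mem h.2.2⟩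
    · exact h
    · exact ⟨h.1, h.2.1, ha.of_append _ _ _ h.2.2⟩
  comparable u μ ν h h' := by
    rcases μ with _ | ⟨f, μ⟩ <;> rcases ν with _ | ⟨g, ν⟩
    · simp
    · simp
    · simp
    · rw [shiftFun_true_cons] at h h'
      obtain ⟨-, rfl, h⟩ := h
      obtain ⟨-, rfl, h'⟩ := h'
      simpa using ha.comparable _ _ _ h h'
  walk u μ h := by
    rcases μ with _ | ⟨f, μ⟩
    · exact ⟨u, rfl⟩
    · rw [shiftFun_true_cons] at h
      obtain ⟨rfl, rfl, h⟩ := h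
      obtain ⟨w, hw⟩ := ha.walk _ _ h
      exact ⟨w, dWalk_cons.2 ⟨rfl, hw⟩⟩
  exit u μ w h hw hwS := by
    rcases μ with _ | ⟨f, μ⟩
    · rw [shiftFun_true_nil] at h
      exact ⟨e, by simpa [shiftFun_true_cons] using h⟩
    · rw [shiftFun_true_cons] at h
      obtain ⟨rfl, rfl, h⟩ := h
      obtain ⟨g, hg⟩ := ha.exit _ _ _ h (dWalk_cons.1 hw).2 hwS
      exact ⟨g, by rw [List.cons_append, shiftFun_true_cons]; exact ⟨rfl, rfl, hg⟩⟩

theorem IsPathSet.shiftFun_false {a : V × List E → Bool} (ha : Γ.IsPathSet S a) (e : E) :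
    Γ.IsPathSet S (Γ.shiftFun (e, false) a) where
  origin_unique u μ v ν h h' :=
    (DirectedGraph.shiftFun_false.1 h).1.trans (DirectedGraph.shiftFun_false.1 h').1.symm
  of_append u μ ν h := by
    rw [DirectedGraph.shiftFun_false] at h ⊢
    exact ⟨h.1, ha.of_append _ (e :: μ) ν h.2⟩
  comparable u μ ν h h' := by
    simpa using ha.comparable _ _ _ (DirectedGraph.shiftFun_false.1 h).2
      (DirectedGraph.shiftFun_false.1 h').2
  walk u μ h := by
    obtain ⟨rfl, h'⟩ := DirectedGraph.shiftFun_false.1 h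
    obtain ⟨w, hw⟩ := ha.walk _ _ h'
    exact ⟨w, (dWalk_cons.1 hw).2⟩
  exit u μ w h hw hwS := by
    obtain ⟨rfl, h'⟩ := DirectedGraph.shiftFun_false.1 h
    obtain ⟨f, hf⟩ := ha.exit _ _ _ h' (dWalk_cons.2 ⟨rfl, hw⟩) hwS
    exact ⟨f, DirectedGraph.shiftFun_false.2 ⟨rfl, hf⟩⟩

theorem IsPathSet.shiftFun {a : V × List E → Bool} (ha : Γ.IsPathSet S a) (l : E × Bool) :
    Γ.IsPathSet S (Γ.shiftFun l a) := by
  obtain ⟨e, b⟩ := l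
  cases b
  exacts [ha.shiftFun_false e, ha.shiftFun_true e]

namespace PathSpace

/-- The partial action of a letter on the path space. -/
def shift (l : E × Bool) (a : Γ.PathSpace S) : Γ.PathSpace S := ⟨Γ.shiftFun l a.1, a.2.shiftFun l⟩

theorem shift_true_nil {e : E} {a : Γ.PathSpace S} {u : V} :
    (shift (e, true) a).1 (u, []) ↔ u = Γ.o e ∧ a.1 (Γ.t e, []) := shiftFun_true_nil

theorem shift_true_cons {e : E} {a : Γ.PathSpace S} {u : V} {f : E} {μ : List E} :
    (shift (e, true) a).1 (u, f :: μ) ↔ u = Γ.o e ∧ f = e ∧ a.1 (Γ.t e, μ) := shiftFun_true_cons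

theorem shift_false {e : E} {a : Γ.PathSpace S} {u : V} {μ : List E} :
    (shift (e, false) a).1 (u, μ) ↔ u = Γ.t e ∧ a.1 (Γ.o e, e :: μ) := DirectedGraph.shiftFun_false

theorem continuous_shift (l : E × Bool) : Continuous (shift l : Γ.PathSpace S → Γ.PathSpace S) := by
  have hc : ∀ (p : Prop) (κ : V × List E), IsClopen {a : Γ.PathSpace S | p ∧ a.1 κ} := by
    intro p κ
    by_cases hp : p
    · simpa [hp] using isClopen_coord κ
    · simpa [hp] using isClopen_empty
  refine continuous_of_coord ?_
  obtain ⟨e, _ | _⟩ := l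
  · rintro ⟨u, μ⟩
    simp only [shift_false]
    exact hc _ _
  · rintro ⟨u, _ | ⟨f, μ⟩⟩
    · simp only [shift_true_nil]
      exact hc _ _
    · simp only [shift_true_cons, ← and_assoc]
      exact hc _ _

theorem ext_iff' {a b : Γ.PathSpace S} (h : ∀ u μ, a.1 (u, μ) ↔ b.1 (u, μ)) : a = b :=
  Subtype.ext (funext fun ⟨u, μ⟩ => Bool.eq_iff_iff.2 (h u μ))

theorem shift_zero (l : E × Bool) : shift l (0 : Γ.PathSpace S) = 0 := by
  refine ext_iff' ?_
  obtain ⟨e, _ | _⟩ := l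
  · intro u μ
    simp [shift_false, not_zero_apply]
  · rintro u (_ | ⟨f, μ⟩)
    · simp [shift_true_nil, not_zero_apply]
    · simp [shift_true_cons, not_zero_apply]

/-- A letter can act on the path set `a` if and only if `a` starts with the inverse letter. -/
theorem shift_ne_zero_iff_true {e : E} {a : Γ.PathSpace S} :
    shift (e, true) a ≠ 0 ↔ a.1 (Γ.t e, []) := by
  constructor
  · intro h
    obtain ⟨s, hs⟩ := exists_of_ne_zero h
    exact (shift_true_nil.1 hs).2
  · intro h
    exact ne_zero_of_apply (shift_true_nil.2 ⟨rfl, h⟩)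

theorem shift_ne_zero_iff_false {e : E} {a : Γ.PathSpace S} :
    shift (e, false) a ≠ 0 ↔ a.1 (Γ.o e, [e]) := by
  constructor
  · intro h
    obtain ⟨s, hs⟩ := exists_of_ne_zero h
    exact (shift_false.1 hs).2
  · intro h
    exact ne_zero_of_apply (shift_false.2 ⟨rfl, h⟩)

/-- The partial actions of a letter and of the inverse letter are inverse to each other. -/
theorem shift_shift_not {e : E} {b : Bool} {a : Γ.PathSpace S} (h : shift (e, !b) a ≠ 0) :
    shift (e, b) (shift (e, !b) a) = a := by
  cases b
  · rw [Bool.not_false, shift_ne_zero_iff_true] at h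
    refine ext_iff' fun u μ => ?_
    rw [Bool.not_false, shift_false, shift_true_cons]
    constructor
    · rintro ⟨rfl, -, -, h⟩
      exact h
    · intro h'
      obtain rfl := a.2.origin_unique _ _ _ _ h h'
      exact ⟨rfl, rfl, rfl, h'⟩
  · rw [Bool.not_true, shift_ne_zero_iff_false] at h
    refine ext_iff' fun u μ => ?_
    rcases μ with _ | ⟨f, μ⟩
    · rw [Bool.not_true, shift_true_nil, shift_false]
      constructor
      · rintro ⟨rfl, -, h⟩
        exact a.2.nil_mem h
      · intro h'
        exact ⟨a.2.origin_unique _ _ _ _ h' h, rfl, h⟩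
    · rw [Bool.not_true, shift_true_cons, shift_false]
      constructor
      · rintro ⟨rfl, rfl, -, h⟩
        exact h
      · intro h'
        obtain rfl := a.2.origin_unique _ _ _ _ h h'
        have := a.2.comparable _ _ _ h h'
        obtain rfl : f = e := by
          simp only [List.cons_prefix_cons, List.nil_prefix, and_true, List.prefix_nil] at this
          rcases this with h | h
          exacts [h.symm, h.1]
        exact ⟨rfl, rfl, rfl, h'⟩

/-- The partial action of a word on the path space. -/
def act (w : List (E × Bool)) (a : Γ.PathSpace S) : Γ.PathSpace S := w.foldr shift a

@[simp] theorem act_nil (a : Γ.PathSpace S) : act [] a = a := rfl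

@[simp] theorem act_cons (l : E × Bool) (w : List (E × Bool)) (a : Γ.PathSpace S) :
    act (l :: w) a = shift l (act w a) := rfl

theorem act_append (w w' : List (E × Bool)) (a : Γ.PathSpace S) :
    act (w ++ w') a = act w (act w' a) := by
  simp [act]

theorem act_zero (w : List (E × Bool)) : act w (0 : Γ.PathSpace S) = 0 := by
  induction w with
  | nil => rfl
  | cons l w ih => rw [act_cons, ih, shift_zero]

theorem continuous_act (w : List (E × Bool)) :
    Continuous (act w : Γ.PathSpace S → Γ.PathSpace S) := by
  induction w with
  | nil => exact continuous_id
  | cons l w ih => exact (continuous_shift l).comp ih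

/-- Free reduction of a word can only enlarge the domain of its partial action. -/
theorem act_red {w w' : List (E × Bool)} (h : FreeGroup.Red w w') {a : Γ.PathSpace S}
    (ha : act w a ≠ 0) : act w' a = act w a := by
  induction h with
  | refl => rfl
  | tail _ hs ih =>
    rw [← ih] at ha ⊢
    cases hs with
    | @not L₁ L₂ e b =>
      rw [act_append] at ha ⊢
      rw [act_append]
      congr 1
      simp only [act_cons] at ha ⊢
      have h1 : shift (e, !b) (act L₂ a) ≠ 0 := by
        intro h0
        rw [h0, shift_zero, act_zero] at ha
        exact ha rfl
      rw [shift_shift_not h1]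

theorem act_invRev_act {w : List (E × Bool)} {a : Γ.PathSpace S} (ha : act w a ≠ 0) :
    act (FreeGroup.invRev w) (act w a) = a := by
  induction w with
  | nil => rfl
  | cons l w ih =>
    obtain ⟨e, b⟩ := l
    have h1 : act w a ≠ 0 := by
      intro h0
      rw [act_cons, h0, shift_zero] at ha
      exact ha rfl
    have h2 : FreeGroup.invRev ((e, b) :: w) = FreeGroup.invRev w ++ [(e, !b)] := by
      simp [FreeGroup.invRev]
    rw [h2, act_append, act_cons, act_cons, act_nil]
    have h3 := shift_shift_not (e := e) (b := !b) (a := act w a)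
    rw [Bool.not_not] at h3
    rw [h3 ha, ih h1]

theorem shift_walk {l : E × Bool} {a : Γ.PathSpace S} {s r : V} (hs : a.1 (s, []))
    (hr : (shift l a).1 (r, [])) : Γ.origin l = r ∧ Γ.terminus l = s := by
  obtain ⟨e, _ | _⟩ := l
  · obtain ⟨rfl, h⟩ := shift_false.1 hr
    exact ⟨rfl, a.2.origin_unique _ _ _ _ h hs⟩
  · obtain ⟨rfl, h⟩ := shift_true_nil.1 hr
    exact ⟨rfl, a.2.origin_unique _ _ _ _ h hs⟩

/-- A word that acts on a path starting at `s`, with the result starting at `r`, is a walk from `r` to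
`s`. -/
theorem act_walk {w : List (E × Bool)} {a : Γ.PathSpace S} {s r : V} (hs : a.1 (s, []))
    (hr : (act w a).1 (r, [])) : Γ.IsWalk r w s := by
  induction w generalizing r with
  | nil => exact a.2.origin_unique _ _ _ _ hr hs
  | cons l w ih =>
    have h0 : act w a ≠ 0 := by
      intro h0
      rw [act_cons, h0, shift_zero] at hr
      exact not_zero_apply _ hr
    obtain ⟨v, hv⟩ := exists_of_ne_zero h0
    obtain ⟨h1, h2⟩ := shift_walk hv hr
    exact ⟨h1, h2 ▸ ih hv⟩

/-- A directed word acts on all paths that start at its end. -/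
theorem act_map_true {μ : List E} {u v : V} (hμ : Γ.DWalk u μ v) {a : Γ.PathSpace S}
    (ha : a.1 (v, [])) : (act (μ.map fun e => (e, true)) a).1 (u, []) := by
  induction μ generalizing u with
  | nil =>
    obtain rfl := dWalk_nil.1 hμ
    exact ha
  | cons e μ ih =>
    obtain ⟨rfl, h⟩ := dWalk_cons.1 hμ
    exact shift_true_nil.2 ⟨rfl, ih h⟩

/-- The inverse of a directed word acts on the paths that start with this word. -/
theorem act_negWord {μ : List E} {u v : V} (hμ : Γ.DWalk u μ v) {a : Γ.PathSpace S} {ν : List E}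
    (ha : a.1 (u, μ ++ ν)) : (act (negWord μ) a).1 (v, ν) := by
  induction μ generalizing u a with
  | nil =>
    obtain rfl := dWalk_nil.1 hμ
    exact ha
  | cons e μ ih =>
    obtain ⟨rfl, h⟩ := dWalk_cons.1 hμ
    rw [negWord_cons, act_append]
    exact ih h (shift_false.2 ⟨rfl, ha⟩)

end PathSpace

end PathSpace

/-! ### The groupoid in terms of the partial action on the path space -/

section Bridge

universe u v
variable {V : Type u} {E : Type v} {Γ : DirectedGraph V E} {S : Set V} {r s : V}

theorem image_trans_cone (α : Γ.GPath r s) (g : FreeGroup E) :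
    (trans α).vert '' Γ.cone s g = Γ.cone r (α.word * g) := by
  ext q
  constructor
  · rintro ⟨p, hp, rfl⟩
    obtain ⟨c, hc⟩ := mem_cone.1 hp
    refine mem_cone.2 ⟨c, ?_⟩
    change α.word * p.2.word = _
    rw [hc, mul_assoc]
  · intro hq
    obtain ⟨c, hc⟩ := mem_cone.1 hq
    refine ⟨(trans α).vert.symm q, mem_cone.2 ⟨c, ?_⟩, Equiv.apply_symm_apply _ _⟩
    change α.word⁻¹ * q.2.word = _
    rw [hc]
    group

theorem image_mem_act_iff (α : Γ.GPath r s) (x : (Γ.cover s).Spectrum)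
    (B : Set (Γ.CoverVert s)) : (trans α).vert '' B ∈ (act α x).1 ↔ B ∈ x.1 :=
  (Set.image_injective.2 (trans α).vert.injective).mem_set_image

theorem cone_mem_act_iff (α : Γ.GPath r s) (x : (Γ.cover s).Spectrum) (g : FreeGroup E) :
    Γ.cone r g ∈ (act α x).1 ↔ Γ.cone s (α.word⁻¹ * g) ∈ x.1 := by
  rw [← image_mem_act_iff α x, image_trans_cone, mul_inv_cancel_left]

theorem image_mem_ring_iff (α : Γ.GPath r s) (B : Set (Γ.CoverVert s)) :
    (trans α).vert '' B ∈ (Γ.cover r).ring ↔ B ∈ (Γ.cover s).ring := by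
  refine ⟨fun h => ?_, (trans α).image_ring⟩
  have := (trans α).symm.image_ring h
  rwa [Iso.image_symm_image] at this

/-- A fixed ultrafilter of a vertex lying over `S` is mapped to another one, so that only the condition
`V(r) ∈ αx` has to be checked for the range. -/
theorem act_mem_transversal_iff (α : Γ.GPath r s) {x : (Γ.cover s).Spectrum}
    (hx : (⟨s, x⟩ : Γ.BundleSpectrum) ∈ Γ.transversal S) :
    (⟨r, act α x⟩ : Γ.BundleSpectrum) ∈ Γ.transversal S ↔ Γ.cone s α.word⁻¹ ∈ x.1 := by
  rw [mem_transversal_iff] at hx ⊢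
  rw [cone_mem_act_iff, mul_one]
  refine ⟨fun h => h.1, fun h => ⟨h, fun p hp heq => hx.2 ((trans α).vert.symm p) hp ?_⟩⟩
  ext B
  rw [← image_mem_act_iff α x, heq, fixedFilter, fixedFilter, Set.mem_sep_iff, Set.mem_sep_iff,
    image_mem_ring_iff, Equiv.image_eq_preimage_symm, Set.mem_preimage]

/-- The path set of a point of `X(E, S)`. -/
def pathSet (ξ : Γ.transversal S) : Γ.PathSpace S :=
  ⟨code ξ.1, isPathSet_code (mem_transversal_iff_exit.1 ξ.2).2⟩

theorem pathSet_iff {x : (Γ.cover s).Spectrum}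
    {h : (⟨s, x⟩ : Γ.BundleSpectrum) ∈ Γ.transversal S} {u : V} {μ : List E} :
    (pathSet ⟨⟨s, x⟩, h⟩).1 (u, μ) ↔ u = s ∧ Γ.cone s (pos μ) ∈ x.1 := code_iff

theorem pathSet_nil (ξ : Γ.transversal S) : (pathSet ξ).1 (ξ.1.1, []) :=
  pathSet_iff.2 ⟨rfl, (mem_transversal_iff.1 ξ.2).1⟩

theorem pathSet_injective : Function.Injective (pathSet : Γ.transversal S → Γ.PathSpace S) := by
  rintro ⟨⟨s, x⟩, hx⟩ ⟨⟨t, y⟩, hy⟩ h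
  have h1 : (pathSet ⟨⟨s, x⟩, hx⟩).1 (s, []) := pathSet_nil ⟨⟨s, x⟩, hx⟩
  rw [h] at h1
  obtain rfl := (pathSet_iff.1 h1).1
  have hcode : code (⟨s, x⟩ : Γ.BundleSpectrum) = code ⟨s, y⟩ := congrArg Subtype.val h
  have : x = y := by
    apply Subtype.ext
    rw [x.eq_pointFilter (mem_transversal_iff.1 hx).1, hcode,
      ← y.eq_pointFilter (mem_transversal_iff.1 hy).1]
  subst this
  rfl

theorem PathSpace.point_mem_transversal (a : Γ.PathSpace S) (h : a.1 (s, [])) :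
    (⟨s, a.2.point h⟩ : Γ.BundleSpectrum) ∈ Γ.transversal S := by
  refine mem_transversal_iff_exit.2 ⟨a.2.cone_mem_pointFilter h, fun μ w h1 h2 h3 => ?_⟩
  obtain ⟨e, he⟩ := a.2.exit s μ w (a.2.cone_mem_pointFilter_iff.1 h1) h2 h3
  exact ⟨e, a.2.cone_mem_pointFilter he⟩

/-- The point of `X(E, S)` given by a nonzero path set. -/
def PathSpace.toPoint (a : Γ.PathSpace S) (h : a.1 (s, [])) : Γ.transversal S :=
  ⟨⟨s, a.2.point h⟩, a.point_mem_transversal h⟩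

theorem PathSpace.pathSet_toPoint (a : Γ.PathSpace S) (h : a.1 (s, [])) :
    pathSet (a.toPoint h) = a := Subtype.ext (a.2.code_point h)

open Classical in
/-- Under the correspondence of points and path sets, the action of the groupoid of paths becomes
the partial action of words. -/
theorem act_pathSet_iff {x : (Γ.cover s).Spectrum}
    (hx : (⟨s, x⟩ : Γ.BundleSpectrum) ∈ Γ.transversal S) {w : List (E × Bool)} {r : V}
    (hr : (PathSpace.act w (pathSet ⟨⟨s, x⟩, hx⟩)).1 (r, [])) (μ : List E) :
    (PathSpace.act w (pathSet ⟨⟨s, x⟩, hx⟩)).1 (r, μ) ↔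
      Γ.cone s ((FreeGroup.mk w)⁻¹ * pos μ) ∈ x.1 := by
  induction w generalizing r μ with
  | nil =>
    obtain ⟨rfl, -⟩ := pathSet_iff.1 hr
    rw [PathSpace.act_nil, pathSet_iff]
    simp [← FreeGroup.one_eq_mk]
  | cons l w ih =>
    have h0 : PathSpace.act w (pathSet ⟨⟨s, x⟩, hx⟩) ≠ 0 := by
      intro h0
      rw [PathSpace.act_cons, h0, PathSpace.shift_zero] at hr
      exact PathSpace.not_zero_apply _ hr
    obtain ⟨r', hr'⟩ := PathSpace.exists_of_ne_zero h0
    have hwalk := PathSpace.act_walk (pathSet_nil ⟨⟨s, x⟩, hx⟩) hr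
    have hvert : ∃ p : Γ.CoverVert s, p.2.word = (FreeGroup.mk (l :: w))⁻¹ :=
      ⟨⟨r, GPath.inv (⟨FreeGroup.mk (l :: w), by
        rw [FreeGroup.toWord_mk]
        exact hwalk.red FreeGroup.reduce.red⟩ : Γ.GPath r s)⟩, rfl⟩
    specialize ih hr'
    obtain ⟨e, _ | _⟩ := l
    · obtain ⟨rfl, hb⟩ := PathSpace.shift_false.1 hr
      obtain rfl := PathSpace.origin_unique _ hb hr'
      have h1 : (FreeGroup.mk ((e, false) :: w))⁻¹ * pos μ
          = (FreeGroup.mk w)⁻¹ * pos (e :: μ) := by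
        rw [pos_cons, show (e, false) :: w = [(e, false)] ++ w from rfl, ← FreeGroup.mul_mk,
          mul_inv_rev, mul_assoc]
        rfl
      rw [PathSpace.act_cons, PathSpace.shift_false, h1, ih]
      simp
    · obtain ⟨rfl, hb⟩ := PathSpace.shift_true_nil.1 hr
      obtain rfl := PathSpace.origin_unique _ hb hr'
      have h1 : (FreeGroup.mk ((e, true) :: w))⁻¹ = (FreeGroup.mk w)⁻¹ * (FreeGroup.of e)⁻¹ := by
        rw [show (e, true) :: w = [(e, true)] ++ w from rfl, ← FreeGroup.mul_mk, mul_inv_rev]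
        rfl
      have h2 : Γ.cone s (FreeGroup.mk w)⁻¹ ∈ x.1 := by simpa using (ih []).1 hr'
      rw [PathSpace.act_cons]
      rcases μ with _ | ⟨f, μ⟩
      · refine iff_of_true hr ?_
        obtain ⟨p, hp⟩ := hvert
        rw [pos_nil, mul_one, ← hp]
        refine x.2.prop.mem_of_superset _ h2 _ (cone_mem_ring p) ?_
        have := cone_anti (Γ := Γ) (s := s) p.2.word [e]
        rwa [hp, h1, pos_singleton, inv_mul_cancel_right, ← h1, ← hp] at this
      · rw [PathSpace.shift_true_cons]
        by_cases hfe : f = e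
        · subst hfe
          rw [ih, h1, pos_cons, mul_assoc, inv_mul_cancel_left]
          simp
        · refine iff_of_false (fun h => hfe h.2.1) fun hmem => ?_
          obtain ⟨z, hz, hz'⟩ := x.2.prop.nonempty_of_mem (x.2.prop.inter_mem _ h2 _ hmem)
          obtain ⟨c, hc⟩ := mem_cone.1 hz
          obtain ⟨d, hd⟩ := mem_cone.1 hz'
          have : pos (f :: μ ++ d) = pos (e :: c) := by
            rw [pos_append, pos_cons e]
            have h3 : pos c = FreeGroup.mk w * z.2.word := by rw [hc]; group
            rw [h3, hd, h1]
            group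
          exact hfe (by simpa using congrArg List.head? (pos_injective this))

namespace ToeplitzGroupoid

/-- The word of an element of the groupoid. -/
abbrev word (γ : Γ.ToeplitzGroupoid S) : FreeGroup E := γ.α.word

open Classical in
/-- The path `α` of an element `(α, x)` of the groupoid has the form `a b⁻¹` with directed words `a` and
`b`, where the directed path `x` starts with `b`: the sets `V(s)` and `V(α⁻¹)` both belong to `x`, hence
so does their intersection. -/
theorem act_source_ne_zero (γ : Γ.ToeplitzGroupoid S) :
    (PathSpace.act γ.word.toWord (pathSet γ.source)).1 (γ.r, []) := by
  obtain ⟨r, s, α, x, hx, hy⟩ := γ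
  have h1 := (mem_transversal_iff.1 hx).1
  have h2 := (act_mem_transversal_iff α hx).1 hy
  have h3 := x.2.prop.inter_mem _ h2 _ h1
  obtain ⟨z, hz, hz'⟩ := x.2.prop.nonempty_of_mem h3
  obtain ⟨a, b, hab, heq, -, hinter⟩ := exists_cylWord_inter hz hz'
  have hcone : Γ.cone s (pos b) ∈ x.1 := by
    change Γ.cone s α.word⁻¹ ∩ Γ.cone s 1 = _ at hinter
    rw [hinter, heq, one_mul] at h3
    simpa [cone] using h3
  rw [one_mul] at heq
  obtain ⟨q, hq, hqw⟩ := x.exists_vert_of_cone_mem hcone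
  have hα : α.word = pos a * (pos b)⁻¹ := by
    rw [← heq]
    group
  have hwa : Γ.DWalk r a q.1 :=
    dWalk_of_word_eq (p := (⟨r, α.inv⟩ : Γ.CoverVert s)) (q := q) (by rw [hq, ← heq]; rfl)
  change (PathSpace.act α.word.toWord _).1 (r, [])
  rw [hα, hab.toWord, PathSpace.act_append]
  refine PathSpace.act_map_true hwa (PathSpace.act_negWord hqw ?_)
  rw [List.append_nil]
  exact pathSet_iff.2 ⟨rfl, hcone⟩

open Classical in
theorem pathSet_range (γ : Γ.ToeplitzGroupoid S) :
    pathSet γ.range = PathSpace.act γ.word.toWord (pathSet γ.source) := by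
  have h0 := γ.act_source_ne_zero
  refine PathSpace.ext_iff' fun u μ => ?_
  have hur : (PathSpace.act γ.word.toWord (pathSet γ.source)).1 (u, μ) → u = γ.r := fun h =>
    PathSpace.origin_unique _ h h0
  have key := act_pathSet_iff γ.source_mem h0 μ
  rw [FreeGroup.mk_toWord, ← cone_mem_act_iff] at key
  constructor
  · intro h
    obtain ⟨rfl, h'⟩ := pathSet_iff.1 h
    exact key.2 h'
  · intro h
    obtain rfl := hur h
    exact pathSet_iff.2 ⟨rfl, key.1 h⟩

theorem ext_of_word {γ γ' : Γ.ToeplitzGroupoid S} (hw : γ.word = γ'.word)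
    (hs : γ.source = γ'.source) : γ = γ' := by
  obtain ⟨r, s, α, x, hx, hy⟩ := γ
  obtain ⟨r', s', α', x', hx', hy'⟩ := γ'
  have h := congrArg Subtype.val hs
  change (⟨s, x⟩ : Γ.BundleSpectrum) = ⟨s', x'⟩ at h
  cases h
  have hα := α.isWalk
  rw [show α.word = α'.word from hw] at hα
  obtain rfl := hα.left_unique α'.isWalk
  obtain rfl : α = α' := GPath.ext hw
  rfl

open Classical in
/-- The element `(α, x)` of the groupoid, for the point `x` given by a path set. -/
def ofPathSet (α : Γ.GPath r s) (a : Γ.PathSpace S) (hs : a.1 (s, []))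
    (hr : (PathSpace.act α.word.toWord a).1 (r, [])) : Γ.ToeplitzGroupoid S where
  r := r
  s := s
  α := α
  x := a.2.point hs
  source_mem := a.point_mem_transversal hs
  range_mem := by
    refine (act_mem_transversal_iff α (a.point_mem_transversal hs)).2 ?_
    have ha := a.pathSet_toPoint hs
    rw [← ha] at hr
    have := (act_pathSet_iff (a.point_mem_transversal hs) hr []).1 hr
    simpa [FreeGroup.mk_toWord] using this

open Classical in
theorem pathSet_ofPathSet (α : Γ.GPath r s) (a : Γ.PathSpace S) (hs : a.1 (s, []))
    (hr : (PathSpace.act α.word.toWord a).1 (r, [])) :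
    pathSet (ofPathSet α a hs hr).source = a := a.pathSet_toPoint hs

open Classical in
theorem exists_of_act_ne_zero {g : FreeGroup E} {a : Γ.PathSpace S}
    (h : PathSpace.act g.toWord a ≠ 0) :
    ∃ γ : Γ.ToeplitzGroupoid S, γ.word = g ∧ pathSet γ.source = a := by
  have ha : a ≠ 0 := by
    rintro rfl
    exact h (PathSpace.act_zero _)
  obtain ⟨s, hs⟩ := PathSpace.exists_of_ne_zero ha
  obtain ⟨r, hr⟩ := PathSpace.exists_of_ne_zero h
  have hw := PathSpace.act_walk hs hr
  exact ⟨ofPathSet ⟨g, hw⟩ a hs hr, rfl, pathSet_ofPathSet _ a hs hr⟩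

end ToeplitzGroupoid

/-! ### Topology of the groupoid -/

/-- The coordinates are clopen: for an ultrafilter not containing `V(μ)`, this is witnessed by an
element disjoint from `V(μ)`, hence is an open condition. -/
theorem continuous_pathSet : Continuous (pathSet : Γ.transversal S → Γ.PathSpace S) := by
  refine PathSpace.continuous_of_coord ?_
  rintro ⟨u, μ⟩
  have hopen : ∀ (t : V) (B : Set (Γ.CoverVert t)), B ∈ (Γ.cover t).ring →
      IsOpen {x : (Γ.cover t).Spectrum | B ∈ x.1} := fun t B hB =>
    TopologicalSpace.isOpen_generateFrom_of_mem ⟨B, hB, rfl⟩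
  have h1 : ∀ t, IsOpen {x : (Γ.cover t).Spectrum | Γ.cone t (pos μ) ∈ x.1} := by
    intro t
    rcases cone_eq_empty_or_exists_vert (Γ.base t) μ with h | ⟨p, hp, -⟩
    · rw [base_word, one_mul] at h
      rw [h]
      convert isOpen_empty
      ext x
      simpa using x.2.prop.empty_notMem
    · rw [base_word, one_mul] at hp
      exact hopen t _ (hp ▸ cone_mem_ring p)
  have h2 : ∀ t, IsOpen {x : (Γ.cover t).Spectrum | Γ.cone t (pos μ) ∉ x.1} := by
    intro t
    have : {x : (Γ.cover t).Spectrum | Γ.cone t (pos μ) ∉ x.1} =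
        ⋃ C ∈ {C ∈ (Γ.cover t).ring | Γ.cone t (pos μ) ∩ C = ∅}, {x | C ∈ x.1} := by
      ext x
      simp only [Set.mem_ofPred_eq, Set.mem_iUnion, exists_prop]
      constructor
      · intro h
        obtain ⟨C, hC, hd⟩ := x.exists_disjoint_cone (Γ.base t) μ (by simpa [base_word] using h)
        exact ⟨C, ⟨x.2.prop.subset hC, by simpa [base_word] using hd⟩, hC⟩
      · rintro ⟨C, ⟨-, hd⟩, hC⟩ h
        exact x.2.prop.empty_notMem (hd ▸ x.2.prop.inter_mem _ h C hC)
    rw [this]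
    exact isOpen_biUnion fun C hC => hopen t C hC.1
  have key : ∀ Q : ∀ t, Set (Γ.cover t).Spectrum, (∀ t, IsOpen (Q t)) →
      IsOpen {ξ : Γ.transversal S | ξ.1.2 ∈ Q ξ.1.1} := fun Q hQ =>
    IsOpen.preimage continuous_subtype_val
      ((isOpen_sigma_iff (s := {x : Γ.BundleSpectrum | x.2 ∈ Q x.1})).2 fun t => hQ t)
  have heq : {ξ : Γ.transversal S | (pathSet ξ).1 (u, μ)} =
      {ξ | u = ξ.1.1 ∧ Γ.cone ξ.1.1 (pos μ) ∈ ξ.1.2.1} := by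
    ext ⟨⟨t, x⟩, hx⟩
    exact pathSet_iff
  rw [heq]
  constructor
  · rw [← isOpen_compl_iff]
    refine key (fun t => {x | ¬ (u = t ∧ Γ.cone t (pos μ) ∈ x.1)}) fun t => ?_
    by_cases hut : u = t
    · simpa [hut] using h2 t
    · simp [hut]
  · refine key (fun t => {x | u = t ∧ Γ.cone t (pos μ) ∈ x.1}) fun t => ?_
    by_cases hut : u = t
    · simpa [hut] using h1 t
    · simp [hut]

theorem PathSpace.continuous_toPoint (s : V) :
    Continuous fun a : {a : Γ.PathSpace S // a.1 (s, [])} => a.1.toPoint a.2 := by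
  refine Continuous.subtype_mk (f := fun a : {a : Γ.PathSpace S // a.1 (s, [])} =>
    (⟨s, a.1.2.point a.2⟩ : Γ.BundleSpectrum)) ?_ _
  refine continuous_sigmaMk.comp (continuous_generateFrom_iff.2 ?_)
  rintro _ ⟨B, hB, rfl⟩
  have : (fun a : {a : Γ.PathSpace S // a.1 (s, [])} => a.1.2.point a.2) ⁻¹' Spectrum.supp B =
      Subtype.val ⁻¹' (⋃ μ, ⋃ F ∈ {F : Set E | F.Finite ∧ Γ.cylWord s (pos μ) F ⊆ B},
        {a : Γ.PathSpace S | a.1 (s, μ)} ∩ ⋂ e ∈ F, {a | a.1 (s, μ ++ [e])}ᶜ) := by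
    ext ⟨a, ha⟩
    simp only [Set.mem_preimage, Set.mem_iUnion, Set.mem_inter_iff, Set.mem_iInter,
      Set.mem_compl_iff, Set.mem_ofPred_eq, exists_prop]
    constructor
    · rintro ⟨-, μ, F, h1, h2, h3, h4⟩
      exact ⟨μ, F, ⟨h2, h4⟩, h1, h3⟩
    · rintro ⟨μ, F, ⟨h2, h4⟩, h1, h3⟩
      exact ⟨hB, μ, F, h1, h2, h3, h4⟩
  rw [this]
  refine IsOpen.preimage continuous_subtype_val ?_
  refine isOpen_iUnion fun μ => isOpen_biUnion fun F hF => ?_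
  exact (isClopen_coord _).isOpen.inter
    (hF.1.isOpen_biInter fun e _ => (isClopen_coord _).compl.isOpen)

namespace ToeplitzGroupoid

theorem continuous_source : Continuous (source : Γ.ToeplitzGroupoid S → Γ.transversal S) :=
  continuous_iff_le_induced.2 inf_le_right

theorem isOpen_preimage_path (P : Set (Σ r s : V, Γ.GPath r s)) :
    IsOpen {γ : Γ.ToeplitzGroupoid S | γ.path ∈ P} := by
  let : TopologicalSpace (Σ r s : V, Γ.GPath r s) := ⊥
  have hc : Continuous (path : Γ.ToeplitzGroupoid S → Σ r s : V, Γ.GPath r s) :=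
    continuous_iff_le_induced.2 inf_le_left
  have : DiscreteTopology (Σ r s : V, Γ.GPath r s) := ⟨rfl⟩
  exact (isOpen_discrete P).preimage hc

theorem isClopen_preimage_path (P : Set (Σ r s : V, Γ.GPath r s)) :
    IsClopen {γ : Γ.ToeplitzGroupoid S | γ.path ∈ P} :=
  ⟨⟨isOpen_preimage_path Pᶜ⟩, isOpen_preimage_path P⟩

open Classical in
variable (S) in
/-- The path sets of the points on which the path `α` acts. -/
def pathDomain (α : Γ.GPath r s) : Set (Γ.PathSpace S) :=
  {a | a.1 (s, []) ∧ (PathSpace.act α.word.toWord a).1 (r, [])}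

theorem isClopen_pathDomain (α : Γ.GPath r s) : IsClopen (pathDomain S α) :=
  (PathSpace.isClopen_coord (s, [])).inter
    ((PathSpace.isClopen_coord (r, [])).preimage
      (PathSpace.continuous_act (Γ := Γ) (S := S) _))

theorem continuous_ofPathSet (α : Γ.GPath r s) :
    Continuous fun a : pathDomain S α => ofPathSet α a.1 a.2.1 a.2.2 := by
  refine continuous_inf_rng.2 ⟨continuous_induced_rng.2 ?_, continuous_induced_rng.2 ?_⟩
  · exact @continuous_const _ _ _ ⊥ (⟨r, s, α⟩ : Σ r s : V, Γ.GPath r s)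
  · exact (PathSpace.continuous_toPoint s).comp
      (continuous_subtype_val.subtype_mk fun a : pathDomain S α => a.2.1)

theorem path_eq_iff {γ : Γ.ToeplitzGroupoid S} {α : Γ.GPath r s} :
    γ.path = ⟨r, s, α⟩ ↔ γ.s = s ∧ γ.word = α.word := by
  obtain ⟨r', s', α', x, hx, hy⟩ := γ
  constructor
  · intro h
    cases h
    exact ⟨rfl, rfl⟩
  · rintro ⟨rfl, hw⟩
    have hα := α'.isWalk
    rw [show α'.word = α.word from hw] at hα
    obtain rfl := hα.left_unique α.isWalk
    obtain rfl : α' = α := GPath.ext hw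
    rfl

theorem pathSet_source_mem (γ : Γ.ToeplitzGroupoid S) :
    pathSet γ.source ∈ pathDomain S γ.α :=
  ⟨pathSet_nil γ.source, γ.act_source_ne_zero⟩

theorem ofPathSet_source (γ : Γ.ToeplitzGroupoid S) :
    ofPathSet γ.α (pathSet γ.source) γ.pathSet_source_mem.1 γ.pathSet_source_mem.2 = γ :=
  ext_of_word rfl (pathSet_injective (pathSet_ofPathSet _ _ _ _))

/-- The elements `(α, x)` with given `α` form a compact set, parametrized by a clopen subset of the path
space. -/
theorem isCompact_path_eq [CompactSpace (Γ.PathSpace S)] (σ : Σ r s : V, Γ.GPath r s) :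
    IsCompact {γ : Γ.ToeplitzGroupoid S | γ.path = σ} := by
  obtain ⟨r, s, α⟩ := σ
  have : CompactSpace (pathDomain S α) :=
    isCompact_iff_compactSpace.1 (isClopen_pathDomain α).isClosed.isCompact
  have : {γ : Γ.ToeplitzGroupoid S | γ.path = ⟨r, s, α⟩} =
      Set.range fun a : pathDomain S α => ofPathSet α a.1 a.2.1 a.2.2 := by
    ext γ
    constructor
    · intro h
      obtain ⟨r', s', α', x, hx, hy⟩ := γ
      cases h
      let γ : Γ.ToeplitzGroupoid S := ⟨r', s', α', x, hx, hy⟩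
      exact ⟨⟨pathSet γ.source, γ.pathSet_source_mem⟩, γ.ofPathSet_source⟩
    · rintro ⟨a, rfl⟩
      rfl
  rw [this]
  exact isCompact_range (continuous_ofPathSet α)

theorem isCompact_preimage_path [CompactSpace (Γ.PathSpace S)]
    {P : Set (Σ r s : V, Γ.GPath r s)} (hP : P.Finite) :
    IsCompact {γ : Γ.ToeplitzGroupoid S | γ.path ∈ P} := by
  have : {γ : Γ.ToeplitzGroupoid S | γ.path ∈ P} = ⋃ σ ∈ P, {γ | γ.path = σ} := by
    ext γ
    simp
  rw [this]
  exact hP.isCompact_biUnion fun σ _ => isCompact_path_eq σ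

/-- A compact subset involves only finitely many paths, because the groupoid of paths is discrete. -/
theorem finite_path_of_compact {K : Set (Γ.ToeplitzGroupoid S)} (hK : IsCompact K) :
    (path '' K).Finite := by
  let : TopologicalSpace (Σ r s : V, Γ.GPath r s) := ⊥
  have hc : Continuous (path : Γ.ToeplitzGroupoid S → Σ r s : V, Γ.GPath r s) :=
    continuous_iff_le_induced.2 inf_le_left
  have : DiscreteTopology (Σ r s : V, Γ.GPath r s) := ⟨rfl⟩
  exact isCompact_iff_finite.1 (hK.image hc)

end ToeplitzGroupoid

end Bridge

/-! ### Functions on the groupoid as families of functions on the path space -/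

section Hat

universe u v
variable {V : Type u} {E : Type v} {Γ : DirectedGraph V E} {S : Set V} {r s : V}

namespace PathSpace

open Classical in
/-- The partial action of the free group on the path space; zero stands for undefined values. -/
def gact (g : FreeGroup E) (a : Γ.PathSpace S) : Γ.PathSpace S := act g.toWord a

theorem gact_zero (g : FreeGroup E) : gact g (0 : Γ.PathSpace S) = 0 := act_zero _

theorem ne_zero_of_gact {g : FreeGroup E} {a : Γ.PathSpace S} (h : gact g a ≠ 0) : a ≠ 0 := by
  rintro rfl
  exact h (gact_zero g)

@[simp] theorem gact_one (a : Γ.PathSpace S) : gact 1 a = a := by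
  simp [gact]

theorem gact_of (e : E) (a : Γ.PathSpace S) : gact (FreeGroup.of e) a = shift (e, true) a := by
  simp [gact]

theorem gact_of_inv (e : E) (a : Γ.PathSpace S) :
    gact (FreeGroup.of e)⁻¹ a = shift (e, false) a := by
  simp [gact, FreeGroup.toWord_inv, FreeGroup.invRev]

theorem gact_mul {g k : FreeGroup E} {a : Γ.PathSpace S} (h : gact g (gact k a) ≠ 0) :
    gact (g * k) a = gact g (gact k a) := by
  classical
  have hact : act (g.toWord ++ k.toWord) a = gact g (gact k a) := by
    rw [act_append]
    rfl
  rw [← hact] at h ⊢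
  rw [← act_red FreeGroup.reduce.red h, ← FreeGroup.toWord_mul]
  rfl

theorem gact_inv_gact {g : FreeGroup E} {a : Γ.PathSpace S} (h : gact g a ≠ 0) :
    gact g⁻¹ (gact g a) = a := by
  classical
  simp only [gact] at h ⊢
  rw [FreeGroup.toWord_inv]
  exact act_invRev_act h

theorem continuous_gact (g : FreeGroup E) :
    Continuous (gact g : Γ.PathSpace S → Γ.PathSpace S) := continuous_act _

end PathSpace

open PathSpace

namespace ToeplitzGroupoid

theorem pathSet_range_eq_gact (γ : Γ.ToeplitzGroupoid S) :
    pathSet γ.range = gact γ.word (pathSet γ.source) := γ.pathSet_range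

theorem gact_ne_zero (γ : Γ.ToeplitzGroupoid S) : gact γ.word (pathSet γ.source) ≠ 0 :=
  ne_zero_of_apply γ.act_source_ne_zero

theorem exists_of_gact_ne_zero {g : FreeGroup E} {a : Γ.PathSpace S} (h : gact g a ≠ 0) :
    ∃ γ : Γ.ToeplitzGroupoid S, γ.word = g ∧ pathSet γ.source = a := exists_of_act_ne_zero h

theorem ext_of_pathSet {γ γ' : Γ.ToeplitzGroupoid S} (hw : γ.word = γ'.word)
    (hs : pathSet γ.source = pathSet γ'.source) : γ = γ' :=
  ext_of_word hw (pathSet_injective hs)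

open Classical in
/-- The function `f(g, ·)` on the path space, extended by zero, for a function `f` on the
groupoid. -/
def hat (f : Γ.ToeplitzGroupoid S → ℂ) (g : FreeGroup E) (a : Γ.PathSpace S) : ℂ :=
  if h : ∃ γ : Γ.ToeplitzGroupoid S, γ.word = g ∧ pathSet γ.source = a then f h.choose else 0

theorem hat_apply (f : Γ.ToeplitzGroupoid S → ℂ) (γ : Γ.ToeplitzGroupoid S) :
    hat f γ.word (pathSet γ.source) = f γ := by
  have h : ∃ γ' : Γ.ToeplitzGroupoid S, γ'.word = γ.word ∧ pathSet γ'.source = pathSet γ.source :=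
    ⟨γ, rfl, rfl⟩
  rw [hat, dif_pos h]
  exact congrArg f (ext_of_pathSet h.choose_spec.1 h.choose_spec.2)

theorem hat_of_eq (f : Γ.ToeplitzGroupoid S → ℂ) {γ : Γ.ToeplitzGroupoid S} {g : FreeGroup E}
    {a : Γ.PathSpace S} (hg : γ.word = g) (ha : pathSet γ.source = a) : hat f g a = f γ := by
  subst hg ha
  exact hat_apply f γ

theorem hat_eq_zero (f : Γ.ToeplitzGroupoid S → ℂ) {g : FreeGroup E} {a : Γ.PathSpace S}
    (h : gact g a = 0) : hat f g a = 0 := by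
  rw [hat, dif_neg]
  rintro ⟨γ, rfl, rfl⟩
  exact γ.gact_ne_zero h

theorem gact_ne_zero_of_hat {f : Γ.ToeplitzGroupoid S → ℂ} {g : FreeGroup E} {a : Γ.PathSpace S}
    (h : hat f g a ≠ 0) : gact g a ≠ 0 := fun h0 => h (hat_eq_zero f h0)

theorem exists_of_hat {f : Γ.ToeplitzGroupoid S → ℂ} {g : FreeGroup E} {a : Γ.PathSpace S}
    (h : hat f g a ≠ 0) : ∃ γ : Γ.ToeplitzGroupoid S, γ.word = g ∧ pathSet γ.source = a ∧
      f γ = hat f g a := by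
  obtain ⟨γ, h1, h2⟩ := exists_of_gact_ne_zero (gact_ne_zero_of_hat h)
  exact ⟨γ, h1, h2, (hat_of_eq f h1 h2).symm⟩

/-- To identify the functions `f(g, ·)` it suffices to consider the domain of `g`. -/
theorem hat_eq_of {f : Γ.ToeplitzGroupoid S → ℂ} {F : FreeGroup E → Γ.PathSpace S → ℂ}
    (h : ∀ γ, f γ = F γ.word (pathSet γ.source)) (h0 : ∀ g a, gact g a = 0 → F g a = 0)
    (g : FreeGroup E) (a : Γ.PathSpace S) : hat f g a = F g a := by
  by_cases ha : gact g a = 0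
  · rw [hat_eq_zero f ha, h0 g a ha]
  · obtain ⟨γ, rfl, rfl⟩ := exists_of_gact_ne_zero ha
    rw [hat_apply, h]

theorem hat_add (f f' : Γ.ToeplitzGroupoid S → ℂ) (g : FreeGroup E) (a : Γ.PathSpace S) :
    hat (f + f') g a = hat f g a + hat f' g a :=
  hat_eq_of (F := fun g a => hat f g a + hat f' g a) (fun γ => by simp [hat_apply])
    (fun g a h => by simp [hat_eq_zero _ h]) g a

theorem hat_smul (c : ℂ) (f : Γ.ToeplitzGroupoid S → ℂ) (g : FreeGroup E) (a : Γ.PathSpace S) :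
    hat (c • f) g a = c * hat f g a :=
  hat_eq_of (F := fun g a => c * hat f g a) (fun γ => by simp [hat_apply])
    (fun g a h => by simp [hat_eq_zero _ h]) g a

theorem hat_invol (f : Γ.ToeplitzGroupoid S → ℂ) (g : FreeGroup E) (a : Γ.PathSpace S) :
    hat (invol f) g a = star (hat f g⁻¹ (gact g a)) := by
  refine hat_eq_of (F := fun g a => star (hat f g⁻¹ (gact g a))) (fun γ => ?_) (fun g a h => ?_) g a
  · exact congrArg star (hat_of_eq f (γ := γ.inv) rfl γ.pathSet_range_eq_gact).symm
  · simp [h, hat_eq_zero f (gact_zero g⁻¹)]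

theorem finsum_comp_injective {α β M : Type*} [AddCommMonoid M] (φ : α → β)
    (hφ : Function.Injective φ) (F : β → M) (h : ∀ b, F b ≠ 0 → b ∈ Set.range φ) :
    ∑ᶠ a, F (φ a) = ∑ᶠ b, F b := by
  rw [← finsum_mem_range hφ, ← finsum_mem_univ F]
  exact finsum_mem_inter_support_eq' _ _ _ fun b hb => iff_of_true (h b hb) trivial

theorem SameSource.word_injective (γ : Γ.ToeplitzGroupoid S) :
    Function.Injective fun η : SameSource γ => η.β.word := by
  rintro ⟨r, β, h⟩ ⟨r', β', h'⟩ hw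
  have hβ := β.isWalk
  rw [show β.word = β'.word from hw] at hβ
  obtain rfl := hβ.left_unique β'.isWalk
  obtain rfl : β = β' := GPath.ext hw
  rfl

/-- The sum over the groupoid elements with the source of a given one becomes a sum over the words,
as an element is determined by its word and its source. -/
theorem hat_conv (f f' : Γ.ToeplitzGroupoid S → ℂ) (g : FreeGroup E) (a : Γ.PathSpace S) :
    hat (conv f f') g a = ∑ᶠ k, hat f (g * k⁻¹) (gact k a) * hat f' k a := by
  refine hat_eq_of
    (F := fun g a => ∑ᶠ k, hat f (g * k⁻¹) (gact k a) * hat f' k a) (fun γ => ?_) ?_ g a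
  · rw [conv, ← finsum_comp_injective _ (SameSource.word_injective γ)]
    · refine finsum_congr fun η => ?_
      exact (congrArg₂ (· * ·) (hat_of_eq f (γ := η.left) rfl η.right.pathSet_range_eq_gact)
        (hat_of_eq f' (γ := η.right) rfl rfl)).symm
    · intro k hk
      obtain ⟨η, rfl, hη, -⟩ := exists_of_hat (right_ne_zero_of_mul hk)
      have hs := pathSet_injective hη
      obtain ⟨r, s, α, x, hx, hy⟩ := γ
      obtain ⟨r', s', β, x', hx', hy'⟩ := η
      have h : (⟨s', x'⟩ : Γ.BundleSpectrum) = ⟨s, x⟩ := congrArg Subtype.val hs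
      cases h
      exact ⟨⟨r', β, hy'⟩, rfl⟩
  · intro g a h
    refine finsum_eq_zero_of_forall_eq_zero fun k => ?_
    by_contra hne
    have h1 := gact_ne_zero_of_hat (left_ne_zero_of_mul hne)
    rw [← gact_mul h1, inv_mul_cancel_right] at h1
    exact h1 h

/-! ### Continuous functions of compact support -/

theorem finite_path_support (f : C_c(Γ.ToeplitzGroupoid S, ℂ)) :
    (path '' Function.support f).Finite :=
  (finite_path_of_compact f.hasCompactSupport).subset (Set.image_mono (subset_tsupport f))

theorem finite_hat_support (f : C_c(Γ.ToeplitzGroupoid S, ℂ)) :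
    {g | hat f g ≠ 0}.Finite := by
  refine ((finite_path_support f).image fun σ => σ.2.2.word).subset ?_
  intro g hg
  obtain ⟨a, ha⟩ := Function.ne_iff.1 hg
  obtain ⟨γ, rfl, rfl, h⟩ := exists_of_hat ha
  exact ⟨γ.path, ⟨γ, by rw [Function.mem_support, h]; exact ha, rfl⟩, rfl⟩

/-- At a point outside the domain of `g` the function vanishes nearby, since it is supported on a finite
union of clopen domains. -/
theorem continuous_hat (f : C_c(Γ.ToeplitzGroupoid S, ℂ)) (g : FreeGroup E) :
    Continuous (hat f g : Γ.PathSpace S → ℂ) := by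
  let P := {σ ∈ path '' Function.support f | σ.2.2.word = g}
  let C : Set (Γ.PathSpace S) := ⋃ σ ∈ P, pathDomain S σ.2.2
  have hC : IsClosed C := ((finite_path_support f).subset (Set.sep_subset _ _)).isClosed_biUnion
    fun σ _ => (isClopen_pathDomain σ.2.2).isClosed
  rw [continuous_iff_continuousAt]
  intro a
  by_cases ha : gact g a ≠ 0
  · obtain ⟨γ, rfl, rfl⟩ := exists_of_gact_ne_zero ha
    have hmem := (isClopen_pathDomain (S := S) γ.α).isOpen.mem_nhds γ.pathSet_source_mem
    refine ContinuousOn.continuousAt ?_ hmem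
    rw [continuousOn_iff_continuous_domRestrict]
    refine (f.continuous.comp (continuous_ofPathSet γ.α)).congr fun a => ?_
    exact (hat_of_eq f rfl (pathSet_ofPathSet γ.α a.1 a.2.1 a.2.2)).symm
  · have haC : a ∈ Cᶜ := by
      intro haC
      obtain ⟨σ, ⟨-, rfl⟩, hσ⟩ := Set.mem_iUnion₂.1 haC
      exact ha (ne_zero_of_apply hσ.2)
    have hzero : ∀ b ∈ Cᶜ, hat f g b = 0 := by
      intro b hbC
      by_contra hb
      obtain ⟨γ, rfl, rfl, h⟩ := exists_of_hat hb
      exact hbC (Set.mem_biUnion ⟨⟨γ, by rw [Function.mem_support, h]; exact hb, rfl⟩, rfl⟩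
        γ.pathSet_source_mem)
    refine (continuousAt_const (y := (0 : ℂ))).congr ?_
    filter_upwards [hC.isOpen_compl.mem_nhds haC] with b hb
    exact (hzero b hb).symm

/-- The function `f(g, ·)` as an element of the algebra of continuous functions on the path
space. -/
def hatC (f : C_c(Γ.ToeplitzGroupoid S, ℂ)) (g : FreeGroup E) : C(Γ.PathSpace S, ℂ) :=
  ⟨hat f g, continuous_hat f g⟩

@[simp] theorem hatC_apply (f : C_c(Γ.ToeplitzGroupoid S, ℂ)) (g : FreeGroup E)
    (a : Γ.PathSpace S) : hatC f g a = hat f g a := rfl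

theorem finite_hatC_support (f : C_c(Γ.ToeplitzGroupoid S, ℂ)) :
    (Function.support (hatC f)).Finite := by
  refine (finite_hat_support f).subset fun g hg h0 => hg ?_
  ext a
  exact congrFun h0 a

theorem hatC_add (f f' : C_c(Γ.ToeplitzGroupoid S, ℂ)) : hatC (f + f') = hatC f + hatC f' := by
  ext g a
  exact hat_add f f' g a

theorem hatC_smul (c : ℂ) (f : C_c(Γ.ToeplitzGroupoid S, ℂ)) : hatC (c • f) = c • hatC f := by
  ext g a
  exact hat_smul c f g a

theorem ext_hat {f f' : Γ.ToeplitzGroupoid S → ℂ} (h : ∀ g a, hat f g a = hat f' g a) :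
    f = f' := by
  funext γ
  rw [← hat_apply f, ← hat_apply f', h]

/-- A function that is supported on finitely many paths is an element of `C_c` if it is given by
continuous functions on the path space. -/
def mkCc [CompactSpace (Γ.PathSpace S)] (φ : Γ.ToeplitzGroupoid S → ℂ)
    (F : FreeGroup E → Γ.PathSpace S → ℂ) (hF : ∀ g, Continuous (F g))
    (h : ∀ γ, φ γ = F γ.word (pathSet γ.source))
    (hfin : (path '' Function.support φ).Finite) : C_c(Γ.ToeplitzGroupoid S, ℂ) where
  toFun := φ
  continuous_toFun := by
    rw [continuous_iff_continuousAt]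
    intro γ
    have h1 : Continuous fun γ' : Γ.ToeplitzGroupoid S => F γ.word (pathSet γ'.source) :=
      (hF _).comp (continuous_pathSet.comp continuous_source)
    refine h1.continuousAt.congr ?_
    filter_upwards [(isOpen_preimage_path {γ.path}).mem_nhds rfl] with γ' hγ'
    rw [h, (path_eq_iff.1 hγ').2]
  hasCompactSupport' := by
    refine HasCompactSupport.intro' (isCompact_preimage_path hfin)
      (isClopen_preimage_path _).isClosed fun γ hγ => ?_
    by_contra hne
    exact hγ ⟨γ, hne, rfl⟩

/-- The convolution product of two continuous functions of compact support. -/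
def convC [CompactSpace (Γ.PathSpace S)] (f f' : C_c(Γ.ToeplitzGroupoid S, ℂ)) :
    C_c(Γ.ToeplitzGroupoid S, ℂ) :=
  mkCc (conv f f') (fun g a => ∑ᶠ k, hat f (g * k⁻¹) (gact k a) * hat f' k a)
    (fun g => by
      have hsub : ∀ a : Γ.PathSpace S,
          (Function.support fun k => hat f (g * k⁻¹) (gact k a) * hat f' k a) ⊆
            (finite_hat_support f').toFinset := by
        intro a k hk
        rw [Set.Finite.coe_toFinset]
        exact fun h0 => right_ne_zero_of_mul hk (congrFun h0 a)
      simp_rw [fun a => finsum_eq_sum_of_support_subset _ (hsub a)]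
      exact continuous_finsetSum _ fun k _ =>
        ((continuous_hat f _).comp (continuous_gact k)).mul (continuous_hat f' k))
    (fun γ => by rw [← hat_conv, hat_apply])
    (by
      classical
      -- The support of the convolution involves only products of paths of the two supports.
      refine (((finite_path_support f).prod (finite_path_support f')).image
        fun p => if h : p.1.2.1 = p.2.1 then (⟨p.1.1, p.2.2.1, p.1.2.2.mul (cast (by rw [h]) p.2.2.2)⟩ :
          Σ r s : V, Γ.GPath r s) else p.1).subset ?_
      rintro _ ⟨γ, hγ, rfl⟩
      obtain ⟨η, hη⟩ : ∃ η : SameSource γ, f η.left * f' η.right ≠ 0 := by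
        by_contra! h0
        exact hγ (finsum_eq_zero_of_forall_eq_zero h0)
      refine ⟨(η.left.path, η.right.path), ⟨⟨_, left_ne_zero_of_mul hη, rfl⟩,
        ⟨_, right_ne_zero_of_mul hη, rfl⟩⟩, ?_⟩
      refine (dif_pos rfl).trans ?_
      change (⟨γ.r, γ.s, (γ.α.mul η.β.inv).mul η.β⟩ : Σ r s : V, Γ.GPath r s) = _
      rw [mul_inv_mul]
      rfl)

@[simp] theorem coe_convC [CompactSpace (Γ.PathSpace S)] (f f' : C_c(Γ.ToeplitzGroupoid S, ℂ)) :
    (convC f f' : Γ.ToeplitzGroupoid S → ℂ) = conv f f' := rfl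

/-- The involution of a continuous function of compact support. -/
def involC [CompactSpace (Γ.PathSpace S)] (f : C_c(Γ.ToeplitzGroupoid S, ℂ)) :
    C_c(Γ.ToeplitzGroupoid S, ℂ) :=
  mkCc (invol f) (fun g a => star (hat f g⁻¹ (gact g a)))
    (fun g => ((continuous_hat f g⁻¹).comp (continuous_gact g)).star)
    (fun γ => by rw [← hat_invol, hat_apply])
    (by
      refine ((finite_path_support f).image
        fun σ => (⟨σ.2.1, σ.1, σ.2.2.inv⟩ : Σ r s : V, Γ.GPath r s)).subset ?_
      rintro _ ⟨γ, hγ, rfl⟩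
      refine ⟨γ.inv.path, ⟨_, fun h => hγ ?_, rfl⟩, ?_⟩
      · rw [invol, h, star_zero]
      · obtain ⟨r, s, α, x, hx, hy⟩ := γ
        change (⟨r, s, α.inv.inv⟩ : Σ r s : V, Γ.GPath r s) = ⟨r, s, α⟩
        rw [show α.inv.inv = α from GPath.ext (inv_inv _)])

@[simp] theorem coe_involC [CompactSpace (Γ.PathSpace S)] (f : C_c(Γ.ToeplitzGroupoid S, ℂ)) :
    (involC f : Γ.ToeplitzGroupoid S → ℂ) = invol f := rfl

open Classical in
/-- The indicator function of the path sets that contain the word `κ`. -/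
def chi (κ : V × List E) : C(Γ.PathSpace S, ℂ) :=
  ⟨fun a => if a.1 κ then 1 else 0, by
    have := (IsLocallyConstant.iff_isOpen_fiber_apply.2 fun a => ?_ :
      IsLocallyConstant fun a : Γ.PathSpace S => if a.1 κ then (1 : ℂ) else 0)
    · exact this.continuous
    · by_cases ha : a.1 κ
      · convert (isClopen_coord κ).isOpen using 1
        ext b
        by_cases hb : b.1 κ <;> simp [ha, hb]
      · convert (isClopen_coord κ).compl.isOpen using 1
        ext b
        by_cases hb : b.1 κ <;> simp [ha, hb]⟩

theorem chi_of_mem {κ : V × List E} {a : Γ.PathSpace S} (h : a.1 κ) : chi κ a = 1 := if_pos h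

theorem chi_of_notMem {κ : V × List E} {a : Γ.PathSpace S} (h : ¬ a.1 κ) : chi κ a = 0 := if_neg h

open Classical in
/-- The function on the groupoid that is supported on the elements `(α, x)` such that `α` has the
word `g` and source `s`, and is given there by the function `h` on the path space. -/
def single [CompactSpace (Γ.PathSpace S)] (g : FreeGroup E) (s : V) (h : C(Γ.PathSpace S, ℂ)) :
    C_c(Γ.ToeplitzGroupoid S, ℂ) :=
  mkCc (fun γ => if γ.word = g then chi (s, []) (pathSet γ.source) * h (pathSet γ.source) else 0)
    (fun g' a => if g' = g then chi (s, []) a * h a else 0)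
    (fun g' => by split_ifs <;> fun_prop)
    (fun γ => rfl)
    (by
      refine Set.Subsingleton.finite ?_
      have key : ∀ γ : Γ.ToeplitzGroupoid S, (if γ.word = g then
          chi (s, []) (pathSet γ.source) * h (pathSet γ.source) else 0) ≠ 0 →
          γ.word = g ∧ γ.s = s := by
        intro γ hγ
        rw [ite_ne_right_iff] at hγ
        refine ⟨hγ.1, ?_⟩
        by_contra hs
        refine hγ.2 ?_
        rw [chi_of_notMem, zero_mul]
        exact fun hmem => hs (PathSpace.origin_unique _ (pathSet_nil γ.source) hmem)
      rintro _ ⟨γ, hγ, rfl⟩ _ ⟨γ', hγ', rfl⟩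
      obtain ⟨h1, h2⟩ := key γ hγ
      obtain ⟨h1', h2'⟩ := key γ' hγ'
      exact path_eq_iff.2 ⟨h2.trans h2'.symm, h1.trans h1'.symm⟩)

open Classical in
theorem single_apply [CompactSpace (Γ.PathSpace S)] (g : FreeGroup E) (s : V)
    (h : C(Γ.PathSpace S, ℂ)) (γ : Γ.ToeplitzGroupoid S) : single g s h γ =
      if γ.word = g then chi (s, []) (pathSet γ.source) * h (pathSet γ.source) else 0 := rfl

open Classical in
theorem hat_single [CompactSpace (Γ.PathSpace S)] (g : FreeGroup E) (s : V)
    (h : C(Γ.PathSpace S, ℂ)) (g' : FreeGroup E) (a : Γ.PathSpace S) :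
    hat (single g s h) g' a = if g' = g ∧ gact g a ≠ 0 then chi (s, []) a * h a else 0 := by
  refine hat_eq_of (F := fun g' a => if g' = g ∧ gact g a ≠ 0 then chi (s, []) a * h a else 0)
    (fun γ => ?_) (fun g' a h => ?_) g' a
  · rw [single_apply]
    refine if_congr ?_ rfl rfl
    constructor
    · rintro rfl
      exact ⟨rfl, γ.gact_ne_zero⟩
    · exact fun h => h.1
  · rw [if_neg]
    rintro ⟨rfl, h'⟩
    exact h' h

/-! ### The `I`-norm -/

theorem finsum_source_eq (f : Γ.ToeplitzGroupoid S → ℂ) (ξ : Γ.transversal S) :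
    ∑ᶠ γ : {γ : Γ.ToeplitzGroupoid S // γ.source = ξ}, ‖f γ.1‖ =
      ∑ᶠ g, ‖hat f g (pathSet ξ)‖ := by
  rw [← finsum_comp_injective (fun γ : {γ : Γ.ToeplitzGroupoid S // γ.source = ξ} => γ.1.word)]
  · refine finsum_congr fun γ => ?_
    rw [hat_of_eq f (γ := γ.1) rfl (by rw [γ.2])]
  · rintro ⟨γ, hγ⟩ ⟨γ', hγ'⟩ h
    exact Subtype.ext (ext_of_word h (hγ.trans hγ'.symm))
  · intro g hg
    obtain ⟨γ, rfl, hγ, -⟩ := exists_of_hat (norm_ne_zero_iff.1 hg)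
    exact ⟨⟨γ, pathSet_injective hγ⟩, rfl⟩

theorem finsum_range_eq (f : Γ.ToeplitzGroupoid S → ℂ) (ξ : Γ.transversal S) :
    ∑ᶠ γ : {γ : Γ.ToeplitzGroupoid S // γ.range = ξ}, ‖f γ.1‖ =
      ∑ᶠ g, ‖hat (invol f) g (pathSet ξ)‖ := by
  have hback : ∀ γ : Γ.ToeplitzGroupoid S, γ.range = ξ →
      gact γ.word⁻¹ (pathSet ξ) = pathSet γ.source := by
    rintro γ rfl
    rw [pathSet_range_eq_gact, gact_inv_gact γ.gact_ne_zero]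
  rw [← finsum_comp_injective (fun γ : {γ : Γ.ToeplitzGroupoid S // γ.range = ξ} => γ.1.word⁻¹)]
  · refine finsum_congr fun γ => ?_
    rw [hat_invol, norm_star, inv_inv, hback _ γ.2, hat_apply]
  · rintro ⟨γ, hγ⟩ ⟨γ', hγ'⟩ h
    have hw : γ.word = γ'.word := inv_injective h
    exact Subtype.ext (ext_of_pathSet hw (by rw [← hback γ hγ, ← hback γ' hγ', hw]))
  · intro g hg
    rw [hat_invol, norm_star, norm_ne_zero_iff] at hg
    obtain ⟨γ, h1, h2, -⟩ := exists_of_hat hg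
    have hg0 : gact g (pathSet ξ) ≠ 0 := ne_zero_of_gact (gact_ne_zero_of_hat hg)
    refine ⟨⟨γ, pathSet_injective ?_⟩, ?_⟩
    · rw [pathSet_range_eq_gact, h1, h2, gact_inv_gact hg0]
    · simp [h1]

theorem exists_pathSet_eq {a : Γ.PathSpace S} (ha : a ≠ 0) : ∃ ξ, pathSet ξ = a := by
  obtain ⟨s, hs⟩ := exists_of_ne_zero ha
  exact ⟨a.toPoint hs, a.pathSet_toPoint hs⟩

theorem finsum_hat_le [CompactSpace (Γ.PathSpace S)] (f : C_c(Γ.ToeplitzGroupoid S, ℂ)) :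
    ∃ C, ∀ a, ∑ᶠ g, ‖hat f g a‖ ≤ C := by
  refine ⟨∑ g ∈ (finite_hat_support f).toFinset, ‖hatC f g‖, fun a => ?_⟩
  rw [finsum_eq_sum_of_support_subset (s := (finite_hat_support f).toFinset)]
  · exact Finset.sum_le_sum fun g _ => (hatC f g).norm_coe_le_norm a
  · intro g hg
    rw [Set.Finite.coe_toFinset]
    exact fun h0 => norm_ne_zero_iff.1 hg (congrFun h0 a)

theorem inorm_nonneg (f : Γ.ToeplitzGroupoid S → ℂ) : 0 ≤ inorm f :=
  le_max_of_le_left (Real.iSup_nonneg fun _ => finsum_nonneg fun _ => norm_nonneg _)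

theorem finsum_norm_hat_le_inorm [CompactSpace (Γ.PathSpace S)]
    (f : C_c(Γ.ToeplitzGroupoid S, ℂ)) (a : Γ.PathSpace S) :
    ∑ᶠ g, ‖hat f g a‖ ≤ inorm f := by
  by_cases ha : a = 0
  · rw [finsum_eq_zero_of_forall_eq_zero]
    · exact inorm_nonneg _
    · intro g
      rw [hat_eq_zero _ (by rw [ha, gact_zero]), norm_zero]
  · obtain ⟨ξ, rfl⟩ := exists_pathSet_eq ha
    rw [← finsum_source_eq]
    refine le_max_of_le_left (le_ciSup (f := fun ξ : Γ.transversal S =>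
      ∑ᶠ γ : {γ : Γ.ToeplitzGroupoid S // γ.source = ξ}, ‖f γ.1‖) ?_ ξ)
    obtain ⟨C, hC⟩ := finsum_hat_le f
    refine ⟨C, ?_⟩
    rintro _ ⟨ξ, rfl⟩
    exact (finsum_source_eq f ξ).trans_le (hC _)

theorem finsum_norm_hat_invol_le_inorm [CompactSpace (Γ.PathSpace S)]
    (f : C_c(Γ.ToeplitzGroupoid S, ℂ)) (a : Γ.PathSpace S) :
    ∑ᶠ g, ‖hat (invol f) g a‖ ≤ inorm f := by
  by_cases ha : a = 0
  · rw [finsum_eq_zero_of_forall_eq_zero]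
    · exact inorm_nonneg _
    · intro g
      rw [hat_eq_zero _ (by rw [ha, gact_zero]), norm_zero]
  · obtain ⟨ξ, rfl⟩ := exists_pathSet_eq ha
    rw [← finsum_range_eq]
    refine le_max_of_le_right (le_ciSup (f := fun ξ : Γ.transversal S =>
      ∑ᶠ γ : {γ : Γ.ToeplitzGroupoid S // γ.range = ξ}, ‖f γ.1‖) ?_ ξ)
    obtain ⟨C, hC⟩ := finsum_hat_le (involC f)
    refine ⟨C, ?_⟩
    rintro _ ⟨ξ, rfl⟩
    exact (finsum_range_eq f ξ).trans_le (hC _)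

end ToeplitzGroupoid

end Hat

/-! ### The range projections of a Toeplitz family -/

section Family

variable {V E : Type*} {Γ : DirectedGraph V E} {S : Set V}
variable {H : Type*} [NormedAddCommGroup H] [InnerProductSpace ℂ H] [CompleteSpace H]

theorem re_inner_star_mul (T : H →L[ℂ] H) (ξ : H) :
    (inner ℂ ξ ((star T * T) ξ)).re = ‖T ξ‖ ^ 2 := by
  rw [mul_apply_eq_comp, ContinuousLinearMap.star_eq_adjoint,
    ContinuousLinearMap.adjoint_inner_right, inner_self_eq_norm_sq_to_K]
  norm_cast

theorem _root_.IsStarProjection.re_inner {P : H →L[ℂ] H} (hP : IsStarProjection P) (ξ : H) :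
    (inner ℂ ξ (P ξ)).re = ‖P ξ‖ ^ 2 := by
  rw [← re_inner_star_mul, hP.isSelfAdjoint.star_eq, hP.isIdempotentElem.eq]

omit [CompleteSpace H] in
theorem re_inner_le_of_le {T T' : H →L[ℂ] H} (h : T ≤ T') (ξ : H) :
    (inner ℂ ξ (T ξ)).re ≤ (inner ℂ ξ (T' ξ)).re := by
  have h1 := ((ContinuousLinearMap.le_def _ _).1 h).re_inner_nonneg_right ξ
  rw [sub_apply, inner_sub_right, map_sub, sub_nonneg] at h1
  exact h1

open Classical in
/-- The projection `S_μ S_μ^*` of a family of operators, for a directed word `μ` with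
origin `u`; it is zero if `μ` is not a walk starting at `u`. -/
def rangeProj (Γ : DirectedGraph V E) (s : E → H →L[ℂ] H) (p : V → H →L[ℂ] H) :
    V → List E → (H →L[ℂ] H)
  | u, [] => p u
  | u, e :: μ => if Γ.o e = u then s e * rangeProj Γ s p (Γ.t e) μ * star (s e) else 0

variable {s : E → H →L[ℂ] H} {p : V → H →L[ℂ] H}

theorem rangeProj_cons (e : E) (μ : List E) : Γ.rangeProj s p (Γ.o e) (e :: μ) =
    s e * Γ.rangeProj s p (Γ.t e) μ * star (s e) := if_pos rfl

theorem rangeProj_cons_of_ne {e : E} {u : V} (h : Γ.o e ≠ u) (μ : List E) :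
    Γ.rangeProj s p u (e :: μ) = 0 := if_neg h

namespace IsToeplitzFamily

variable (h : Γ.IsToeplitzFamily S s p)

include h

theorem p_star (u : V) : star (p u) = p u := (h.projection u).isSelfAdjoint.star_eq

theorem p_mul_p (u : V) : p u * p u = p u := (h.projection u).isIdempotentElem.eq

theorem s_mul_p (e : E) : s e * p (Γ.t e) = s e := by
  rw [← h.initial, ← mul_assoc, h.partialIsometry]

theorem p_mul_star_s (e : E) : p (Γ.t e) * star (s e) = star (s e) := by
  have := congrArg star (h.s_mul_p e)
  rwa [star_mul, h.p_star] at this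

theorem norm_p_le (u : V) (ξ : H) : ‖p u ξ‖ ≤ ‖ξ‖ :=
  ((p u).le_opNorm ξ).trans
    (mul_le_of_le_one_left (norm_nonneg _) (IsStarProjection.norm_le _ (h.projection u)))

theorem sum_norm_star_le (u : V) (F : Finset {f // Γ.o f = u}) (ξ : H) :
    ∑ f ∈ F, ‖star (s f) ξ‖ ^ 2 ≤ ‖p u ξ‖ ^ 2 := by
  obtain ⟨q, hq, hle, -⟩ := h.final u
  have h1 : HasSum (fun f : {f // Γ.o f = u} => ‖star (s f) ξ‖ ^ 2) (inner ℂ ξ (q ξ)).re := by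
    have h2 : HasSum (fun f : {f // Γ.o f = u} => inner ℂ ξ ((s f * star (s f)) ξ))
        (inner ℂ ξ (q ξ)) := (hq ξ).mapL (innerSL ℂ ξ)
    refine (Complex.hasSum_re h2).congr_fun fun f => ?_
    rw [← re_inner_star_mul, star_star]
  refine (sum_le_hasSum F (fun f _ => sq_nonneg _) h1).trans ?_
  rw [← (h.projection u).re_inner]
  exact re_inner_le_of_le hle ξ

theorem norm_star_le (e : E) (ξ : H) : ‖star (s e) ξ‖ ≤ ‖p (Γ.o e) ξ‖ := by
  have := h.sum_norm_star_le (Γ.o e) {⟨e, rfl⟩} ξ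
  rw [Finset.sum_singleton] at this
  exact le_of_sq_le_sq this (norm_nonneg _)

theorem star_s_mul_p (e : E) : star (s e) * p (Γ.o e) = star (s e) := by
  ext ξ
  have h1 := h.norm_star_le e (ξ - p (Γ.o e) ξ)
  have h2 : p (Γ.o e) (ξ - p (Γ.o e) ξ) = 0 := by
    rw [map_sub, ← mul_apply_eq_comp, h.p_mul_p, sub_self]
  rw [h2, norm_zero, norm_le_zero_iff, map_sub, sub_eq_zero] at h1
  exact h1.symm

theorem p_mul_s (e : E) : p (Γ.o e) * s e = s e := by
  have := congrArg star (h.star_s_mul_p e)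
  rwa [star_mul, h.p_star, star_star] at this

theorem norm_s_apply (e : E) (ξ : H) : ‖s e ξ‖ = ‖p (Γ.t e) ξ‖ := by
  have h1 := re_inner_star_mul (s e) ξ
  rw [h.initial, (h.projection _).re_inner] at h1
  exact ((sq_eq_sq₀ (norm_nonneg _) (norm_nonneg _)).1 h1).symm

/-- The final projections of two different edges with the same origin are orthogonal, because their
sum is bounded by a projection. -/
theorem star_s_mul_s {e f : E} (hef : e ≠ f) : star (s e) * s f = 0 := by
  classical
  by_cases ho : Γ.o e = Γ.o f
  · ext η
    have h1 := h.sum_norm_star_le (Γ.o f)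
      ({⟨e, ho⟩, ⟨f, rfl⟩} : Finset {f' // Γ.o f' = Γ.o f}) (s f η)
    rw [Finset.sum_pair (by simpa using hef)] at h1
    have h2 : ‖star (s f) (s f η)‖ = ‖s f η‖ := by
      rw [← mul_apply_eq_comp, h.initial, h.norm_s_apply]
    have h3 : ‖star (s e) (s f η)‖ ^ 2 ≤ 0 := by
      have := pow_le_pow_left₀ (norm_nonneg _) (h.norm_p_le (Γ.o f) (s f η)) 2
      simp only [h2] at h1
      linarith
    have h4 : ‖star (s e) (s f η)‖ = 0 := by
      simpa using le_antisymm h3 (sq_nonneg _)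
    simpa using h4
  · rw [← h.star_s_mul_p e, ← h.p_mul_s f, mul_assoc, ← mul_assoc (p _), h.orthogonal _ _ ho,
      zero_mul, mul_zero]

theorem p_eq_sum {u : V} (hu : u ∈ S) (hfin : (Γ.outEdges u).Finite) :
    p u = ∑ e ∈ hfin.toFinset, s e * star (s e) := by
  obtain ⟨q, hq, -, heq⟩ := h.final u
  rw [← heq hu]
  have : Fintype {f // Γ.o f = u} := hfin.fintype
  ext ξ
  rw [(hq ξ).unique (hasSum_fintype _), sum_apply]
  refine (Finset.sum_subtype _ (fun f => ?_) fun f => (s f * star (s f)) ξ).symm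
  rw [Set.Finite.mem_toFinset]
  rfl

theorem rangeProj_star (u : V) (μ : List E) :
    star (Γ.rangeProj s p u μ) = Γ.rangeProj s p u μ := by
  induction μ generalizing u with
  | nil => exact h.p_star u
  | cons e μ ih =>
    by_cases ho : Γ.o e = u
    · subst ho
      rw [rangeProj_cons, star_mul, star_mul, star_star, ih, mul_assoc]
    · rw [rangeProj_cons_of_ne ho, star_zero]

theorem p_mul_rangeProj (u : V) (μ : List E) :
    p u * Γ.rangeProj s p u μ = Γ.rangeProj s p u μ := by
  cases μ with
  | nil => exact h.p_mul_p u
  | cons e μ =>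
    by_cases ho : Γ.o e = u
    · subst ho
      rw [rangeProj_cons, ← mul_assoc, ← mul_assoc, h.p_mul_s]
    · rw [rangeProj_cons_of_ne ho, mul_zero]

theorem rangeProj_mul_p (u : V) (μ : List E) :
    Γ.rangeProj s p u μ * p u = Γ.rangeProj s p u μ := by
  have := congrArg star (h.p_mul_rangeProj u μ)
  rwa [star_mul, h.rangeProj_star, h.p_star] at this

theorem rangeProj_mul_of_ne {u v : V} (huv : u ≠ v) (μ ν : List E) :
    Γ.rangeProj s p u μ * Γ.rangeProj s p v ν = 0 := by
  rw [← h.rangeProj_mul_p u, ← h.p_mul_rangeProj v, mul_assoc, ← mul_assoc (p u),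
    h.orthogonal _ _ huv, zero_mul, mul_zero]

theorem rangeProj_cons_mul_cons (e : E) (μ ν : List E) :
    Γ.rangeProj s p (Γ.o e) (e :: μ) * Γ.rangeProj s p (Γ.o e) (e :: ν) =
      s e * (Γ.rangeProj s p (Γ.t e) μ * Γ.rangeProj s p (Γ.t e) ν) * star (s e) := by
  rw [rangeProj_cons, rangeProj_cons]
  calc s e * Γ.rangeProj s p (Γ.t e) μ * star (s e) *
        (s e * Γ.rangeProj s p (Γ.t e) ν * star (s e))
      = s e * Γ.rangeProj s p (Γ.t e) μ * (star (s e) * s e) *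
        Γ.rangeProj s p (Γ.t e) ν * star (s e) := by simp only [mul_assoc]
    _ = s e * (Γ.rangeProj s p (Γ.t e) μ * p (Γ.t e)) *
        Γ.rangeProj s p (Γ.t e) ν * star (s e) := by rw [h.initial, ← mul_assoc]
    _ = _ := by rw [h.rangeProj_mul_p]; simp only [mul_assoc]

theorem rangeProj_mul_append (u : V) (μ κ : List E) :
    Γ.rangeProj s p u μ * Γ.rangeProj s p u (μ ++ κ) = Γ.rangeProj s p u (μ ++ κ) := by
  induction μ generalizing u with
  | nil => exact h.p_mul_rangeProj u κ
  | cons e μ ih =>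
    by_cases ho : Γ.o e = u
    · subst ho
      rw [List.cons_append, h.rangeProj_cons_mul_cons, ih, rangeProj_cons]
    · rw [rangeProj_cons_of_ne ho, List.cons_append, rangeProj_cons_of_ne ho, zero_mul]

theorem rangeProj_idem (u : V) (μ : List E) :
    Γ.rangeProj s p u μ * Γ.rangeProj s p u μ = Γ.rangeProj s p u μ := by
  simpa using h.rangeProj_mul_append u μ []

theorem comparable_of_rangeProj_mul {u : V} {μ ν : List E}
    (hne : Γ.rangeProj s p u μ * Γ.rangeProj s p u ν ≠ 0) : μ <+: ν ∨ ν <+: μ := by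
  induction μ generalizing u ν with
  | nil => exact Or.inl List.nil_prefix
  | cons e μ ih =>
    cases ν with
    | nil => exact Or.inr List.nil_prefix
    | cons f ν =>
      by_cases he : Γ.o e = u
      · by_cases hf : Γ.o f = u
        · by_cases hef : e = f
          · subst hef he
            rw [h.rangeProj_cons_mul_cons] at hne
            simpa using ih (left_ne_zero_of_mul (right_ne_zero_of_mul (mul_assoc (s e) _ _ ▸ hne)))
          · refine absurd ?_ hne
            subst he
            rw [rangeProj_cons, ← hf, rangeProj_cons, mul_assoc, mul_assoc (s f),
              ← mul_assoc (star (s e)), h.star_s_mul_s hef, zero_mul, mul_zero]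
        · rw [rangeProj_cons_of_ne hf, mul_zero] at hne
          exact absurd rfl hne
      · rw [rangeProj_cons_of_ne he, zero_mul] at hne
        exact absurd rfl hne

theorem rangeProj_comm (u v : V) (μ ν : List E) :
    Γ.rangeProj s p u μ * Γ.rangeProj s p v ν = Γ.rangeProj s p v ν * Γ.rangeProj s p u μ := by
  by_cases huv : u = v
  · subst huv
    have key : ∀ μ κ, Γ.rangeProj s p u (μ ++ κ) * Γ.rangeProj s p u μ
        = Γ.rangeProj s p u (μ ++ κ) := fun μ κ => by
      have := congrArg star (h.rangeProj_mul_append u μ κ)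
      rwa [star_mul, h.rangeProj_star, h.rangeProj_star] at this
    by_cases hc : μ <+: ν ∨ ν <+: μ
    · rcases hc with ⟨κ, rfl⟩ | ⟨κ, rfl⟩
      · rw [h.rangeProj_mul_append, key]
      · rw [h.rangeProj_mul_append, key]
    · have h0 : ∀ μ ν, ¬(μ <+: ν ∨ ν <+: μ) →
          Γ.rangeProj s p u μ * Γ.rangeProj s p u ν = 0 := fun μ ν hc =>
        not_ne_iff.1 (mt h.comparable_of_rangeProj_mul hc)
      rw [h0 μ ν hc, h0 ν μ (mt Or.symm hc)]
  · rw [h.rangeProj_mul_of_ne huv, h.rangeProj_mul_of_ne (Ne.symm huv)]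

omit h in
theorem exists_dWalk_of_rangeProj {u : V} {μ : List E} (hne : Γ.rangeProj s p u μ ≠ 0) :
    ∃ w, Γ.DWalk u μ w := by
  induction μ generalizing u with
  | nil => exact ⟨u, rfl⟩
  | cons e μ ih =>
    by_cases he : Γ.o e = u
    · subst he
      rw [rangeProj_cons] at hne
      obtain ⟨w, hw⟩ := ih (right_ne_zero_of_mul (left_ne_zero_of_mul hne))
      exact ⟨w, dWalk_cons.2 ⟨rfl, hw⟩⟩
    · exact absurd (rangeProj_cons_of_ne he μ) hne

theorem rangeProj_singleton (e : E) : Γ.rangeProj s p (Γ.o e) [e] = s e * star (s e) := by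
  rw [rangeProj_cons]
  change s e * p (Γ.t e) * star (s e) = _
  rw [h.s_mul_p]

/-- The projection of a walk ending in `S` is the sum of the projections of its prolongations by one
edge. -/
theorem rangeProj_eq_sum {u w : V} {μ : List E} (hμ : Γ.DWalk u μ w) (hw : w ∈ S)
    (hfin : (Γ.outEdges w).Finite) :
    Γ.rangeProj s p u μ = ∑ e ∈ hfin.toFinset, Γ.rangeProj s p u (μ ++ [e]) := by
  induction μ generalizing u with
  | nil =>
    obtain rfl := dWalk_nil.1 hμ
    refine (h.p_eq_sum hw hfin).trans (Finset.sum_congr rfl fun e he => ?_)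
    obtain rfl : Γ.o e = u := by simpa [outEdges] using he
    rw [List.nil_append, h.rangeProj_singleton]
  | cons e μ ih =>
    obtain ⟨rfl, hμ'⟩ := dWalk_cons.1 hμ
    simp only [List.cons_append, rangeProj_cons]
    rw [ih hμ', Finset.mul_sum, Finset.sum_mul]

end IsToeplitzFamily

end Family

/-! ### Continuous functions on the path space -/

section PathSpaceFunctions

universe u v
variable {V : Type u} {E : Type v} {Γ : DirectedGraph V E} {S : Set V}

open ToeplitzGroupoid PathSpace

theorem star_chi (κ : V × List E) : star (chi κ : C(Γ.PathSpace S, ℂ)) = chi κ := by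
  ext a
  by_cases ha : a.1 κ
  · simp [chi_of_mem ha]
  · simp [chi_of_notMem ha]

theorem chi_injective {a b : Γ.PathSpace S}
    (h : ∀ κ, (chi κ : C(Γ.PathSpace S, ℂ)) a = chi κ b) : a = b := by
  refine PathSpace.ext_iff' fun u μ => ?_
  have := h (u, μ)
  by_cases ha : a.1 (u, μ) <;> by_cases hb : b.1 (u, μ) <;>
    simp [ha, hb, chi_of_mem, chi_of_notMem] at this ⊢

/-- By the theorem of Stone and Weierstrass, the indicator functions `chi κ` generate the algebra of
continuous functions on the path space. -/
theorem chi_induction [CompactSpace (Γ.PathSpace S)] {P : C(Γ.PathSpace S, ℂ) → Prop}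
    (hchi : ∀ κ, P (chi κ)) (hconst : ∀ c : ℂ, P (algebraMap ℂ _ c))
    (hadd : ∀ f g, P f → P g → P (f + g)) (hmul : ∀ f g, P f → P g → P (f * g))
    (hstar : ∀ f, P f → P (star f)) (hclosed : IsClosed {f | P f}) (f : C(Γ.PathSpace S, ℂ)) :
    P f := by
  let A : StarSubalgebra ℂ C(Γ.PathSpace S, ℂ) := StarAlgebra.adjoin ℂ (Set.range chi)
  have hA : A.topologicalClosure = ⊤ := by
    refine ContinuousMap.starSubalgebra_topologicalClosure_eq_top_of_separatesPoints A ?_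
    intro a b hab
    by_contra! hn
    exact hab (chi_injective fun κ => hn _ ⟨chi κ, StarAlgebra.subset_adjoin ℂ _ ⟨κ, rfl⟩, rfl⟩)
  have hsub : (A : Set C(Γ.PathSpace S, ℂ)) ⊆ {f | P f} := by
    intro f hf
    refine StarAlgebra.adjoin_induction (p := fun f _ => P f) ?_ hconst
      (fun f g _ _ => hadd f g) (fun f g _ _ => hmul f g) (fun f _ => hstar f) hf
    rintro _ ⟨κ, rfl⟩
    exact hchi κ
  have hf : f ∈ A.topologicalClosure := hA ▸ StarSubalgebra.mem_top
  exact closure_minimal hsub hclosed hf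

/-- An intertwining relation for the indicator functions `chi κ` extends to all continuous functions. -/
theorem intertwine_of_chi [CompactSpace (Γ.PathSpace S)] {B : Type*} [CStarAlgebra B]
    (Φ Ψ : C(Γ.PathSpace S, ℂ) →⋆ₐ[ℂ] B) (T : B)
    (h : ∀ κ, Φ (chi κ) * T = T * Ψ (chi κ)) (f : C(Γ.PathSpace S, ℂ)) : Φ f * T = T * Ψ f := by
  have hc : ∀ Φ : C(Γ.PathSpace S, ℂ) →⋆ₐ[ℂ] B, Continuous Φ := fun Φ =>
    AddMonoidHomClass.continuous_of_bound Φ 1 fun f => by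
      rw [one_mul]
      exact NonUnitalStarAlgHom.norm_apply_le Φ f
  refine (chi_induction (P := fun f => Φ f * T = T * Ψ f ∧ Φ (star f) * T = T * Ψ (star f))
    ?_ ?_ ?_ ?_ ?_ ?_ f).1
  · intro κ
    rw [star_chi]
    exact ⟨h κ, h κ⟩
  · intro c
    rw [← algebraMap_star_comm, AlgHomClass.commutes, AlgHomClass.commutes, AlgHomClass.commutes,
      AlgHomClass.commutes]
    exact ⟨Algebra.commutes _ _, Algebra.commutes _ _⟩
  · rintro f g ⟨h1, h2⟩ ⟨h3, h4⟩
    simp only [star_add, map_add, add_mul, mul_add, h1, h2, h3, h4, and_self]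
  · rintro f g ⟨h1, h2⟩ ⟨h3, h4⟩
    simp only [star_mul, map_mul]
    exact ⟨by rw [mul_assoc, h3, ← mul_assoc, h1, mul_assoc],
      by rw [mul_assoc, h2, ← mul_assoc, h4, mul_assoc]⟩
  · rintro f ⟨h1, h2⟩
    exact ⟨h2, by rwa [star_star]⟩
  · refine IsClosed.inter (isClosed_eq ?_ ?_) (isClosed_eq ?_ ?_)
    · exact (hc Φ).mul continuous_const
    · exact continuous_const.mul (hc Ψ)
    · exact ((hc Φ).comp continuous_star).mul continuous_const
    · exact continuous_const.mul ((hc Ψ).comp continuous_star)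

/-- Projections in a commutative C*-algebra with the relations of the sets `V(μ)` define a
representation of the algebra of continuous functions on the path space.  It is dual to the
map that assigns to a character of the C*-algebra the set of the words `κ` such that the character
has the value one on the projection `q κ`. -/
theorem exists_starAlgHom_of_projections [CompactSpace (Γ.PathSpace S)] {A : Type*}
    [CommCStarAlgebra A] (q : V × List E → A)
    (idem : ∀ κ, q κ * q κ = q κ) (orth : ∀ u v μ ν, u ≠ v → q (u, μ) * q (v, ν) = 0)
    (append : ∀ u μ ν, q (u, μ) * q (u, μ ++ ν) = q (u, μ ++ ν))
    (comparable : ∀ u μ ν, q (u, μ) * q (u, ν) ≠ 0 → μ <+: ν ∨ ν <+: μ)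
    (walk : ∀ u μ, q (u, μ) ≠ 0 → ∃ w, Γ.DWalk u μ w)
    (exit : ∀ u μ w, Γ.DWalk u μ w → w ∈ S →
      ∃ F : Finset E, q (u, μ) = ∑ e ∈ F, q (u, μ ++ [e])) :
    ∃ Φ : C(Γ.PathSpace S, ℂ) →⋆ₐ[ℂ] A, ∀ κ, Φ (chi κ) = q κ := by
  classical
  have h01 : ∀ (φ : WeakDual.characterSpace ℂ A) κ, φ (q κ) ≠ 1 → φ (q κ) = 0 := by
    intro φ κ h1
    have h2 := congrArg φ (idem κ)
    rw [map_mul] at h2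
    by_contra h0
    exact h1 (mul_right_cancel₀ h0 (by rw [h2, one_mul]))
  have hne : ∀ (φ : WeakDual.characterSpace ℂ A) κ, φ (q κ) = 1 → q κ ≠ 0 := by
    intro φ κ h1 h0
    rw [h0, map_zero] at h1
    exact zero_ne_one h1
  let pt : WeakDual.characterSpace ℂ A → Γ.PathSpace S := fun φ =>
    ⟨fun κ => decide (φ (q κ) = 1), by
      refine ⟨fun u μ v ν h h' => ?_, fun u μ ν h => ?_, fun u μ ν h h' => ?_, fun u μ h => ?_,
        fun u μ w h hw hS => ?_⟩ <;> simp only [decide_eq_true_eq] at *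
      · by_contra huv
        have := congrArg φ (orth u v μ ν huv)
        rw [map_mul, h, h', map_zero, one_mul] at this
        exact one_ne_zero this
      · have := congrArg φ (append u μ ν)
        rwa [map_mul, h, mul_one] at this
      · refine comparable u μ ν fun h0 => ?_
        have := congrArg φ h0
        rw [map_mul, h, h', map_zero, one_mul] at this
        exact one_ne_zero this
      · exact walk u μ (hne φ _ h)
      · obtain ⟨F, hF⟩ := exit u μ w hw hS
        by_contra! hn
        rw [hF, map_sum, Finset.sum_eq_zero fun e _ => h01 φ _ (hn e)] at h
        exact zero_ne_one h⟩
  have hpt : ∀ φ κ, (pt φ).1 κ ↔ φ (q κ) = 1 := fun φ κ => by simp [pt]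
  have hcont : Continuous pt := by
    refine continuous_of_coord fun κ => ?_
    have hev : Continuous fun φ : WeakDual.characterSpace ℂ A => φ (q κ) :=
      (gelfandStarTransform A (q κ)).continuous
    simp only [hpt]
    refine ⟨isClosed_eq hev continuous_const, ?_⟩
    rw [← isClosed_compl_iff]
    convert isClosed_eq hev (continuous_const (y := (0 : ℂ))) using 1
    ext φ
    refine ⟨fun h => h01 φ κ h, fun h h1 => ?_⟩
    exact zero_ne_one ((show φ (q κ) = 0 from h).symm.trans h1)
  refine ⟨((gelfandStarTransform A).symm : C(WeakDual.characterSpace ℂ A, ℂ) →⋆ₐ[ℂ] A).comp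
    (ContinuousMap.compStarAlgHom' ℂ ℂ ⟨pt, hcont⟩), fun κ => ?_⟩
  change (gelfandStarTransform A).symm ((chi κ : C(Γ.PathSpace S, ℂ)).comp ⟨pt, hcont⟩) = q κ
  rw [StarAlgEquiv.symm_apply_eq]
  ext φ
  rw [gelfandStarTransform_apply_apply]
  change (chi κ : C(Γ.PathSpace S, ℂ)) (pt φ) = φ (q κ)
  by_cases h1 : φ (q κ) = 1
  · rw [chi_of_mem ((hpt φ κ).2 h1), h1]
  · rw [chi_of_notMem (fun h => h1 ((hpt φ κ).1 h)), h01 φ κ h1]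

end PathSpaceFunctions

section Diagonal

universe u v
variable {V : Type u} {E : Type v} {Γ : DirectedGraph V E} {S : Set V}
variable {H : Type*} [NormedAddCommGroup H] [InnerProductSpace ℂ H] [CompleteSpace H]
  {s : E → H →L[ℂ] H} {p : V → H →L[ℂ] H}

open ToeplitzGroupoid PathSpace

/-- The representation of the diagonal: the range projections of a Toeplitz family generate
a commutative C*-algebra, which is a quotient of the algebra of continuous functions on the
path space. -/
theorem IsToeplitzFamily.exists_diagonal [CompactSpace (Γ.PathSpace S)]
    (h : Γ.IsToeplitzFamily S s p) (hS : S ⊆ Γ.regular) :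
    ∃ Φ : C(Γ.PathSpace S, ℂ) →⋆ₐ[ℂ] (H →L[ℂ] H),
      ∀ κ, Φ (chi κ) = Γ.rangeProj s p κ.1 κ.2 := by
  let R : Set (H →L[ℂ] H) := Set.range fun κ : V × List E => Γ.rangeProj s p κ.1 κ.2
  let A : StarSubalgebra ℂ (H →L[ℂ] H) := StarAlgebra.adjoin ℂ R
  have hcomm : ∀ x y : A, x * y = y * x := by
    refine (StarAlgebra.isMulCommutative_adjoin ℂ (s := R) ?_ ?_).is_comm.comm
    · rintro _ ⟨κ, rfl⟩ _ ⟨κ', rfl⟩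
      exact h.rangeProj_comm _ _ _ _
    · rintro _ ⟨κ, rfl⟩ _ ⟨κ', rfl⟩
      simp only [h.rangeProj_star]
      exact h.rangeProj_comm _ _ _ _
  let D : StarSubalgebra ℂ (H →L[ℂ] H) := A.topologicalClosure
  have hclosed : IsClosed (D : Set (H →L[ℂ] H)) := A.isClosed_topologicalClosure
  let _ : CommCStarAlgebra D :=
    { (inferInstance : CStarAlgebra D) with
      mul_comm := (StarSubalgebra.commRingTopologicalClosure A hcomm).mul_comm }
  have hmem : ∀ κ : V × List E, Γ.rangeProj s p κ.1 κ.2 ∈ D := fun κ =>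
    A.le_topologicalClosure (StarAlgebra.subset_adjoin ℂ _ ⟨κ, rfl⟩)
  obtain ⟨Φ, hΦ⟩ := exists_starAlgHom_of_projections (Γ := Γ) (S := S)
    (fun κ => (⟨_, hmem κ⟩ : D))
    (fun κ => Subtype.ext (h.rangeProj_idem _ _))
    (fun u v μ ν huv => Subtype.ext (h.rangeProj_mul_of_ne huv _ _))
    (fun u μ ν => Subtype.ext (h.rangeProj_mul_append _ _ _))
    (fun u μ ν hne => h.comparable_of_rangeProj_mul fun h0 => hne (Subtype.ext h0))
    (fun u μ hne => IsToeplitzFamily.exists_dWalk_of_rangeProj fun h0 => hne (Subtype.ext h0))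
    (fun u μ w hw hwS => ⟨(hS hwS).2.toFinset, Subtype.ext (by
      rw [AddSubmonoidClass.coe_finsetSum]
      exact h.rangeProj_eq_sum hw hwS (hS hwS).2)⟩)
  exact ⟨D.subtype.comp Φ, fun κ => congrArg Subtype.val (hΦ κ)⟩

end Diagonal

/-! ### The representation of the convolution algebra given by a Toeplitz family -/

section Rep

universe u v
variable {V : Type u} {E : Type v} {Γ : DirectedGraph V E} {S : Set V}
variable {H : Type*} [NormedAddCommGroup H] [InnerProductSpace ℂ H] [CompleteSpace H]

open ToeplitzGroupoid PathSpace

/-- The partial action of a letter, as a continuous map. -/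
def PathSpace.shiftC (l : E × Bool) : C(Γ.PathSpace S, Γ.PathSpace S) :=
  ⟨shift l, continuous_shift l⟩

/-- The partial action of a word, as a continuous map. -/
def PathSpace.actC (w : List (E × Bool)) : C(Γ.PathSpace S, Γ.PathSpace S) :=
  ⟨act w, continuous_act w⟩

/-- The partial action of an element of the free group, as a continuous map. -/
def PathSpace.gactC (g : FreeGroup E) : C(Γ.PathSpace S, Γ.PathSpace S) :=
  ⟨gact g, continuous_gact g⟩

theorem chi_comp {φ : C(Γ.PathSpace S, Γ.PathSpace S)} {κ κ' : V × List E}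
    (h : ∀ a, (φ a).1 κ ↔ a.1 κ') : (chi κ : C(Γ.PathSpace S, ℂ)).comp φ = chi κ' := by
  ext a
  by_cases ha : a.1 κ'
  · rw [ContinuousMap.comp_apply, chi_of_mem ha, chi_of_mem ((h a).2 ha)]
  · rw [ContinuousMap.comp_apply, chi_of_notMem ha, chi_of_notMem (mt (h a).1 ha)]

theorem chi_comp_eq_zero {φ : C(Γ.PathSpace S, Γ.PathSpace S)} {κ : V × List E}
    (h : ∀ a, ¬ (φ a).1 κ) : (chi κ : C(Γ.PathSpace S, ℂ)).comp φ = 0 := by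
  ext a
  rw [ContinuousMap.comp_apply, chi_of_notMem (h a), ContinuousMap.zero_apply]

theorem chi_mul_eq_self {φ : C(Γ.PathSpace S, Γ.PathSpace S)} {κ : V × List E}
    {f : C(Γ.PathSpace S, ℂ)} (h : ∀ a, f a ≠ 0 → (φ a).1 κ) :
    (chi κ : C(Γ.PathSpace S, ℂ)).comp φ * f = f := by
  ext a
  by_cases ha : f a = 0
  · rw [ContinuousMap.mul_apply, ha, mul_zero]
  · rw [ContinuousMap.mul_apply, ContinuousMap.comp_apply, chi_of_mem (h a ha), one_mul]

/-- The operator of a letter: `S_e` for a directed edge, and `S_e^*` for its reversal. -/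
def letterOp (s : E → H →L[ℂ] H) (l : E × Bool) : H →L[ℂ] H := if l.2 then s l.1 else star (s l.1)

/-- The product of the operators of the letters of a word. -/
def wordOp (s : E → H →L[ℂ] H) (w : List (E × Bool)) : H →L[ℂ] H := (w.map (letterOp s)).prod

open Classical in
/-- The operator of an element of the free group, defined by its reduced word. -/
def groupOp (s : E → H →L[ℂ] H) (g : FreeGroup E) : H →L[ℂ] H := wordOp s g.toWord

variable {s : E → H →L[ℂ] H} {p : V → H →L[ℂ] H}

@[simp] theorem letterOp_true (e : E) : letterOp s (e, true) = s e := rfl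

@[simp] theorem letterOp_false (e : E) : letterOp s (e, false) = star (s e) := rfl

theorem star_letterOp (e : E) (b : Bool) : star (letterOp s (e, b)) = letterOp s (e, !b) := by
  cases b <;> simp

theorem wordOp_nil : wordOp s [] = 1 := rfl

theorem wordOp_cons (l : E × Bool) (w : List (E × Bool)) :
    wordOp s (l :: w) = letterOp s l * wordOp s w := by
  simp [wordOp]

theorem wordOp_append (w w' : List (E × Bool)) :
    wordOp s (w ++ w') = wordOp s w * wordOp s w' := by
  simp [wordOp]

theorem star_wordOp (w : List (E × Bool)) :
    star (wordOp s w) = wordOp s (FreeGroup.invRev w) := by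
  induction w with
  | nil => simp [wordOp_nil]
  | cons l w ih =>
    obtain ⟨e, b⟩ := l
    have h : FreeGroup.invRev ((e, b) :: w) = FreeGroup.invRev w ++ [(e, !b)] := by
      simp [FreeGroup.invRev]
    rw [h, wordOp_cons, star_mul, ih, wordOp_append, wordOp_cons, wordOp_nil, mul_one,
      star_letterOp]

theorem star_groupOp (g : FreeGroup E) : star (groupOp s g) = groupOp s g⁻¹ := by
  classical
  rw [groupOp, star_wordOp, ← FreeGroup.toWord_inv]
  rfl

theorem groupOp_one : groupOp s 1 = 1 := by
  simp [groupOp, wordOp_nil]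

theorem groupOp_of (e : E) : groupOp s (FreeGroup.of e) = s e := by
  simp [groupOp, wordOp]

namespace IsToeplitzFamily

section Norm

variable (h : Γ.IsToeplitzFamily S s p)

include h

theorem norm_letterOp_le (l : E × Bool) (ξ : H) : ‖letterOp s l ξ‖ ≤ ‖ξ‖ := by
  obtain ⟨e, _ | _⟩ := l
  · exact (h.norm_star_le e ξ).trans (h.norm_p_le _ _)
  · exact (h.norm_s_apply e ξ).trans_le (h.norm_p_le _ _)

theorem norm_groupOp_le (g : FreeGroup E) (ξ : H) : ‖groupOp s g ξ‖ ≤ ‖ξ‖ := by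
  classical
  rw [groupOp]
  induction g.toWord with
  | nil => exact le_rfl
  | cons l w ih =>
    rw [wordOp_cons, mul_apply_eq_comp]
    exact (h.norm_letterOp_le l _).trans ih

end Norm

variable [CompactSpace (Γ.PathSpace S)] (h : Γ.IsToeplitzFamily S s p)
  {Φ : C(Γ.PathSpace S, ℂ) →⋆ₐ[ℂ] (H →L[ℂ] H)}
  (hΦ : ∀ κ, Φ (chi κ) = Γ.rangeProj s p κ.1 κ.2)

include h hΦ

/-- The covariance for a letter, verified on the indicator functions. -/
theorem diagonal_mul_letterOp (l : E × Bool) (f : C(Γ.PathSpace S, ℂ)) :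
    Φ f * letterOp s l = letterOp s l * Φ (f.comp (shiftC l)) := by
  refine intertwine_of_chi Φ (Φ.comp (ContinuousMap.compStarAlgHom' ℂ ℂ (shiftC l))) _ ?_ f
  intro κ
  change Φ (chi κ) * _ = _ * Φ ((chi κ : C(Γ.PathSpace S, ℂ)).comp (shiftC l))
  obtain ⟨e, _ | _⟩ := l
  · obtain ⟨u, μ⟩ := κ
    by_cases hu : u = Γ.t e
    · subst hu
      rw [chi_comp (κ' := (Γ.o e, e :: μ)) fun a => shift_false.trans (and_iff_right rfl), hΦ, hΦ,
        letterOp_false, rangeProj_cons, ← mul_assoc, ← mul_assoc, h.initial, h.p_mul_rangeProj]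
    · rw [chi_comp_eq_zero fun a ha => hu (shift_false.1 ha).1, map_zero, mul_zero, hΦ,
        letterOp_false, ← h.rangeProj_mul_p, ← h.p_mul_star_s, mul_assoc, ← mul_assoc (p u),
        h.orthogonal _ _ hu, zero_mul, mul_zero]
  · obtain ⟨u, _ | ⟨f, μ⟩⟩ := κ
    · by_cases hu : u = Γ.o e
      · subst hu
        rw [chi_comp (κ' := (Γ.t e, [])) fun a => shift_true_nil.trans (and_iff_right rfl), hΦ, hΦ,
          letterOp_true]
        exact (h.p_mul_s e).trans (h.s_mul_p e).symm
      · rw [chi_comp_eq_zero fun a ha => hu (shift_true_nil.1 ha).1, map_zero, mul_zero, hΦ,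
          letterOp_true, ← h.p_mul_s e, ← mul_assoc]
        change p u * p (Γ.o e) * s e = 0
        rw [h.orthogonal _ _ hu, zero_mul]
    · by_cases hf : u = Γ.o e ∧ f = e
      · obtain ⟨rfl, rfl⟩ := hf
        rw [chi_comp (κ' := (Γ.t f, μ))
          fun a => shift_true_cons.trans ((and_iff_right rfl).trans (and_iff_right rfl)), hΦ, hΦ,
          letterOp_true, rangeProj_cons, mul_assoc _ _ (s f), h.initial, mul_assoc,
          h.rangeProj_mul_p]
      · rw [chi_comp_eq_zero fun a ha => hf ⟨(shift_true_cons.1 ha).1, (shift_true_cons.1 ha).2.1⟩,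
          map_zero, mul_zero, hΦ, letterOp_true]
        by_cases hu : Γ.o f = u
        · subst hu
          have hne : f ≠ e := by
            rintro rfl
            exact hf ⟨rfl, rfl⟩
          rw [rangeProj_cons, mul_assoc, h.star_s_mul_s hne, mul_zero]
        · rw [rangeProj_cons_of_ne hu, zero_mul]

theorem diagonal_mul_wordOp (w : List (E × Bool)) (f : C(Γ.PathSpace S, ℂ)) :
    Φ f * wordOp s w = wordOp s w * Φ (f.comp (actC w)) := by
  induction w generalizing f with
  | nil => rw [wordOp_nil, mul_one, one_mul]; rfl
  | cons l w ih =>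
    rw [wordOp_cons, ← mul_assoc, h.diagonal_mul_letterOp hΦ, mul_assoc, ih, mul_assoc]
    rfl

/-- The covariance of the representation of the diagonal. -/
theorem diagonal_mul_groupOp (g : FreeGroup E) (f : C(Γ.PathSpace S, ℂ)) :
    Φ f * groupOp s g = groupOp s g * Φ (f.comp (gactC g)) :=
  h.diagonal_mul_wordOp hΦ _ f

theorem groupOp_mul_diagonal {g : FreeGroup E} {f : C(Γ.PathSpace S, ℂ)}
    (hf : ∀ a, f a ≠ 0 → gact g a ≠ 0) :
    groupOp s g * Φ f = Φ (f.comp (gactC g⁻¹)) * groupOp s g := by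
  rw [h.diagonal_mul_groupOp hΦ]
  congr 2
  ext a
  change f a = f (gact g⁻¹ (gact g a))
  by_cases ha : gact g a = 0
  · have h0 : ∀ a, gact g a = 0 → f a = 0 := fun a ha => not_ne_iff.1 fun h => hf a h ha
    rw [ha, gact_zero, h0 a ha, h0 0 (gact_zero g)]
  · rw [gact_inv_gact ha]

omit [CompactSpace (Γ.PathSpace S)] in
theorem exists_letterOp_mul (e : E) (b : Bool) :
    ∃ κ, letterOp s (e, b) * letterOp s (e, !b) = Φ (chi κ) ∧
      ∀ a : Γ.PathSpace S, shift (e, !b) a ≠ 0 → a.1 κ := by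
  cases b
  · exact ⟨(Γ.t e, []), (h.initial e).trans (hΦ (Γ.t e, [])).symm, fun a => shift_ne_zero_iff_true.1⟩
  · exact ⟨(Γ.o e, [e]), (h.rangeProj_singleton e).symm.trans (hΦ (Γ.o e, [e])).symm,
      fun a => shift_ne_zero_iff_false.1⟩

/-- Cancelling a pair of inverse letters removes a factor `S_e^* S_e` or `S_e S_e^*`, which is absorbed by
the operator `Φ f` as `f` is supported on the domain of the partial action. -/
theorem wordOp_mul_diagonal_of_red {w w' : List (E × Bool)} (hw : FreeGroup.Red w w')
    {f : C(Γ.PathSpace S, ℂ)} (hf : ∀ a, f a ≠ 0 → PathSpace.act w a ≠ 0) :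
    wordOp s w * Φ f = wordOp s w' * Φ f := by
  induction hw with
  | refl => rfl
  | tail hr hs ih =>
    rw [ih]
    have hf' := fun a ha => (act_red hr (hf a ha)).symm ▸ hf a ha
    cases hs with
    | @not L₁ L₂ e b =>
      obtain ⟨κ, hκ, hmem⟩ := h.exists_letterOp_mul hΦ e b
      rw [wordOp_append, wordOp_cons, wordOp_cons, ← mul_assoc (letterOp s _), hκ,
        h.diagonal_mul_wordOp hΦ, wordOp_append, mul_assoc, mul_assoc (wordOp s L₂), ← map_mul,
        chi_mul_eq_self, mul_assoc]
      intro a ha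
      refine hmem _ fun h0 => hf' a ha ?_
      rw [act_append, act_cons, act_cons]
      rw [show shift (e, !b) (PathSpace.act L₂ a) = 0 from h0, shift_zero, act_zero]

theorem groupOp_mul_groupOp {g k : FreeGroup E} {f : C(Γ.PathSpace S, ℂ)}
    (hf : ∀ a, f a ≠ 0 → gact g (gact k a) ≠ 0) :
    groupOp s g * (groupOp s k * Φ f) = groupOp s (g * k) * Φ f := by
  classical
  rw [groupOp, groupOp, groupOp, ← mul_assoc, ← wordOp_append, FreeGroup.toWord_mul]
  refine h.wordOp_mul_diagonal_of_red hΦ FreeGroup.reduce.red fun a ha => ?_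
  rw [act_append]
  exact hf a ha

omit h hΦ in
/-- If the functions `f_i` satisfy `∑ |f_i|² ≤ M`, then `∑ ‖Φ(f_i)ξ‖² ≤ M‖ξ‖²`. -/
theorem _root_.DirectedGraph.sum_norm_sq_le {X ι : Type*} [TopologicalSpace X] [CompactSpace X]
    (Φ : C(X, ℂ) →⋆ₐ[ℂ] (H →L[ℂ] H)) (F : Finset ι) (f : ι → C(X, ℂ)) {M : ℝ} (hM : 0 ≤ M)
    (hf : ∀ a, ∑ i ∈ F, ‖f i a‖ ^ 2 ≤ M) (ξ : H) : ∑ i ∈ F, ‖Φ (f i) ξ‖ ^ 2 ≤ M * ‖ξ‖ ^ 2 := by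
  let k : C(X, ℂ) := ∑ i ∈ F, star (f i) * f i
  have h1 : ∑ i ∈ F, ‖Φ (f i) ξ‖ ^ 2 = (inner ℂ ξ (Φ k ξ)).re := by
    rw [map_sum, sum_apply, inner_sum, Complex.re_sum]
    refine Finset.sum_congr rfl fun i _ => ?_
    rw [map_mul, map_star, re_inner_star_mul]
  have h2 : ‖k‖ ≤ M := by
    refine (ContinuousMap.norm_le _ hM).2 fun a => ?_
    have h3 : k a = ((∑ i ∈ F, ‖f i a‖ ^ 2 : ℝ) : ℂ) := by
      simp only [k, ContinuousMap.sum_apply, ContinuousMap.mul_apply, ContinuousMap.star_apply]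
      push_cast
      refine Finset.sum_congr rfl fun i _ => ?_
      exact Complex.conj_mul' _
    rw [h3, Complex.norm_real, Real.norm_of_nonneg (Finset.sum_nonneg fun i _ => sq_nonneg _)]
    exact hf a
  rw [h1]
  calc (inner ℂ ξ (Φ k ξ)).re ≤ ‖ξ‖ * ‖Φ k ξ‖ :=
        (Complex.re_le_norm _).trans (norm_inner_le_norm _ _)
    _ ≤ ‖ξ‖ * (M * ‖ξ‖) := by
        gcongr
        refine ((Φ k).le_opNorm ξ).trans ?_
        gcongr
        exact (NonUnitalStarAlgHom.norm_apply_le Φ k).trans h2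
    _ = _ := by ring

omit h hΦ in
/-- A continuous factorization `z = c(z)d(z)` with `|c(z)|² = |d(z)|² = |z|`. -/
theorem _root_.DirectedGraph.exists_sqrt_factorization :
    ∃ c d : C(ℂ, ℂ), ∀ z, c z * d z = z ∧ ‖c z‖ ^ 2 = ‖z‖ ∧ ‖d z‖ ^ 2 = ‖z‖ := by
  have hd : Continuous fun z : ℂ => ((√‖z‖ : ℝ) : ℂ) := by fun_prop
  have hnorm : ∀ z : ℂ, ‖z / ((√‖z‖ : ℝ) : ℂ)‖ = √‖z‖ := fun z => by
    rw [norm_div, Complex.norm_real, Real.norm_of_nonneg (Real.sqrt_nonneg _), Real.div_sqrt]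
  have hc : Continuous fun z : ℂ => z / ((√‖z‖ : ℝ) : ℂ) := by
    rw [continuous_iff_continuousAt]
    intro z
    by_cases hz : z = 0
    · subst hz
      rw [ContinuousAt, zero_div, tendsto_zero_iff_norm_tendsto_zero]
      simp only [hnorm]
      have : Continuous fun z : ℂ => √‖z‖ := by fun_prop
      simpa using this.tendsto 0
    · refine continuousAt_id.div hd.continuousAt ?_
      simpa [Real.sqrt_eq_zero'] using hz
  refine ⟨⟨_, hc⟩, ⟨_, hd⟩, fun z => ⟨?_, ?_, ?_⟩⟩
  · by_cases hz : z = 0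
    · simp [hz]
    · refine div_mul_cancel₀ _ ?_
      simpa [Real.sqrt_eq_zero'] using hz
  · rw [ContinuousMap.coe_mk, hnorm, Real.sq_sqrt (norm_nonneg _)]
  · rw [ContinuousMap.coe_mk, Complex.norm_real, Real.norm_of_nonneg (Real.sqrt_nonneg _),
      Real.sq_sqrt (norm_nonneg _)]

end IsToeplitzFamily

/-- The integrated form `∑ S_g Φ(f(g, ·))` of a representation of the diagonal and of the operators
`S_g` of the elements of the free group.  The sum is finite, as `f` has compact support. -/
def integrated [CompactSpace (Γ.PathSpace S)] (s : E → H →L[ℂ] H)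
    (Φ : C(Γ.PathSpace S, ℂ) →⋆ₐ[ℂ] (H →L[ℂ] H)) (f : C_c(Γ.ToeplitzGroupoid S, ℂ)) : H →L[ℂ] H :=
  ∑ᶠ g, groupOp s g * Φ (hatC f g)

variable [CompactSpace (Γ.PathSpace S)] {Φ : C(Γ.PathSpace S, ℂ) →⋆ₐ[ℂ] (H →L[ℂ] H)}

theorem integrated_eq_sum {f : C_c(Γ.ToeplitzGroupoid S, ℂ)} {F : Finset (FreeGroup E)}
    (hF : Function.support (hatC f) ⊆ F) :
    integrated s Φ f = ∑ g ∈ F, groupOp s g * Φ (hatC f g) := by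
  refine finsum_eq_sum_of_support_subset _ fun g hg => hF fun h0 => hg ?_
  change groupOp s g * Φ (hatC f g) = 0
  rw [h0, map_zero, mul_zero]

theorem integrated_add (f f' : C_c(Γ.ToeplitzGroupoid S, ℂ)) :
    integrated s Φ (f + f') = integrated s Φ f + integrated s Φ f' := by
  classical
  let F := (finite_hatC_support f).toFinset ∪ (finite_hatC_support f').toFinset
  have h1 : Function.support (hatC f) ⊆ F := by simp [F]
  have h2 : Function.support (hatC f') ⊆ F := by simp [F]
  have h3 : Function.support (hatC (f + f')) ⊆ F := by
    rw [hatC_add]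
    exact (Function.support_add _ _).trans (Set.union_subset h1 h2)
  rw [integrated_eq_sum h1, integrated_eq_sum h2, integrated_eq_sum h3, ← Finset.sum_add_distrib]
  refine Finset.sum_congr rfl fun g _ => ?_
  rw [hatC_add, Pi.add_apply, map_add, mul_add]

theorem integrated_smul (c : ℂ) (f : C_c(Γ.ToeplitzGroupoid S, ℂ)) :
    integrated s Φ (c • f) = c • integrated s Φ f := by
  have h1 : Function.support (hatC f) ⊆ (finite_hatC_support f).toFinset := by simp
  have h3 : Function.support (hatC (c • f)) ⊆ (finite_hatC_support f).toFinset := by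
    rw [hatC_smul]
    exact (Function.support_const_smul_subset _ _).trans h1
  rw [integrated_eq_sum h1, integrated_eq_sum h3, Finset.smul_sum]
  refine Finset.sum_congr rfl fun g _ => ?_
  rw [hatC_smul, Pi.smul_apply, map_smul, mul_smul_comm]

namespace IsToeplitzFamily

variable (h : Γ.IsToeplitzFamily S s p) (hΦ : ∀ κ, Φ (chi κ) = Γ.rangeProj s p κ.1 κ.2)

include h hΦ

theorem integrated_conv {f f' f'' : C_c(Γ.ToeplitzGroupoid S, ℂ)}
    (hf : (f'' : Γ.ToeplitzGroupoid S → ℂ) = conv f f') :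
    integrated s Φ f'' = integrated s Φ f * integrated s Φ f' := by
  have h1 : Function.support (hatC f) ⊆ (finite_hatC_support f).toFinset := by simp
  have h2 : Function.support (hatC f') ⊆ (finite_hatC_support f').toFinset := by simp
  have h3 : ∀ g, hatC f'' g = ∑ k ∈ (finite_hatC_support f').toFinset,
      (hatC f (g * k⁻¹)).comp (gactC k) * hatC f' k := by
    intro g
    ext a
    rw [hatC_apply, hf, hat_conv, ContinuousMap.sum_apply]
    refine finsum_eq_sum_of_support_subset _ fun k hk => ?_
    rw [Set.Finite.coe_toFinset]
    exact fun h0 => right_ne_zero_of_mul hk (DFunLike.congr_fun h0 a)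
  have hfin : ∀ k, (Function.support fun g =>
      groupOp s g * Φ ((hatC f (g * k⁻¹)).comp (gactC k) * hatC f' k)).Finite := by
    intro k
    refine ((finite_hatC_support f).image (· * k)).subset fun g hg => ?_
    refine ⟨g * k⁻¹, fun h0 => hg ?_, by simp⟩
    change groupOp s g * Φ ((hatC f (g * k⁻¹)).comp (gactC k) * hatC f' k) = 0
    rw [h0, ContinuousMap.zero_comp, zero_mul, map_zero, mul_zero]
  rw [integrated_eq_sum h1, integrated_eq_sum h2, integrated, Finset.sum_mul_sum, Finset.sum_comm]
  simp_rw [h3, map_sum, Finset.mul_sum]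
  rw [finsum_sum_comm _ _ fun k _ => hfin k]
  refine Finset.sum_congr rfl fun k _ => ?_
  rw [← finsum_comp_equiv (Equiv.mulRight k)]
  rw [finsum_eq_sum_of_support_subset (s := (finite_hatC_support f).toFinset)]
  · refine Finset.sum_congr rfl fun g _ => ?_
    rw [Equiv.coe_mulRight, mul_inv_cancel_right, mul_assoc, ← mul_assoc (Φ _),
      h.diagonal_mul_groupOp hΦ, mul_assoc, ← map_mul, h.groupOp_mul_groupOp hΦ]
    exact fun a ha => gact_ne_zero_of_hat (left_ne_zero_of_mul ha)
  · intro g hg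
    refine h1 fun h0 => hg ?_
    beta_reduce
    rw [Equiv.coe_mulRight, mul_inv_cancel_right, h0, ContinuousMap.zero_comp, zero_mul, map_zero,
      mul_zero]

theorem integrated_invol {f f' : C_c(Γ.ToeplitzGroupoid S, ℂ)}
    (hf : (f' : Γ.ToeplitzGroupoid S → ℂ) = invol f) :
    integrated s Φ f' = star (integrated s Φ f) := by
  have h1 : Function.support (hatC f) ⊆ (finite_hatC_support f).toFinset := by simp
  have h2 : ∀ g, hatC f' g⁻¹ = (star (hatC f g)).comp (gactC g⁻¹) := by
    intro g
    ext a
    rw [hatC_apply, hf, hat_invol, inv_inv]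
    rfl
  have h3 : ∀ g, groupOp s g⁻¹ * Φ (hatC f' g⁻¹) = star (groupOp s g * Φ (hatC f g)) := by
    intro g
    rw [h2, ← h.diagonal_mul_groupOp hΦ, star_mul, star_groupOp, map_star]
  rw [integrated_eq_sum h1, integrated, ← finsum_comp_equiv (Equiv.inv (FreeGroup E)), star_sum]
  simp_rw [Equiv.inv_apply, h3]
  refine finsum_eq_sum_of_support_subset _ fun g hg => h1 fun h0 => hg ?_
  change star (groupOp s g * Φ (hatC f g)) = 0
  rw [h0, map_zero, mul_zero, star_zero]

/-- The integrated form is bounded by the `I`-norm.  With `f(g, ·) = c_g d_g` and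
`|c_g|² = |d_g|² = |f(g, ·)|`, the form `⟨∑ S_g Φ(c_g d_g)ξ, η⟩` is the sum of the terms
`⟨S_g Φ(d_g)ξ, Φ(c_g ∘ g⁻¹)^* η⟩`.  The sums of squares of `Φ(d_g)ξ` and of `Φ(c_g ∘ g⁻¹)^* η` are bounded
by the suprema of the sums of `|f|` over the sources and over the ranges, so that the
Cauchy-Schwarz inequality applies. -/
theorem norm_integrated_le (f : C_c(Γ.ToeplitzGroupoid S, ℂ)) :
    ‖integrated s Φ f‖ ≤ inorm f := by
  obtain ⟨c, d, hcd⟩ := exists_sqrt_factorization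
  have hM := inorm_nonneg (f : Γ.ToeplitzGroupoid S → ℂ)
  let F := (finite_hatC_support f).toFinset
  have h1 : Function.support (hatC f) ⊆ F := by simp [F]
  have hz : ∀ g ∉ F, ∀ a, hat f g a = 0 := fun g hg a =>
    DFunLike.congr_fun (not_ne_iff.1 fun h0 => hg (h1 h0) : hatC f g = 0) a
  have hd : ∀ a, ∑ g ∈ F, ‖(d.comp (hatC f g)) a‖ ^ 2 ≤ inorm f := by
    intro a
    refine le_trans (le_of_eq ?_) (finsum_norm_hat_le_inorm f a)
    rw [finsum_eq_sum_of_support_subset (s := F)]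
    · exact Finset.sum_congr rfl fun g _ => (hcd _).2.2
    · intro g hg
      by_contra hgF
      exact hg (by simp [hz g hgF])
  have hc : ∀ a, ∑ g ∈ F, ‖star ((c.comp (hatC f g)).comp (gactC g⁻¹)) a‖ ^ 2 ≤ inorm f := by
    intro a
    refine le_trans (le_of_eq ?_) (finsum_norm_hat_invol_le_inorm f a)
    rw [← finsum_comp_equiv (Equiv.inv (FreeGroup E)), finsum_eq_sum_of_support_subset (s := F)]
    · refine Finset.sum_congr rfl fun g _ => ?_
      rw [ContinuousMap.star_apply, norm_star, Equiv.inv_apply, hat_invol, inv_inv, norm_star]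
      exact (hcd _).2.1
    · intro g hg
      by_contra hgF
      exact hg (by simp [hat_invol, hz g hgF])
  refine ContinuousLinearMap.opNorm_le_of_re_inner_le hM fun ξ η hξ1 hη1 => ?_
  have hterm : ∀ g, (inner ℂ ((groupOp s g * Φ (hatC f g)) ξ) η).re ≤
      ‖Φ (star ((c.comp (hatC f g)).comp (gactC g⁻¹))) η‖ * ‖Φ (d.comp (hatC f g)) ξ‖ := by
    intro g
    have hfac : hatC f g = c.comp (hatC f g) * d.comp (hatC f g) := by
      ext a
      exact (hcd _).1.symm
    have hsupp : ∀ a, c.comp (hatC f g) a ≠ 0 → gact g a ≠ 0 := fun a ha => by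
      refine gact_ne_zero_of_hat (f := f) fun h0 => ha ?_
      have h2 := (hcd 0).2.1
      rw [norm_zero, sq_eq_zero_iff, norm_eq_zero] at h2
      rw [ContinuousMap.comp_apply, hatC_apply, h0, h2]
    rw [hfac, map_mul, ← mul_assoc, h.groupOp_mul_diagonal hΦ hsupp, ← hfac, mul_assoc,
      mul_apply_eq_comp, ← ContinuousLinearMap.adjoint_inner_right,
      ← ContinuousLinearMap.star_eq_adjoint, ← map_star, mul_apply_eq_comp]
    refine (Complex.re_le_norm _).trans ((norm_inner_le_norm _ _).trans ?_)
    rw [mul_comm]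
    gcongr
    exact h.norm_groupOp_le g _
  have hsum := Finset.sum_le_sum fun g (_ : g ∈ F) => hterm g
  have hη := sum_norm_sq_le Φ F _ hM hc η
  have hξ := sum_norm_sq_le Φ F _ hM hd ξ
  rw [integrated_eq_sum h1, sum_apply, sum_inner]
  refine le_trans (le_of_eq (map_sum Complex.reAddGroupHom _ _)) (hsum.trans ?_)
  rw [hη1, one_pow, mul_one] at hη
  rw [hξ1, one_pow, mul_one] at hξ
  refine le_of_sq_le_sq ((Finset.sum_mul_sq_le_sq_mul_sq _ _ _).trans ?_) hM
  rw [sq (inorm f)]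
  gcongr

theorem integrated_single_of (e : E) :
    integrated s Φ (single (FreeGroup.of e) (Γ.t e) 1) = s e := by
  classical
  have h1 : ∀ g, hatC (single (FreeGroup.of e) (Γ.t e) 1 : C_c(Γ.ToeplitzGroupoid S, ℂ)) g =
      if g = FreeGroup.of e then chi (Γ.t e, []) else 0 := by
    intro g
    ext a
    rw [hatC_apply, hat_single]
    simp only [gact_of, shift_ne_zero_iff_true]
    by_cases hg : g = FreeGroup.of e <;> by_cases ha : a.1 (Γ.t e, []) <;>
      simp [hg, ha, chi_of_mem, chi_of_notMem]
  rw [integrated_eq_sum (F := {FreeGroup.of e}), Finset.sum_singleton, h1, if_pos rfl, hΦ,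
    groupOp_of]
  · exact h.s_mul_p e
  · intro g hg
    by_contra hne
    exact hg (by rw [h1, if_neg (by simpa using hne)])

omit h in
theorem integrated_single_one (u : V) : integrated s Φ (single 1 u 1) = p u := by
  classical
  have h1 : ∀ g, hatC (single 1 u 1 : C_c(Γ.ToeplitzGroupoid S, ℂ)) g =
      if g = 1 then chi (u, []) else 0 := by
    intro g
    ext a
    rw [hatC_apply, hat_single, gact_one]
    by_cases hg : g = 1 <;> by_cases ha : a.1 (u, []) <;>
      simp [hg, ha, chi_of_mem, chi_of_notMem]
    exact fun h0 => absurd ha (by rw [h0]; exact not_zero_apply _)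
  rw [integrated_eq_sum (F := {1}), Finset.sum_singleton, h1, if_pos rfl, hΦ, groupOp_one, one_mul]
  · rfl
  · intro g hg
    by_contra hne
    exact hg (by rw [h1, if_neg (by simpa using hne)])

end IsToeplitzFamily

end Rep

/-! ### Cyclic subspaces and the universal norm -/

section Universal

universe u v w

/-- The closure of the range of a map defined on a small set is small. -/
theorem small_closure_range {ι : Type v} {X : Type w} [TopologicalSpace X] [FrechetUrysohnSpace X]
    [T2Space X] [Small.{u} ι] (f : ι → X) : Small.{u} (closure (Set.range f)) := by
  classical
  let F : {σ : ℕ → ι // ∃ x, Filter.Tendsto (fun n => f (σ n)) Filter.atTop (nhds x)} →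
      closure (Set.range f) := fun σ => ⟨σ.2.choose,
    mem_closure_of_tendsto σ.2.choose_spec (Filter.Eventually.of_forall fun n => ⟨_, rfl⟩)⟩
  refine small_of_surjective (f := F) ?_
  rintro ⟨x, hx⟩
  obtain ⟨y, hy, hlim⟩ := mem_closure_iff_seq_limit.1 hx
  choose σ hσ using hy
  have hσ' : Filter.Tendsto (fun n => f (σ n)) Filter.atTop (nhds x) := by simpa only [hσ]
  exact ⟨⟨σ, x, hσ'⟩, Subtype.ext (tendsto_nhds_unique (Exists.choose_spec (⟨x, hσ'⟩ :
    ∃ x, Filter.Tendsto (fun n => f (σ n)) Filter.atTop (nhds x))) hσ')⟩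

/-- A small Hilbert space is isometric to a Hilbert space in the smaller universe. -/
theorem exists_linearIsometryEquiv_of_small (K : Type w) [NormedAddCommGroup K]
    [InnerProductSpace ℂ K] [CompleteSpace K] [Small.{u} K] :
    ∃ ι : Type u, Nonempty (lp (fun _ : ι => ℂ) 2 ≃ₗᵢ[ℂ] K) := by
  obtain ⟨B, b, -⟩ := exists_hilbertBasis ℂ K
  let e : Shrink.{u} B ≃ B := (equivShrink B).symm
  let b' : HilbertBasis (Shrink.{u} B) ℂ K := HilbertBasis.mk (b.orthonormal.comp e e.injective) (by
    rw [e.surjective.range_comp, b.dense_span])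
  exact ⟨_, ⟨b'.repr.symm⟩⟩

variable {V : Type u} {E : Type v} {Γ : DirectedGraph V E} {S : Set V}
variable {H : Type w} [NormedAddCommGroup H] [InnerProductSpace ℂ H] [CompleteSpace H]

open ToeplitzGroupoid

/-- A bounded `*`-representation of the convolution algebra on a Hilbert space in an arbitrary
universe. -/
structure IsCcRep (ρ : C_c(Γ.ToeplitzGroupoid S, ℂ) →ₗ[ℂ] (H →L[ℂ] H)) : Prop where
  map_conv : ∀ f g h : C_c(Γ.ToeplitzGroupoid S, ℂ),
    (h : Γ.ToeplitzGroupoid S → ℂ) = conv f g → ρ h = ρ f * ρ g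
  map_invol : ∀ f h : C_c(Γ.ToeplitzGroupoid S, ℂ),
    (h : Γ.ToeplitzGroupoid S → ℂ) = invol f → ρ h = star (ρ f)
  bounded : ∀ f, ‖ρ f‖ ≤ inorm f

/-- The compression of a representation to the range of an isometry, provided that this range is
invariant. -/
def IsCcRep.compress {ρ : C_c(Γ.ToeplitzGroupoid S, ℂ) →ₗ[ℂ] (H →L[ℂ] H)} (hρ : IsCcRep ρ)
    {L : Type (max u v)} [NormedAddCommGroup L] [InnerProductSpace ℂ L] [CompleteSpace L]
    (A : L →ₗᵢ[ℂ] H) (hA : ∀ f x, ∃ y, A y = ρ f (A x)) : Γ.CcRep S where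
  H := L
  toLin :=
    { toFun := fun f => (ContinuousLinearMap.adjoint A.toContinuousLinearMap) ∘L ρ f ∘L
        A.toContinuousLinearMap
      map_add' := fun f g => by ext; simp
      map_smul' := fun c f => by ext; simp }
  map_conv f g h hh := by
    ext x
    obtain ⟨y, hy⟩ := hA g x
    have h1 := DFunLike.congr_fun A.adjoint_comp_self y
    simp only [LinearMap.coe_mk, AddHom.coe_mk, mul_apply_eq_comp, hρ.map_conv f g h hh,
      ContinuousLinearMap.comp_apply, LinearIsometry.coe_toContinuousLinearMap] at h1 ⊢
    rw [← hy, h1]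
    rfl
  map_invol f h hh := by
    simp only [LinearMap.coe_mk, AddHom.coe_mk, hρ.map_invol f h hh,
      ContinuousLinearMap.star_eq_adjoint, ContinuousLinearMap.adjoint_comp,
      ContinuousLinearMap.adjoint_adjoint, ContinuousLinearMap.comp_assoc]
  bounded f := by
    refine ContinuousLinearMap.opNorm_le_bound _ (inorm_nonneg _) fun x => ?_
    have h1 : ‖ContinuousLinearMap.adjoint A.toContinuousLinearMap‖ ≤ 1 := by
      rw [LinearIsometryEquiv.norm_map]
      exact A.norm_toContinuousLinearMap_le
    refine ((ContinuousLinearMap.adjoint A.toContinuousLinearMap).le_of_opNorm_le h1 _).trans ?_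
    rw [one_mul]
    refine ((ρ f).le_of_opNorm_le (hρ.bounded f) _).trans_eq ?_
    exact congrArg _ (A.norm_map x)

/-- The universal norm is a supremum over Hilbert spaces in one universe.  It nevertheless dominates
the norm of a representation on an arbitrary Hilbert space: for a given vector, only the smallest
closed invariant subspace containing it matters, and this is isometric to an `ℓ²` space in the universe of
the groupoid. -/
theorem IsCcRep.norm_le [CompactSpace (Γ.PathSpace S)]
    {ρ : C_c(Γ.ToeplitzGroupoid S, ℂ) →ₗ[ℂ] (H →L[ℂ] H)} (hρ : IsCcRep ρ)
    (f : C_c(Γ.ToeplitzGroupoid S, ℂ)) : ‖ρ f‖ ≤ ‖Γ.universalRep S f‖ := by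
  refine ContinuousLinearMap.opNorm_le_bound _ (norm_nonneg _) fun ξ => ?_
  -- The range of `N` is spanned by `ξ` and its orbit.  The summand `ℂξ` is needed as the
  -- representation may be degenerate.
  let N : ℂ × C_c(Γ.ToeplitzGroupoid S, ℂ) →ₗ[ℂ] H :=
    (LinearMap.toSpanSingleton ℂ H ξ).coprod ((ContinuousLinearMap.apply ℂ H ξ).toLinearMap ∘ₗ ρ)
  have hN : ∀ z, N z = z.1 • ξ + ρ z.2 ξ := fun z => by simp [N]
  let K : Submodule ℂ H := (LinearMap.range N).topologicalClosure
  have hK : (K : Set H) = closure (Set.range N) := by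
    rw [Submodule.topologicalClosure_coe, LinearMap.coe_range]
  have hinv : ∀ f, ∀ y ∈ K, ρ f y ∈ K := by
    intro f y hy
    rw [← SetLike.mem_coe, hK] at hy ⊢
    refine map_mem_closure (ρ f).continuous hy ?_
    rintro _ ⟨z, rfl⟩
    refine ⟨(0, z.1 • f + convC f z.2), ?_⟩
    rw [hN, hN, map_add, map_add, map_smul, map_smul, hρ.map_conv f z.2 _ (coe_convC _ _)]
    simp
  have hξ : ξ ∈ K := Submodule.le_topologicalClosure _ ⟨(1, 0), by simp [hN]⟩
  have hcomplete : CompleteSpace K :=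
    (Submodule.isClosed_topologicalClosure _).completeSpace_coe
  have hsmall : Small.{max u v} K := by
    have := small_closure_range.{max u v} N
    rw [← hK] at this
    exact this
  obtain ⟨ι, ⟨U⟩⟩ := exists_linearIsometryEquiv_of_small.{max u v} K
  let A : lp (fun _ : ι => ℂ) 2 →ₗᵢ[ℂ] H := K.subtypeₗᵢ.comp U.toLinearIsometry
  have hA : ∀ y : K, A (U.symm y) = y := fun y => congrArg Subtype.val (U.apply_symm_apply y)
  have hAK : ∀ x, A x ∈ K := fun x => (U x).2
  let π : Γ.CcRep S := hρ.compress A fun f x => ⟨U.symm ⟨_, hinv f _ (hAK x)⟩, hA _⟩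
  -- On the invariant subspace the compression is the representation itself.
  have h1 : ‖π.toLin f (U.symm ⟨ξ, hξ⟩)‖ = ‖ρ f ξ‖ := by
    change ‖ContinuousLinearMap.adjoint A.toContinuousLinearMap (ρ f (A (U.symm ⟨ξ, hξ⟩)))‖ = _
    rw [hA]
    change ‖ContinuousLinearMap.adjoint A.toContinuousLinearMap (ρ f ξ)‖ = _
    have h2 := DFunLike.congr_fun A.adjoint_comp_self (U.symm ⟨ρ f ξ, hinv f ξ hξ⟩)
    rw [ContinuousLinearMap.comp_apply, LinearIsometry.coe_toContinuousLinearMap, hA] at h2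
    rw [h2]
    exact U.symm.norm_map _
  rw [← h1]
  have h3 : ‖U.symm ⟨ξ, hξ⟩‖ = ‖ξ‖ := U.symm.norm_map _
  exact (ContinuousLinearMap.le_of_opNorm_le (π.toLin f)
    (lp.norm_apply_le_norm ENNReal.top_ne_zero (Γ.universalRep S f) π) _).trans_eq
      (congrArg _ h3)

/-! ### The convolution algebra is dense in the Toeplitz graph algebra -/

-- The C*-algebra structure, with shortcuts to weaker structures.  The instances are scoped so that the
-- statement of the theorem elaborates without them.

scoped instance : NonUnitalCStarAlgebra (lp (fun π : Γ.CcRep S => π.H →L[ℂ] π.H) ∞) := inferInstance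

scoped instance : IsClosed (Γ.toeplitzAlgebra S : Set (lp (fun π : Γ.CcRep S => π.H →L[ℂ] π.H) ∞)) :=
  NonUnitalStarSubalgebra.isClosed_topologicalClosure _

scoped instance : NonUnitalCStarAlgebra (Γ.toeplitzAlgebra S) :=
  NonUnitalStarSubalgebra.nonUnitalCStarAlgebra (Γ.toeplitzAlgebra S)

scoped instance : NonUnitalNonAssocSemiring (Γ.toeplitzAlgebra S) :=
  NonUnitalNonAssocRing.toNonUnitalNonAssocSemiring

scoped instance : Zero (Γ.toeplitzAlgebra S) := MulZeroClass.toZero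

scoped instance : NonUnitalNormedRing (Γ.toeplitzAlgebra S) :=
  NonUnitalCStarAlgebra.toNonUnitalNormedRing

scoped instance : ContinuousMul (Γ.toeplitzAlgebra S) := NonUnitalSeminormedRing.toContinuousMul

scoped instance : ContinuousStar (Γ.toeplitzAlgebra S) := NormedStarGroup.to_continuousStar

scoped instance : Module ℂ (Γ.toeplitzAlgebra S) := NonUnitalStarSubalgebra.instModule _

scoped instance : SMul ℂ (Γ.toeplitzAlgebra S) := Module.toDistribMulAction.toSMul

theorem toToeplitzAlgebra_add (f g : C_c(Γ.ToeplitzGroupoid S, ℂ)) :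
    Γ.toToeplitzAlgebra (f + g) = Γ.toToeplitzAlgebra f + Γ.toToeplitzAlgebra g :=
  Subtype.ext (Subtype.ext (funext fun π => map_add π.toLin f g))

theorem toToeplitzAlgebra_smul (c : ℂ) (f : C_c(Γ.ToeplitzGroupoid S, ℂ)) :
    Γ.toToeplitzAlgebra (c • f) = c • Γ.toToeplitzAlgebra f :=
  Subtype.ext (Subtype.ext (funext fun π => map_smul π.toLin c f))

theorem toToeplitzAlgebra_conv {f g h : C_c(Γ.ToeplitzGroupoid S, ℂ)}
    (hh : (h : Γ.ToeplitzGroupoid S → ℂ) = conv f g) :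
    Γ.toToeplitzAlgebra h = Γ.toToeplitzAlgebra f * Γ.toToeplitzAlgebra g :=
  Subtype.ext (Subtype.ext (funext fun π => π.map_conv f g h hh))

theorem toToeplitzAlgebra_invol {f h : C_c(Γ.ToeplitzGroupoid S, ℂ)}
    (hh : (h : Γ.ToeplitzGroupoid S → ℂ) = invol f) :
    Γ.toToeplitzAlgebra h = star (Γ.toToeplitzAlgebra f) :=
  Subtype.ext (Subtype.ext (funext fun π => π.map_invol f h hh))

/-- The canonical map of the convolution algebra into the Toeplitz graph algebra, as a linear
map. -/
def toToeplitzAlgebraₗ : C_c(Γ.ToeplitzGroupoid S, ℂ) →ₗ[ℂ] Γ.toeplitzAlgebra S where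
  toFun := Γ.toToeplitzAlgebra
  map_add' := toToeplitzAlgebra_add
  map_smul' := toToeplitzAlgebra_smul

theorem denseRange_toToeplitzAlgebra [CompactSpace (Γ.PathSpace S)] :
    DenseRange (Γ.toToeplitzAlgebra : C_c(Γ.ToeplitzGroupoid S, ℂ) → Γ.toeplitzAlgebra S) := by
  let R : NonUnitalStarSubalgebra ℂ (lp (fun π : Γ.CcRep S => π.H →L[ℂ] π.H) ∞) :=
    { carrier := Set.range (Γ.universalRep S)
      add_mem' := by
        rintro _ _ ⟨f, rfl⟩ ⟨g, rfl⟩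
        exact ⟨f + g, congrArg Subtype.val (toToeplitzAlgebra_add f g)⟩
      zero_mem' := ⟨0, congrArg Subtype.val (map_zero (toToeplitzAlgebraₗ (Γ := Γ) (S := S)))⟩
      smul_mem' := by
        rintro c _ ⟨f, rfl⟩
        exact ⟨c • f, congrArg Subtype.val (toToeplitzAlgebra_smul c f)⟩
      mul_mem' := by
        rintro _ _ ⟨f, rfl⟩ ⟨g, rfl⟩
        exact ⟨convC f g, congrArg Subtype.val (toToeplitzAlgebra_conv (coe_convC f g))⟩
      star_mem' := by
        rintro _ ⟨f, rfl⟩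
        exact ⟨involC f, congrArg Subtype.val (toToeplitzAlgebra_invol (coe_involC f))⟩ }
  have hR : NonUnitalStarAlgebra.adjoin ℂ (Set.range (Γ.universalRep S)) = R :=
    le_antisymm (NonUnitalStarAlgebra.adjoin_le le_rfl) (NonUnitalStarAlgebra.subset_adjoin ℂ _)
  rintro ⟨a, ha⟩
  rw [closure_subtype, ← Set.range_comp]
  rw [toeplitzAlgebra, hR] at ha
  exact ha

/-- A bounded representation of the convolution algebra extends to the Toeplitz graph algebra. -/
theorem IsCcRep.exists_extension [CompactSpace (Γ.PathSpace S)]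
    {ρ : C_c(Γ.ToeplitzGroupoid S, ℂ) →ₗ[ℂ] (H →L[ℂ] H)} (hρ : IsCcRep ρ) :
    ∃ π : Γ.toeplitzAlgebra S →⋆ₙₐ[ℂ] (H →L[ℂ] H), ∀ f, π (Γ.toToeplitzAlgebra f) = ρ f := by
  have hd : DenseRange (toToeplitzAlgebraₗ (Γ := Γ) (S := S)) := denseRange_toToeplitzAlgebra
  let T : Γ.toeplitzAlgebra S →L[ℂ] (H →L[ℂ] H) := ρ.extendOfNorm toToeplitzAlgebraₗ
  have hT : ∀ f, T (Γ.toToeplitzAlgebra f) = ρ f := fun f =>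
    LinearMap.extendOfNorm_eq hd ⟨1, fun f => (hρ.norm_le f).trans_eq (one_mul _).symm⟩ f
  refine ⟨{ T with
    map_smul' := T.map_smul
    map_zero' := T.map_zero
    map_mul' := ?_
    map_star' := ?_ }, hT⟩
  · refine hd.induction_on₂ (isClosed_eq ?_ ?_) fun f g => ?_
    · exact T.continuous.comp continuous_mul
    · exact (T.continuous.comp continuous_fst).mul (T.continuous.comp continuous_snd)
    · change T (Γ.toToeplitzAlgebra f * Γ.toToeplitzAlgebra g) =
        T (Γ.toToeplitzAlgebra f) * T (Γ.toToeplitzAlgebra g)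
      rw [← toToeplitzAlgebra_conv (coe_convC f g), hT, hT, hT, hρ.map_conv f g _ (coe_convC f g)]
  · refine fun a => isClosed_property (p := fun a => T (star a) = star (T a)) hd
      (isClosed_eq ?_ ?_) (fun f => ?_) a
    · exact T.continuous.comp continuous_star
    · exact T.continuous.star
    · change T (star (Γ.toToeplitzAlgebra f)) = star (T (Γ.toToeplitzAlgebra f))
      rw [← toToeplitzAlgebra_invol (coe_involC f), hT, hT, hρ.map_invol f _ (coe_involC f)]

/-- A Toeplitz family is the image of the generators under a nondegenerate representation of the
Toeplitz graph algebra. -/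
theorem IsToeplitzFamily.exists_representation [CompactSpace (Γ.PathSpace S)]
    (hS : S ⊆ Γ.regular) {s : E → H →L[ℂ] H} {p : V → H →L[ℂ] H} (h : Γ.IsToeplitzFamily S s p) :
    ∃ π : Γ.toeplitzAlgebra S →⋆ₙₐ[ℂ] (H →L[ℂ] H), Nondegenerate π ∧
      (∀ e, π (Γ.toToeplitzAlgebra (single (FreeGroup.of e) (Γ.t e) 1)) = s e) ∧
      ∀ u, π (Γ.toToeplitzAlgebra (single 1 u 1)) = p u := by
  obtain ⟨Φ, hΦ⟩ := h.exists_diagonal hS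
  let ρ : C_c(Γ.ToeplitzGroupoid S, ℂ) →ₗ[ℂ] (H →L[ℂ] H) :=
    { toFun := integrated s Φ
      map_add' := integrated_add
      map_smul' := integrated_smul }
  have hρ : IsCcRep ρ := ⟨fun f g k hk => h.integrated_conv hΦ hk,
    fun f k hk => h.integrated_invol hΦ hk, h.norm_integrated_le hΦ⟩
  obtain ⟨π, hπ⟩ := hρ.exists_extension
  have hp : ∀ u, π (Γ.toToeplitzAlgebra (single 1 u 1)) = p u := fun u =>
    (hπ _).trans (integrated_single_one hΦ u)
  refine ⟨π, ?_, fun e => (hπ _).trans (h.integrated_single_of hΦ e), hp⟩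
  refine Submodule.eq_top_iff'.2 fun ξ => ?_
  refine (Submodule.isClosed_topologicalClosure _).mem_of_tendsto (h.sum_eq_one ξ)
    (Filter.Eventually.of_forall fun F => ?_)
  refine Submodule.le_topologicalClosure _ (Submodule.sum_mem _ fun u _ => ?_)
  exact Submodule.subset_span ⟨_, ξ, by rw [hp]⟩

end Universal

/-! ### The generators of the Toeplitz graph algebra -/

section Generators

universe u v
variable {V : Type u} {E : Type v} {Γ : DirectedGraph V E} {S : Set V}
  [CompactSpace (Γ.PathSpace S)]

open ToeplitzGroupoid PathSpace

omit [CompactSpace (Γ.PathSpace S)] in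
open Classical in
theorem chi_apply (κ : V × List E) (a : Γ.PathSpace S) :
    (chi κ : C(Γ.PathSpace S, ℂ)) a = if a.1 κ then 1 else 0 := rfl

/-- The image of the function `single g s h` in the Toeplitz graph algebra. -/
def gen (g : FreeGroup E) (s : V) (h : C(Γ.PathSpace S, ℂ)) : Γ.toeplitzAlgebra S :=
  Γ.toToeplitzAlgebra (single g s h)

theorem gen_congr {g : FreeGroup E} {s s' : V} {h h' : C(Γ.PathSpace S, ℂ)}
    (hh : ∀ a, gact g a ≠ 0 → chi (s, []) a * h a = chi (s', []) a * h' a) :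
    gen g s h = gen g s' h' := by
  classical
  refine congrArg Γ.toToeplitzAlgebra (DFunLike.coe_injective (ext_hat fun g' a => ?_))
  rw [hat_single, hat_single]
  split_ifs with ha
  · exact hh a ha.2
  · rfl

theorem gen_add (g : FreeGroup E) (s : V) (h h' : C(Γ.PathSpace S, ℂ)) :
    gen g s (h + h') = gen g s h + gen g s h' := by
  classical
  rw [gen, gen, gen, ← toToeplitzAlgebra_add]
  refine congrArg Γ.toToeplitzAlgebra (DFunLike.coe_injective (ext_hat fun g' a => ?_))
  rw [CompactlySupportedContinuousMap.coe_add, hat_add, hat_single, hat_single, hat_single]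
  split_ifs
  · exact mul_add _ _ _
  · exact (add_zero _).symm

theorem gen_smul (g : FreeGroup E) (s : V) (c : ℂ) (h : C(Γ.PathSpace S, ℂ)) :
    gen g s (c • h) = c • gen g s h := by
  classical
  rw [gen, gen, ← toToeplitzAlgebra_smul]
  refine congrArg Γ.toToeplitzAlgebra (DFunLike.coe_injective (ext_hat fun g' a => ?_))
  rw [CompactlySupportedContinuousMap.coe_smul, hat_smul, hat_single, hat_single]
  split_ifs
  · exact mul_left_comm _ _ _
  · exact (mul_zero _).symm

theorem gen_zero (g : FreeGroup E) (s : V) : gen g s (0 : C(Γ.PathSpace S, ℂ)) = 0 := by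
  have := gen_smul g s 0 (0 : C(Γ.PathSpace S, ℂ))
  rwa [zero_smul, zero_smul] at this

/-- The product of two generators, where the second hypothesis takes account of the fact that
`gk` may have a larger domain than the composition of the partial actions of `g` and `k`. -/
theorem gen_mul {g k : FreeGroup E} {s s' s'' : V} {h h' h'' : C(Γ.PathSpace S, ℂ)}
    (h1 : ∀ a, gact g (gact k a) ≠ 0 →
      chi (s, []) (gact k a) * h (gact k a) * (chi (s', []) a * h' a) = chi (s'', []) a * h'' a)
    (h2 : ∀ a, gact (g * k) a ≠ 0 → gact g (gact k a) = 0 → chi (s'', []) a * h'' a = 0) :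
    gen g s h * gen k s' h' = gen (g * k) s'' h'' := by
  classical
  refine (toToeplitzAlgebra_conv (ext_hat fun g' a => ?_)).symm
  rw [hat_conv, finsum_eq_single _ k, hat_single, hat_single, hat_single]
  · simp only [mul_inv_eq_iff_eq_mul]
    by_cases hg : g' = g * k
    · by_cases ha : gact g (gact k a) = 0
      · by_cases hc : gact (g * k) a = 0
        · simp [ha, hc]
        · simp [ha, h2 a hc ha]
      · have hc : gact (g * k) a ≠ 0 := by rwa [gact_mul ha]
        have hk : gact k a ≠ 0 := ne_zero_of_gact ha
        simp [hg, ha, hc, hk, ← h1 a ha]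
    · simp [hg]
  · intro k' hk'
    rw [hat_single _ _ _ k' a, if_neg (fun h => hk' h.1), mul_zero]

theorem star_gen {g : FreeGroup E} {s s' : V} {h h' : C(Γ.PathSpace S, ℂ)}
    (hh : ∀ a, gact g⁻¹ a ≠ 0 → star (chi (s, []) (gact g⁻¹ a) * h (gact g⁻¹ a)) =
      chi (s', []) a * h' a) : star (gen g s h) = gen g⁻¹ s' h' := by
  classical
  refine (toToeplitzAlgebra_invol (ext_hat fun g' a => ?_)).symm
  rw [hat_invol, hat_single, hat_single]
  by_cases hg : g' = g⁻¹
  · subst hg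
    by_cases ha : gact g⁻¹ a = 0
    · simp [ha, gact_zero]
    · have h2 : gact g (gact g⁻¹ a) ≠ 0 := by
        have := gact_inv_gact ha
        rw [inv_inv] at this
        rw [this]
        exact ne_zero_of_gact ha
      rw [inv_inv, if_pos ⟨rfl, ha⟩, if_pos ⟨rfl, h2⟩, hh a ha]
  · have : g'⁻¹ ≠ g := fun h => hg (by rw [← h, inv_inv])
    simp [hg, this]

/-- The partial isometry of an edge. -/
def genEdge (e : E) : Γ.toeplitzAlgebra S := gen (FreeGroup.of e) (Γ.t e) 1

/-- The projection of a vertex. -/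
def genVertex (u : V) : Γ.toeplitzAlgebra S := gen 1 u 1

theorem star_genEdge (e : E) :
    star (genEdge e : Γ.toeplitzAlgebra S) = gen (FreeGroup.of e)⁻¹ (Γ.o e) 1 := by
  refine star_gen fun a ha => ?_
  rw [gact_of_inv] at ha ⊢
  rw [shift_ne_zero_iff_false] at ha
  rw [chi_of_mem (shift_false.2 ⟨rfl, ha⟩), chi_of_mem (a.2.nil_mem ha)]
  simp

theorem gen_one_mul (s : V) (h h' : C(Γ.PathSpace S, ℂ)) :
    gen 1 s h * gen 1 s h' = gen 1 s (h * h') := by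
  refine (gen_mul (s'' := s) (h'' := h * h') (fun a _ => ?_) fun a h1 h2 => ?_).trans
    (by rw [one_mul])
  · simp only [gact_one, chi_apply, ContinuousMap.mul_apply]
    split_ifs <;> ring
  · rw [one_mul, ← gact_one (gact 1 a), h2] at h1
    exact absurd rfl h1

theorem star_gen_one (s : V) (h : C(Γ.PathSpace S, ℂ)) :
    star (gen 1 s h) = gen 1 s (star h) := by
  refine (star_gen (s' := s) (h' := star h) fun a _ => ?_).trans (by rw [inv_one])
  simp only [inv_one, gact_one, chi_apply, ContinuousMap.star_apply]
  split_ifs <;> simp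

theorem star_genVertex (u : V) : star (genVertex u : Γ.toeplitzAlgebra S) = genVertex u := by
  rw [genVertex, star_gen_one, star_one]

theorem genVertex_mul_self (u : V) :
    (genVertex u * genVertex u : Γ.toeplitzAlgebra S) = genVertex u := by
  rw [genVertex, gen_one_mul, one_mul]

theorem genVertex_mul_of_ne {u w : V} (huw : u ≠ w) :
    (genVertex u * genVertex w : Γ.toeplitzAlgebra S) = 0 := by
  refine (gen_mul (s'' := u) (h'' := 0) (fun a _ => ?_) fun a _ _ => mul_zero _).trans (gen_zero _ _)
  rw [gact_one]
  by_cases ha : a.1 (u, [])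
  · rw [chi_of_notMem fun hw => huw (a.2.origin_unique _ _ _ _ ha hw)]
    simp
  · rw [chi_of_notMem ha]
    simp

theorem star_genEdge_mul_self (e : E) :
    star (genEdge e : Γ.toeplitzAlgebra S) * genEdge e = genVertex (Γ.t e) := by
  rw [star_genEdge, genEdge, genVertex]
  refine (gen_mul (s'' := Γ.t e) (h'' := 1) (fun a ha => ?_) fun a _ h2 => ?_).trans
    (by rw [inv_mul_cancel])
  · rw [gact_of_inv, gact_of, shift_ne_zero_iff_false] at ha
    rw [gact_of, chi_of_mem ((shift (e, true) a).2.nil_mem ha)]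
    simp
  · rw [gact_of_inv, gact_of, ← not_ne_iff, shift_ne_zero_iff_false, shift_true_cons] at h2
    rw [chi_of_notMem fun ha => h2 ⟨rfl, rfl, ha⟩, zero_mul]

theorem star_genEdge_mul_of_ne {e f : E} (hef : e ≠ f) :
    star (genEdge e : Γ.toeplitzAlgebra S) * genEdge f = 0 := by
  rw [star_genEdge, genEdge]
  refine (gen_mul (s'' := Γ.t e) (h'' := 0) (fun a ha => ?_) fun a _ _ => mul_zero _).trans
    (gen_zero _ _)
  rw [gact_of_inv, gact_of, shift_ne_zero_iff_false, shift_true_cons] at ha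
  exact absurd ha.2.1 hef

theorem genEdge_mul_genVertex (e : E) :
    (genEdge e * genVertex (Γ.t e) : Γ.toeplitzAlgebra S) = genEdge e := by
  refine (gen_mul (s'' := Γ.t e) (h'' := 1) (fun a _ => ?_) fun a h1 h2 => ?_).trans
    (by rw [mul_one]; rfl)
  · simp only [gact_one, chi_apply, ContinuousMap.one_apply]
    split_ifs <;> ring
  · rw [mul_one] at h1
    rw [gact_one] at h2
    exact absurd h2 h1

theorem genVertex_mul_genEdge (e : E) :
    (genVertex (Γ.o e) * genEdge e : Γ.toeplitzAlgebra S) = genEdge e := by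
  refine (gen_mul (s'' := Γ.t e) (h'' := 1) (fun a ha => ?_) fun a h1 h2 => ?_).trans
    (by rw [one_mul]; rfl)
  · rw [gact_one, gact_of, shift_ne_zero_iff_true] at ha
    rw [gact_of, chi_of_mem (shift_true_nil.2 ⟨rfl, ha⟩)]
    simp
  · rw [one_mul] at h1
    rw [gact_one] at h2
    exact absurd h2 h1

/-- Conjugation with the partial isometry of an edge `e` maps the indicator function of `V(μ)` to that
of `V(eμ)`. -/
theorem genEdge_mul_mul_star (e : E) (μ : List E) :
    (genEdge e : Γ.toeplitzAlgebra S) * gen 1 (Γ.t e) (chi (Γ.t e, μ)) * star (genEdge e) =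
      gen 1 (Γ.o e) (chi (Γ.o e, e :: μ)) := by
  have h1 : (genEdge e : Γ.toeplitzAlgebra S) * gen 1 (Γ.t e) (chi (Γ.t e, μ)) =
      gen (S := S) (FreeGroup.of e) (Γ.t e) (chi (Γ.t e, μ)) := by
    refine (gen_mul (s'' := Γ.t e) (h'' := chi (Γ.t e, μ)) (fun a _ => ?_) fun a h1 h2 => ?_).trans
      (by rw [mul_one])
    · simp only [gact_one, chi_apply, ContinuousMap.one_apply]
      split_ifs <;> ring
    · rw [mul_one] at h1
      rw [gact_one] at h2
      exact absurd h2 h1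
  rw [h1, star_genEdge]
  refine (gen_mul (s'' := Γ.o e) (h'' := chi (Γ.o e, e :: μ)) (fun a ha => ?_)
    fun a _ h2 => ?_).trans (by rw [mul_inv_cancel])
  · rw [gact_of, gact_of_inv, shift_ne_zero_iff_true] at ha
    have hmem : a.1 (Γ.o e, e :: μ) ↔ (shift (e, false) a).1 (Γ.t e, μ) :=
      (shift_false.trans (and_iff_right rfl)).symm
    rw [gact_of_inv, chi_of_mem ha, chi_apply (_, μ), chi_apply (_, e :: μ)]
    simp only [hmem, ContinuousMap.one_apply]
    ring
  · rw [gact_of, gact_of_inv, ← not_ne_iff, shift_ne_zero_iff_true, shift_false] at h2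
    rw [chi_of_notMem (κ := (Γ.o e, e :: μ)) fun ha => h2 ⟨rfl, a.2.of_append _ [e] μ ha⟩, mul_zero]

theorem genEdge_mul_star (e : E) :
    genEdge e * star (genEdge e : Γ.toeplitzAlgebra S) = gen 1 (Γ.o e) (chi (Γ.o e, [e])) := by
  rw [← genEdge_mul_mul_star, show gen (S := S) 1 (Γ.t e) (chi (Γ.t e, [])) = genVertex (Γ.t e) from
    gen_congr fun a _ => ?_, genEdge_mul_genVertex]
  simp only [chi_apply, ContinuousMap.one_apply]
  split_ifs <;> ring

/-- A path starting at a vertex of `S` has exactly one first edge. -/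
theorem genVertex_eq_sum {u : V} (hu : u ∈ S) (hfin : (Γ.outEdges u).Finite) :
    (genVertex u : Γ.toeplitzAlgebra S) =
      ∑ e ∈ hfin.toFinset, genEdge e * star (genEdge e : Γ.toeplitzAlgebra S) := by
  let φ : C(Γ.PathSpace S, ℂ) →+ Γ.toeplitzAlgebra S :=
    { toFun := gen 1 u
      map_zero' := gen_zero 1 u
      map_add' := gen_add 1 u }
  have h1 : ∀ e ∈ hfin.toFinset, genEdge e * star (genEdge e : Γ.toeplitzAlgebra S) =
      φ (chi (u, [e])) := by
    intro e he
    obtain rfl : Γ.o e = u := by simpa [outEdges] using he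
    exact genEdge_mul_star e
  rw [Finset.sum_congr rfl h1, ← map_sum]
  refine gen_congr fun a _ => ?_
  by_cases ha : a.1 (u, [])
  · obtain ⟨e, he⟩ := a.2.exit u [] u ha rfl hu
    rw [List.nil_append] at he
    have ho : ∀ f, a.1 (u, [f]) → Γ.o f = u := by
      intro f hf
      obtain ⟨w, hw⟩ := a.2.walk _ _ hf
      exact (dWalk_cons.1 hw).1
    rw [ContinuousMap.sum_apply, Finset.sum_eq_single e, chi_of_mem he, ContinuousMap.one_apply]
    · intro f _ hfe
      refine chi_of_notMem fun hf => hfe ?_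
      simpa [eq_comm] using a.2.comparable _ _ _ he hf
    · intro hne
      exact absurd (by simpa [outEdges] using ho e he) hne
  · rw [chi_of_notMem ha, zero_mul, zero_mul]

/-- The elements `genEdge e` and `genVertex u` generate the Toeplitz graph algebra. -/
theorem toeplitzAlgebra_induction {P : Γ.toeplitzAlgebra S → Prop} (hs : ∀ e, P (genEdge e))
    (hp : ∀ u, P (genVertex u)) (hzero : P 0) (hadd : ∀ a b, P a → P b → P (a + b))
    (hsmul : ∀ (c : ℂ) a, P a → P (c • a)) (hmul : ∀ a b, P a → P b → P (a * b))
    (hstar : ∀ a, P a → P (star a)) (hclosed : IsClosed {a | P a}) (a : Γ.toeplitzAlgebra S) :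
    P a := by
  classical
  -- the diagonal, over the vertex `s`
  have hdiag : ∀ s h, P (gen 1 s h) := by
    intro s
    let φ : C(Γ.PathSpace S, ℂ) →⋆ₙₐ[ℂ] Γ.toeplitzAlgebra S :=
      { toFun := gen 1 s
        map_zero' := gen_zero 1 s
        map_add' := gen_add 1 s
        map_smul' := gen_smul 1 s
        map_mul' := fun h h' => (gen_one_mul s h h').symm
        map_star' := fun h => (star_gen_one s h).symm }
    have hφ : Continuous φ := AddMonoidHomClass.continuous_of_bound φ 1 fun f => by
      rw [one_mul]
      exact NonUnitalStarAlgHom.norm_apply_le φ f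
    have hchi : ∀ u μ, P (gen 1 u (chi (u, μ))) := by
      intro u μ
      induction μ generalizing u with
      | nil =>
        rw [show gen (S := S) 1 u (chi (u, [])) = genVertex u from gen_congr fun a _ => ?_]
        · exact hp u
        · simp only [chi_apply, ContinuousMap.one_apply]
          split_ifs <;> ring
      | cons e μ ih =>
        by_cases ho : Γ.o e = u
        · subst ho
          rw [← genEdge_mul_mul_star]
          exact hmul _ _ (hmul _ _ (hs e) (ih _)) (hstar _ (hs e))
        · rw [show gen (S := S) 1 u (chi (u, e :: μ)) = gen 1 u 0 from gen_congr fun a _ => ?_,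
            gen_zero]
          · exact hzero
          · rw [chi_of_notMem (κ := (u, e :: μ)), ContinuousMap.zero_apply]
            intro ha
            obtain ⟨w, hw⟩ := a.2.walk _ _ ha
            exact ho (dWalk_cons.1 hw).1
    refine fun h => chi_induction (P := fun h => P (φ h)) ?_ ?_ ?_ ?_ ?_ (hclosed.preimage hφ) h
    · rintro ⟨u, μ⟩
      by_cases hu : u = s
      · subst hu
        exact hchi u μ
      · have h0 : φ (chi (u, μ)) = gen 1 s 0 := gen_congr fun a _ => by
          rw [ContinuousMap.zero_apply, mul_zero]
          by_cases ha : a.1 (u, μ)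
          · rw [chi_of_notMem fun h => hu (a.2.origin_unique _ _ _ _ ha h), zero_mul]
          · rw [chi_of_notMem ha, mul_zero]
        rw [h0, gen_zero]
        exact hzero
    · intro c
      rw [Algebra.algebraMap_eq_smul_one, map_smul]
      exact hsmul _ _ (hp s)
    · intro f g hf hg
      rw [map_add]
      exact hadd _ _ hf hg
    · intro f g hf hg
      rw [map_mul]
      exact hmul _ _ hf hg
    · intro f hf
      rw [map_star]
      exact hstar _ hf
  -- the other singles, by splitting off the first letter of the word
  have hgen : ∀ (w : List (E × Bool)) (g : FreeGroup E), g.toWord = w → ∀ s h, P (gen g s h) := by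
    intro w
    induction w with
    | nil =>
      intro g hg s h
      rw [FreeGroup.toWord_eq_nil_iff] at hg
      subst hg
      exact hdiag s h
    | cons l w ih =>
      intro g hg s h
      have hw : (FreeGroup.mk w).toWord = w := by
        rw [FreeGroup.toWord_mk]
        refine FreeGroup.IsReduced.reduce_eq (FreeGroup.IsReduced.infix
          (FreeGroup.isReduced_toWord (x := g)) ?_)
        rw [hg]
        exact (List.suffix_cons l w).isInfix
      have hact : ∀ a : Γ.PathSpace S, gact g a = shift l (gact (FreeGroup.mk w) a) := by
        intro a
        have h1 : gact g a = PathSpace.act g.toWord a := rfl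
        have h2 : gact (FreeGroup.mk w) a = PathSpace.act (FreeGroup.mk w).toWord a := rfl
        rw [h1, h2, hg, hw, act_cons]
      have hgw : g = FreeGroup.mk [l] * FreeGroup.mk w := by
        rw [FreeGroup.mul_mk, List.singleton_append, ← hg, FreeGroup.mk_toWord]
      obtain ⟨e, _ | _⟩ := l
      · have hl : FreeGroup.mk [(e, false)] = (FreeGroup.of e)⁻¹ := rfl
        rw [hl] at hgw
        have : gen g s h = star (genEdge e) * gen (FreeGroup.mk w) s h := by
          rw [star_genEdge]
          refine Eq.symm ((gen_mul (fun a ha => ?_) fun a h1 h2 => ?_).trans (by rw [← hgw]))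
          · rw [gact_of_inv, shift_ne_zero_iff_false] at ha
            rw [chi_of_mem ((gact (FreeGroup.mk w) a).2.nil_mem ha)]
            simp
          · rw [← hgw, hact, ← gact_of_inv, h2] at h1
            exact absurd rfl h1
        rw [this]
        exact hmul _ _ (hstar _ (hs e)) (ih _ hw s h)
      · have hl : FreeGroup.mk [(e, true)] = FreeGroup.of e := rfl
        rw [hl] at hgw
        have : gen g s h = genEdge e * gen (FreeGroup.mk w) s h := by
          refine Eq.symm ((gen_mul (fun a ha => ?_) fun a h1 h2 => ?_).trans (by rw [← hgw]))
          · rw [gact_of, shift_ne_zero_iff_true] at ha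
            rw [chi_of_mem ha]
            simp
          · rw [← hgw, hact, ← gact_of, h2] at h1
            exact absurd rfl h1
        rw [this]
        exact hmul _ _ (hs e) (ih _ hw s h)
  -- every function of compact support is a finite sum of singles
  have hsum : ∀ f : C_c(Γ.ToeplitzGroupoid S, ℂ), f = ∑ σ ∈ (finite_path_support f).toFinset,
      single σ.2.2.word σ.2.1 (hatC f σ.2.2.word) := by
    intro f
    ext γ
    have key : ∀ σ : Σ r s : V, Γ.GPath r s,
        single σ.2.2.word σ.2.1 (hatC f σ.2.2.word) γ = if σ = γ.path then f γ else 0 := by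
      rintro ⟨r, s, α⟩
      rw [single_apply]
      by_cases hσ : γ.path = ⟨r, s, α⟩
      · obtain ⟨h1, h2⟩ := path_eq_iff.1 hσ
        have hs : (pathSet γ.source).1 (s, []) := h1 ▸ pathSet_nil γ.source
        rw [if_pos h2, if_pos hσ.symm, hatC_apply, ← h2, hat_apply]
        change chi (s, []) _ * _ = _
        rw [chi_of_mem hs, one_mul]
      · rw [if_neg (Ne.symm hσ)]
        split_ifs with hw
        · rw [chi_of_notMem, zero_mul]
          intro hs
          exact hσ (path_eq_iff.2 ⟨PathSpace.origin_unique _ (pathSet_nil γ.source) hs, hw⟩)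
        · rfl
    rw [CompactlySupportedContinuousMap.sum_apply]
    simp_rw [key]
    rw [Finset.sum_ite_eq']
    split_ifs with hmem
    · rfl
    · by_contra hne
      exact hmem (by simpa using ⟨γ, hne, rfl⟩)
  refine isClosed_property (denseRange_toToeplitzAlgebra (Γ := Γ) (S := S)) hclosed
    (fun f => ?_) a
  rw [hsum f]
  change P (toToeplitzAlgebraₗ _)
  rw [map_sum]
  exact Finset.sum_induction _ P hadd hzero fun σ _ => hgen _ _ rfl _ _

end Generators

/-! ### Strong sums of orthogonal projections -/

section StrongSum

variable {H : Type*} [NormedAddCommGroup H] [InnerProductSpace ℂ H] [CompleteSpace H]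
  {ι : Type*}

/-- A family of mutually orthogonal projections is summable in the strong operator topology. -/
theorem exists_hasSum_of_orthogonal {e : ι → H →L[ℂ] H} (he : ∀ i, IsStarProjection (e i))
    (horth : ∀ i j, i ≠ j → e i * e j = 0) :
    ∃ q : H →L[ℂ] H, IsStarProjection q ∧ ∀ ξ, HasSum (fun i => e i ξ) (q ξ) := by
  have hmul : ∀ F G : Finset ι, F ⊆ G → (∑ i ∈ G, e i) * ∑ j ∈ F, e j = ∑ j ∈ F, e j := by
    intro F G hFG
    rw [Finset.sum_mul_sum, Finset.sum_comm]
    refine Finset.sum_congr rfl fun j hj => ?_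
    rw [Finset.sum_eq_single j (fun i _ hij => horth i j hij) fun h => absurd (hFG hj) h]
    exact (he j).isIdempotentElem
  have hproj : ∀ F : Finset ι, IsStarProjection (∑ i ∈ F, e i) := fun F =>
    ⟨hmul F F subset_rfl, isSelfAdjoint_sum F fun i _ => (he i).isSelfAdjoint⟩
  let U : Finset ι → Submodule ℂ H := fun F => (∑ i ∈ F, e i).range
  have hU : ∀ F, ∃ _ : (U F).HasOrthogonalProjection, ∑ i ∈ F, e i = (U F).starProjection :=
    fun F => isStarProjection_iff_eq_starProjection_range.1 (hproj F)
  have hUo : ∀ F, (U F).HasOrthogonalProjection := fun F => (hU F).1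
  have hmono : Monotone U := by
    rintro F G hFG _ ⟨ξ, rfl⟩
    refine ⟨(∑ j ∈ F, e j) ξ, ?_⟩
    exact DFunLike.congr_fun (hmul F G hFG) ξ
  refine ⟨(⨆ F, U F).topologicalClosure.starProjection,
    isStarProjection_iff_eq_starProjection.2 ⟨_, inferInstance, rfl⟩,
    fun ξ => ?_⟩
  have hlim := Submodule.starProjection_tendsto_closure_iSup U hmono ξ
  refine hlim.congr fun F => ?_
  have := DFunLike.congr_fun (hU F).2 ξ
  rw [sum_apply] at this
  exact this.symm

omit [CompleteSpace H] in
theorem mul_eq_of_hasSum {e : ι → H →L[ℂ] H} {q T : H →L[ℂ] H}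
    (hq : ∀ ξ, HasSum (fun i => e i ξ) (q ξ)) (hT : ∀ i, T * e i = e i) : T * q = q := by
  ext ξ
  have h1 := (hq ξ).mapL T
  simp only [← mul_apply_eq_comp, hT] at h1
  exact h1.unique (hq ξ)

theorem mul_eq_of_hasSum_of_orthogonal {e : ι → H →L[ℂ] H} {q : H →L[ℂ] H}
    (hq : ∀ ξ, HasSum (fun i => e i ξ) (q ξ)) (he : ∀ i, IsStarProjection (e i))
    (horth : ∀ i j, i ≠ j → e i * e j = 0) (j : ι) : q * e j = e j := by
  ext ξ
  refine (hq (e j ξ)).unique ?_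
  have h1 := hasSum_single (f := fun i => e i (e j ξ)) j fun i hij => by
    rw [← mul_apply_eq_comp, horth i j hij, zero_apply]
  rwa [← mul_apply_eq_comp (e j), (he j).isIdempotentElem.eq] at h1

end StrongSum

/-! ### The bijection -/

section Main

universe u v
variable {V : Type u} {E : Type v} {Γ : DirectedGraph V E} {S : Set V}
  [CompactSpace (Γ.PathSpace S)]
variable {H : Type*} [NormedAddCommGroup H] [InnerProductSpace ℂ H] [CompleteSpace H]

open ToeplitzGroupoid PathSpace

omit [CompactSpace (Γ.PathSpace S)] in
theorem continuous_representation (π : Γ.toeplitzAlgebra S →⋆ₙₐ[ℂ] (H →L[ℂ] H)) : Continuous π :=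
  AddMonoidHomClass.continuous_of_bound π 1 fun a => by
    rw [one_mul]
    exact NonUnitalStarAlgHom.norm_apply_le π a

/-- A representation of the Toeplitz graph algebra is determined by the images of the
generators. -/
theorem representation_ext {π π' : Γ.toeplitzAlgebra S →⋆ₙₐ[ℂ] (H →L[ℂ] H)}
    (hs : ∀ e, π (genEdge e) = π' (genEdge e)) (hp : ∀ u, π (genVertex u) = π' (genVertex u)) :
    π = π' := by
  ext1 a
  refine toeplitzAlgebra_induction (P := fun a => π a = π' a) hs hp ?_ ?_ ?_ ?_ ?_ ?_ a
  · rw [map_zero, map_zero]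
  · intro a b ha hb
    rw [map_add, map_add, ha, hb]
  · intro c a ha
    rw [map_smul, map_smul, ha]
  · intro a b ha hb
    rw [map_mul, map_mul, ha, hb]
  · intro a ha
    rw [map_star, map_star, ha]
  · exact isClosed_eq (continuous_representation π) (continuous_representation π')

section

variable (π : Γ.toeplitzAlgebra S →⋆ₙₐ[ℂ] (H →L[ℂ] H))

theorem isStarProjection_map_genVertex (u : V) : IsStarProjection (π (genVertex u)) :=
  ⟨by rw [IsIdempotentElem, ← map_mul, genVertex_mul_self],
    by rw [IsSelfAdjoint, ← map_star, star_genVertex]⟩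

theorem map_genVertex_mul_of_ne {u w : V} (huw : u ≠ w) :
    π (genVertex u) * π (genVertex w) = 0 := by
  rw [← map_mul, genVertex_mul_of_ne huw, map_zero]

theorem star_map_genEdge_mul_self (e : E) :
    star (π (genEdge e)) * π (genEdge e) = π (genVertex (Γ.t e)) := by
  rw [← map_star, ← map_mul, star_genEdge_mul_self]

theorem star_map_genEdge_mul_of_ne {e f : E} (hef : e ≠ f) :
    star (π (genEdge e)) * π (genEdge f) = 0 := by
  rw [← map_star, ← map_mul, star_genEdge_mul_of_ne hef, map_zero]

theorem map_genEdge_mul_map_genVertex (e : E) :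
    π (genEdge e) * π (genVertex (Γ.t e)) = π (genEdge e) := by
  rw [← map_mul, genEdge_mul_genVertex]

theorem map_genVertex_mul_map_genEdge (e : E) :
    π (genVertex (Γ.o e)) * π (genEdge e) = π (genEdge e) := by
  rw [← map_mul, genVertex_mul_genEdge]

theorem map_genEdge_partialIsometry (e : E) :
    π (genEdge e) * star (π (genEdge e)) * π (genEdge e) = π (genEdge e) := by
  rw [mul_assoc, star_map_genEdge_mul_self, map_genEdge_mul_map_genVertex]

theorem map_genVertex_eq_sum {u : V} (hu : u ∈ S) (hfin : (Γ.outEdges u).Finite) :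
    π (genVertex u) = ∑ e ∈ hfin.toFinset, π (genEdge e) * star (π (genEdge e)) := by
  rw [genVertex_eq_sum hu hfin, map_sum]
  refine Finset.sum_congr rfl fun f _ => ?_
  rw [map_mul, map_star]

/-- A projection that is a unit for the projections of the vertices is a unit for the image of the
Toeplitz graph algebra. -/
theorem mul_map_of_mul_map_genVertex {q : H →L[ℂ] H} (hq : star q = q)
    (hqp : ∀ u, q * π (genVertex u) = π (genVertex u)) (a : Γ.toeplitzAlgebra S) :
    q * π a = π a := by
  have hpq : ∀ u, π (genVertex u) * q = π (genVertex u) := fun u => by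
    have := congrArg star (hqp u)
    rwa [star_mul, hq, (isStarProjection_map_genVertex π u).isSelfAdjoint.star_eq] at this
  refine (toeplitzAlgebra_induction (P := fun a => q * π a = π a ∧ π a * q = π a)
    ?_ ?_ ?_ ?_ ?_ ?_ ?_ ?_ a).1
  · intro e
    constructor
    · rw [← map_genVertex_mul_map_genEdge, ← mul_assoc, hqp]
    · rw [← map_genEdge_mul_map_genVertex, mul_assoc, hpq]
  · exact fun u => ⟨hqp u, hpq u⟩
  · rw [map_zero, mul_zero, zero_mul]
    exact ⟨rfl, rfl⟩
  · rintro a b ⟨h1, h2⟩ ⟨h3, h4⟩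
    rw [map_add]
    exact ⟨(mul_add _ _ _).trans (congrArg₂ (· + ·) h1 h3),
      (add_mul _ _ _).trans (congrArg₂ (· + ·) h2 h4)⟩
  · rintro c a ⟨h1, h2⟩
    have h3 : π (c • a) = c • π a := map_smul π c a
    rw [h3]
    exact ⟨(mul_smul_comm c q (π a)).trans (congrArg (c • ·) h1),
      (smul_mul_assoc c (π a) q).trans (congrArg (c • ·) h2)⟩
  · rintro a b ⟨h1, -⟩ ⟨-, h4⟩
    rw [map_mul]
    exact ⟨(mul_assoc _ _ _).symm.trans (congrArg (· * π b) h1),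
      (mul_assoc _ _ _).trans (congrArg (π a * ·) h4)⟩
  · rintro a ⟨h1, h2⟩
    have h3 := congrArg star h1
    have h4 := congrArg star h2
    rw [star_mul, hq, ← map_star] at h3 h4
    exact ⟨h4, h3⟩
  · have hc := continuous_representation π
    exact (isClosed_eq (continuous_const.mul hc) hc).inter
      (isClosed_eq (hc.mul continuous_const) hc)

/-- The sum of the projections of the vertices is a projection which acts as a unit on the image of the
representation, hence is the identity by nondegeneracy. -/
theorem hasSum_map_genVertex (hπ : Nondegenerate π) (ξ : H) :
    HasSum (fun u => π (genVertex u) ξ) ξ := by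
  obtain ⟨q, hq, hsum⟩ := exists_hasSum_of_orthogonal (isStarProjection_map_genVertex π)
    fun u w huw => map_genVertex_mul_of_ne π huw
  have hqp := mul_eq_of_hasSum_of_orthogonal hsum (isStarProjection_map_genVertex π)
    fun u w huw => map_genVertex_mul_of_ne π huw
  have hunit := mul_map_of_mul_map_genVertex π hq.isSelfAdjoint.star_eq hqp
  have hcl : IsClosed ((LinearMap.eqLocus q.toLinearMap LinearMap.id : Submodule ℂ H) : Set H) :=
    isClosed_eq q.continuous continuous_id
  have hle : Submodule.span ℂ {η : H | ∃ a ξ, π a ξ = η} ≤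
      LinearMap.eqLocus q.toLinearMap LinearMap.id := by
    rw [Submodule.span_le]
    rintro _ ⟨a, ξ, rfl⟩
    exact DFunLike.congr_fun (hunit a) ξ
  have hξ : ξ ∈ (Submodule.span ℂ {η : H | ∃ a ξ, π a ξ = η}).topologicalClosure := by
    rw [show _ = ⊤ from hπ]
    trivial
  have hqξ : q ξ = ξ := Submodule.topologicalClosure_minimal _ hle hcl hξ
  have h1 := hsum ξ
  rwa [hqξ] at h1

/-- The final projections of the edges with origin `u` are orthogonal subprojections of that of `u`, so
their strong sum exists and is bounded by it. -/
theorem exists_hasSum_map_genEdge (hS : S ⊆ Γ.regular) (u : V) :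
    ∃ q : H →L[ℂ] H, (∀ ξ : H, HasSum (fun f : {f // Γ.o f = u} =>
      (π (genEdge f.1) * star (π (genEdge f.1))) ξ) (q ξ)) ∧
      q ≤ π (genVertex u) ∧ (u ∈ S → q = π (genVertex u)) := by
  have hproj : ∀ f : {f // Γ.o f = u},
      IsStarProjection (π (genEdge f.1) * star (π (genEdge f.1))) := fun f =>
    ⟨by rw [IsIdempotentElem, ← mul_assoc, map_genEdge_partialIsometry], .mul_star_self _⟩
  have horth : ∀ f g : {f // Γ.o f = u}, f ≠ g → π (genEdge f.1) * star (π (genEdge f.1)) *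
      (π (genEdge g.1) * star (π (genEdge g.1))) = 0 := by
    intro f g hfg
    rw [mul_assoc, ← mul_assoc (star _),
      star_map_genEdge_mul_of_ne π fun h => hfg (Subtype.ext h), zero_mul, mul_zero]
  obtain ⟨q, hq, hsum⟩ := exists_hasSum_of_orthogonal hproj horth
  refine ⟨q, hsum, ?_, fun hu => ?_⟩
  · rw [hq.le_iff_mul_eq_right (isStarProjection_map_genVertex π u)]
    refine mul_eq_of_hasSum hsum fun f => ?_
    obtain ⟨f, rfl⟩ := f
    rw [← mul_assoc, map_genVertex_mul_map_genEdge]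
  · have hfin := (hS hu).2
    have : Fintype {f // Γ.o f = u} := hfin.fintype
    ext ξ
    rw [(hsum ξ).unique (hasSum_fintype _), map_genVertex_eq_sum π hu hfin, sum_apply]
    refine (Finset.sum_subtype _ (fun f => ?_)
      fun f => (π (genEdge f) * star (π (genEdge f))) ξ).symm
    rw [Set.Finite.mem_toFinset]
    rfl

/-- The images of the generators under a nondegenerate representation form a Toeplitz family. -/
theorem isToeplitzFamily_of_nondegenerate (hS : S ⊆ Γ.regular) (hπ : Nondegenerate π) :
    Γ.IsToeplitzFamily S (fun e => π (genEdge e)) fun u => π (genVertex u) where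
  partialIsometry := map_genEdge_partialIsometry π
  projection := isStarProjection_map_genVertex π
  orthogonal _ _ := map_genVertex_mul_of_ne π
  sum_eq_one := hasSum_map_genVertex π hπ
  initial := star_map_genEdge_mul_self π
  final := exists_hasSum_map_genEdge π hS

end

omit [CompactSpace (Γ.PathSpace S)] in
theorem mem_supp_reach_base (γ : Γ.ToeplitzGroupoid S) :
    γ.x ∈ Spectrum.supp ((Γ.cover γ.s).reach (Γ.base γ.s)) := by
  have h := (pathSet_iff.1 (pathSet_nil γ.source)).2
  rw [pos_nil] at h
  change (Γ.cover γ.s).reach (Γ.base γ.s) ∈ γ.x.1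
  rw [reach_eq_cone]
  exact h

theorem coe_single_edge (e : E) :
    (single (FreeGroup.of e) (Γ.t e) 1 : Γ.ToeplitzGroupoid S → ℂ) =
      Set.indicator (Γ.edgeSet S e) 1 := by
  classical
  funext γ
  have hmem : γ ∈ Γ.edgeSet S e ↔ γ.s = Γ.t e ∧ γ.word = FreeGroup.of e :=
    (and_iff_left (mem_supp_reach_base γ)).trans path_eq_iff
  rw [single_apply, Set.indicator_apply]
  by_cases hw : γ.word = FreeGroup.of e
  · by_cases hs : γ.s = Γ.t e
    · rw [if_pos hw, if_pos (hmem.2 ⟨hs, hw⟩), chi_of_mem (hs ▸ pathSet_nil γ.source)]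
      simp
    · rw [if_pos hw, if_neg fun h => hs (hmem.1 h).1, chi_of_notMem, zero_mul]
      exact fun h => hs (PathSpace.origin_unique _ (pathSet_nil γ.source) h)
  · rw [if_neg hw, if_neg fun h => hw (hmem.1 h).2]

theorem coe_single_vertex (u : V) :
    (single 1 u 1 : Γ.ToeplitzGroupoid S → ℂ) = Set.indicator (Γ.vertexSet S u) 1 := by
  classical
  funext γ
  have hmem : γ ∈ Γ.vertexSet S u ↔ γ.s = u ∧ γ.word = 1 :=
    (and_iff_left (mem_supp_reach_base γ)).trans path_eq_iff
  rw [single_apply, Set.indicator_apply]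
  by_cases hw : γ.word = 1
  · by_cases hs : γ.s = u
    · rw [if_pos hw, if_pos (hmem.2 ⟨hs, hw⟩), chi_of_mem (hs ▸ pathSet_nil γ.source)]
      simp
    · rw [if_pos hw, if_neg fun h => hs (hmem.1 h).1, chi_of_notMem, zero_mul]
      exact fun h => hs (PathSpace.origin_unique _ (pathSet_nil γ.source) h)
  · rw [if_neg hw, if_neg fun h => hw (hmem.1 h).2]

end Main

end DirectedGraph

end

theorem theorem2p20 {V : Type*} {E : Type*} (Γ : DirectedGraph V E) (S : Set V)
    (hS : S ⊆ Γ.regular) :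
    ∃ (s : E → C_c(Γ.ToeplitzGroupoid S, ℂ)) (p : V → C_c(Γ.ToeplitzGroupoid S, ℂ)),
      (∀ e, (s e : Γ.ToeplitzGroupoid S → ℂ) = Set.indicator (Γ.edgeSet S e) 1) ∧
      (∀ u, (p u : Γ.ToeplitzGroupoid S → ℂ) = Set.indicator (Γ.vertexSet S u) 1) ∧
      ∀ (H : Type*) [NormedAddCommGroup H] [InnerProductSpace ℂ H] [CompleteSpace H],
        Set.BijOn
          (fun π : Γ.toeplitzAlgebra S →⋆ₙₐ[ℂ] (H →L[ℂ] H) =>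
            ((fun e => π (Γ.toToeplitzAlgebra (s e)), fun u => π (Γ.toToeplitzAlgebra (p u))) :
              (E → H →L[ℂ] H) × (V → H →L[ℂ] H)))
          {π | DirectedGraph.Nondegenerate π}
          {F | Γ.IsToeplitzFamily S F.1 F.2} := by
  have := DirectedGraph.compactSpace_pathSpace hS
  refine ⟨fun e => DirectedGraph.ToeplitzGroupoid.single (FreeGroup.of e) (Γ.t e) 1,
    fun u => DirectedGraph.ToeplitzGroupoid.single 1 u 1, DirectedGraph.coe_single_edge,
    DirectedGraph.coe_single_vertex, fun H _ _ _ => ⟨fun π hπ => ?_, fun π _ π' _ h => ?_, ?_⟩⟩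
  · exact DirectedGraph.isToeplitzFamily_of_nondegenerate π hS hπ
  · exact DirectedGraph.representation_ext (fun e => congrFun (congrArg Prod.fst h) e)
      fun u => congrFun (congrArg Prod.snd h) u
  · rintro ⟨s, p⟩ h
    obtain ⟨π, hπ, hs, hp⟩ := h.exists_representation hS
    exact ⟨π, hπ, Prod.ext (funext hs) (funext hp)⟩
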